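/- Let $r_1,r_2\ge 0$ be integers and let $V=\mathbb R^{r_1}\times\mathbb C^{r_2}$ (for example $V=k\otimes_{\mathbb Q}\mathbb R$ for a number field $k$ with $r_1$ real and $r_2$ complex places), with the product $\mathrm{Leb}$ of the Lebesgue measures on the factors. For $v=(v_1,\dots,v_{r_1+r_2})\in V$ put $\|v\|=\prod_{i=1}^{r_1}|v_i|\prod_{i=r_1+1}^{r_1+r_2}|v_i|^2$, and let $V^\times=\{v\in V:\|v\|\neq 0\}$. Let $\mathcal P_c$ be the set of compactly supported Borel probability measures on $V$ that are absolutely continuous with respect to $\mathrm{Leb}$ with density at most $1$ almost everywhere, and for $\mu\in\mathcal P_c$ let $$I(\mu)=\int_{V\times V}\log\|x-y\|\,d\mu(x)\,d\mu(y).$$ Let $\nu\in\mathcal P_c$ satisfy $I(\nu)\le I(\mu)$ for every $\mu\in\mathcal P_c$. Then there exists an open set $U\subset V$ such that $\nu=\mathrm{Leb}|_U$, i.e. $\nu(A)=\mathrm{Leb}(A\cap U)$ for every Borel set $A$; and moreover there exists $v\in V$ such that 1. $(\partial U-v)\cap V^\times$ is a submanifold of codimension $1$ and of class $C^1$, i.e.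 each of its points has an open neighbourhood $W$ in $V$ on which it is the zero set of a $C^1$ function $f:W\to\mathbb R$ whose derivative does not vanish on $W$; 2. $\lambda(\overline U-v)\subset U-v$ for every $0<\lambda<1$. -/

import Mathlib

open MeasureTheory Set
open scoped Pointwise

namespace LogNormEnergy

/-- The real vector space `ℝ^{r₁} × ℂ^{r₂}`, with the real coordinates indexed by `ι` and the complex
coordinates by `κ`. If `ι` and `κ` are the sets of real and of complex places of a number field `k`,
this is `k ⊗_ℚ ℝ` (Mathlib's `NumberField.mixedEmbedding.mixedSpace k`). Its `volume` is the product
of the Lebesgue measures of the factors. -/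
abbrev V (ι κ : Type*) : Type _ := (ι → ℝ) × (κ → ℂ)

variable {ι κ : Type*} [Fintype ι] [Fintype κ]

/-- `‖v‖ = ∏_{i real} |v_i| * ∏_{j complex} |v_j|²`. -/
noncomputable def normV (v : V ι κ) : ℝ := (∏ i, |v.1 i|) * ∏ j, ‖v.2 j‖ ^ 2

open scoped Classical in
/-- On the space attached to a number field, `normV` is the usual norm. -/
theorem normV_eq_norm (k : Type*) [Field k] [NumberField k]
    (v : NumberField.mixedEmbedding.mixedSpace k) :
    normV v = NumberField.mixedEmbedding.norm v := by
  rw [NumberField.mixedEmbedding.norm_apply, NumberField.InfinitePlace.prod_eq_prod_mul_prod]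
  refine congrArg₂ (· * ·) ?_ ?_
  · refine Finset.prod_congr rfl fun w _ => ?_
    rw [NumberField.mixedEmbedding.normAtPlace_apply_of_isReal w.2,
      NumberField.InfinitePlace.mult_isReal, pow_one, Real.norm_eq_abs]
  · refine Finset.prod_congr rfl fun w _ => ?_
    rw [NumberField.mixedEmbedding.normAtPlace_apply_of_isComplex w.2,
      NumberField.InfinitePlace.mult_isComplex]

variable (ι κ) in
/-- `V^× = {v ∈ V : ‖v‖ ≠ 0}`. -/
def VUnits : Set (V ι κ) := {v | normV v ≠ 0}

/-- The energy `I(ν) = ∫_{V × V} log ‖x - y‖ dν(x) dν(y)`. The integral converges absolutely for all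
compactly supported measures of bounded density. -/
noncomputable def energy (ν : Measure (V ι κ)) : ℝ :=
  ∫ p, Real.log (normV (p.1 - p.2)) ∂(ν.prod ν)

/-- Compactly supported probability measures on `V` that are absolutely continuous with respect to
Lebesgue measure, with density at most `1` almost everywhere. -/
structure IsAdmissible (ν : Measure (V ι κ)) : Prop where
  isProbabilityMeasure : IsProbabilityMeasure ν
  isCompact_support : IsCompact ν.support
  absolutelyContinuous : ν ≪ volume
  density_le_one : ∀ᵐ x ∂volume, ν.rnDeriv volume x ≤ 1

/-- `ν` has minimal energy among all admissible measures. -/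
def IsEnergyMinimizer (ν : Measure (V ι κ)) : Prop :=
  IsAdmissible ν ∧ ∀ μ : Measure (V ι κ), IsAdmissible μ → energy ν ≤ energy μ

/-- `S` is an (embedded) submanifold of `E` of codimension `1` and of class `C^1`: near each of its
points it is the zero set of a real-valued `C^1` function without critical points. -/
def IsC1Hypersurface {E : Type*} [NormedAddCommGroup E] [NormedSpace ℝ E] (S : Set E) : Prop :=
  ∀ x ∈ S, ∃ W : Set E, IsOpen W ∧ x ∈ W ∧ ∃ f : E → ℝ, ContDiffOn ℝ 1 f W ∧
    (∀ y ∈ W, fderiv ℝ f y ≠ 0) ∧ S ∩ W = {y ∈ W | f y = 0}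

end LogNormEnergy

namespace LogNormEnergy

/-! ### Logarithmic potentials of measures with small balls -/

section LogPotential

set_option linter.unusedSectionVars false

variable {Ω E : Type*} [MeasurableSpace Ω] [NormedAddCommGroup E] [MeasurableSpace E]
  [BorelSpace E] {m : Measure Ω} {Y : Ω → E} {C α : ℝ}

/-! The energy kernel is a weighted sum of the one-coordinate kernels log |x_a - y_a|, and
admissible measures correspond to functions 0 ≤ f ≤ 1 of bounded support and integral 1
(`IsAdmissible.exists_density`, `energy_densityMeasure`).

Symmetry comes from polarization. Reflect the coordinate a in a hyperplane and split f into an even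
part A and an odd part O. Replacing O by |O| on one side and -|O| on the other gives another
probability density bounded by 1. The kernels of the other coordinates are unchanged when a single
variable is reflected, so they do not see odd parts; in the coordinate a the odd energy is minus one
half of an integral of O(x) O(y) against a kernel with the sign of level(x) level(y). Hence the
energy drops strictly unless the larger of f(x) and f(refl x) lies almost everywhere on one fixed
side (`polarDiff_nonneg_or_nonpos`), and the barycenter v tells which side. Consequently each
coordinate potential grows with |x_a - v_a|, with a gap controlled by the difference of squares
(`IsMinimalDensity.exists_isRadial`).

The first variation and the bathtub principle then show that f is the indicator of a sublevel set of
the total potential W (`IsMinimalDensity.ae_eq_indicator`); level sets of W are null because their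
sections along an axis lie on spheres about v. Strict growth of W on rays from v gives the dilation
property, and the quantitative gap makes the derivative of W nonzero wherever it exists off v.

It remains to see that W is C¹ where all coordinates of x - v are nonzero. In a complex coordinate
the potential is radial, so averaging over circles replaces log |x_a - y_a| by log max(|x_a - v_a|,
|y_a - v_a|), whose integral has derivative mass(r) / r (`contDiffOn_potential_inr`). In a real
coordinate the sections of the sublevel set are intervals of half-width h, and the derivative is an
integral of log |r + h| - log |r - h|; it is continuous because the distribution of h gives small
intervals small mass, which uses a second coordinate (`contDiffOn_potential_inl`). With only one
coordinate the boundary is an explicit sphere. -/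

/-- The positive part of `log (δ / ‖s - Y‖)` has small integral. -/
theorem lintegral_log_div_le (hY : Measurable Y) (hC : 0 ≤ C) (hα : 0 < α)
    (hm : ∀ s : E, ∀ r : ℝ, 0 < r → m {ω | ‖s - Y ω‖ < r} ≤ ENNReal.ofReal (C * r ^ α))
    (s : E) {δ : ℝ} (hδ : 0 < δ) :
    ∫⁻ ω, ENNReal.ofReal (Real.log (δ / ‖s - Y ω‖)) ∂m ≤ ENNReal.ofReal (C / α * δ ^ α) := by
  have h0 : ∀ ω, ENNReal.ofReal (Real.log (δ / ‖s - Y ω‖)) =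
      ENNReal.ofReal (max (Real.log (δ / ‖s - Y ω‖)) 0) := by
    intro ω; rw [ENNReal.ofReal_max]; simp
  simp_rw [h0]
  -- Layer-cake formula: the integrand exceeds t only where Y is within δ e^{-t} of s, so the
  -- small-ball bound gives an exponentially decaying tail.
  rw [lintegral_eq_lintegral_meas_lt m (f := fun ω => max (Real.log (δ / ‖s - Y ω‖)) 0)
      (Filter.Eventually.of_forall fun ω => le_max_right _ _)
    (by fun_prop)]
  have hexp : ∫⁻ t in Ioi (0:ℝ), ENNReal.ofReal (Real.exp (-α * t)) = ENNReal.ofReal (1 / α) := by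
    rw [← ofReal_integral_eq_lintegral_ofReal (integrableOn_exp_mul_Ioi (by linarith) 0)
      (Filter.Eventually.of_forall fun t => (Real.exp_pos _).le),
      integral_exp_mul_Ioi (by linarith)]
    congr 1
    simp [neg_div_neg_eq]
  calc ∫⁻ t in Ioi (0:ℝ), m {ω | t < max (Real.log (δ / ‖s - Y ω‖)) 0}
      ≤ ∫⁻ t in Ioi (0:ℝ), ENNReal.ofReal (C * δ ^ α) * ENNReal.ofReal (Real.exp (-α * t)) := by
        refine setLIntegral_mono (by fun_prop) fun t ht => ?_
        have ht : 0 < t := ht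
        have hsub : {ω | t < max (Real.log (δ / ‖s - Y ω‖)) 0} ⊆
            {ω | ‖s - Y ω‖ < δ * Real.exp (-t)} := by
          intro ω hω
          simp only [mem_ofPred_eq, lt_max_iff] at hω ⊢
          rcases hω with hω | hω
          · rcases (norm_nonneg (s - Y ω)).eq_or_lt with h | h
            · rw [← h]; positivity
            · rw [Real.lt_log_iff_exp_lt (by positivity), lt_div_iff₀ h] at hω
              rw [Real.exp_neg, ← div_eq_mul_inv, lt_div_iff₀ (Real.exp_pos _)]
              linarith
          · linarith
        refine (measure_mono hsub).trans ((hm s _ (by positivity)).trans ?_)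
        rw [← ENNReal.ofReal_mul (by positivity), Real.mul_rpow hδ.le (Real.exp_pos _).le,
          ← Real.exp_mul]
        apply le_of_eq; congr 1; ring_nf
    _ = ENNReal.ofReal (C / α * δ ^ α) := by
        rw [lintegral_const_mul _ (by fun_prop), hexp, ← ENNReal.ofReal_mul (by positivity)]
        congr 1; ring

theorem ae_norm_sub_ne_zero (hα : 0 < α)
    (hm : ∀ s : E, ∀ r : ℝ, 0 < r → m {ω | ‖s - Y ω‖ < r} ≤ ENNReal.ofReal (C * r ^ α)) (s : E) :
    ∀ᵐ ω ∂m, ‖s - Y ω‖ ≠ 0 := by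
  rw [ae_iff]
  have h1 : Filter.Tendsto (fun r : ℝ => ENNReal.ofReal (C * r ^ α)) (nhdsWithin 0 (Ioi 0))
      (nhds 0) := by
    have : Filter.Tendsto (fun r : ℝ => ENNReal.ofReal (C * r ^ α)) (nhds 0) (nhds 0) := by
      have h2 : ContinuousAt (fun r : ℝ => ENNReal.ofReal (C * r ^ α)) 0 := by
        have := Real.continuousAt_rpow_const 0 α (Or.inr hα.le)
        exact ENNReal.continuous_ofReal.continuousAt.comp (continuousAt_const.mul this)
      have h3 := h2.tendsto
      simpa [Real.zero_rpow hα.ne'] using h3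
    exact this.mono_left nhdsWithin_le_nhds
  refine le_antisymm (ge_of_tendsto h1 ?_) (zero_le)
  filter_upwards [self_mem_nhdsWithin] with r hr
  refine (measure_mono ?_).trans (hm s r hr)
  intro ω hω
  simp only [mem_ofPred_eq, not_not] at hω ⊢
  rw [hω]; exact hr

variable [IsFiniteMeasure m]

theorem integrable_log_max (hY : Measurable Y) {T : ℝ} (hT : ∀ᵐ ω ∂m, ‖Y ω‖ ≤ T) (s : E) {δ : ℝ}
    (hδ : 0 < δ) : Integrable (fun ω => Real.log (max ‖s - Y ω‖ δ)) m := by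
  refine Integrable.of_bound (C := |Real.log δ| + |Real.log (max (‖s‖ + T) δ)|)
    (by apply Measurable.aestronglyMeasurable; fun_prop) ?_
  filter_upwards [hT] with ω hω
  have h1 : Real.log δ ≤ Real.log (max ‖s - Y ω‖ δ) := Real.log_le_log hδ (le_max_right _ _)
  have h2 : Real.log (max ‖s - Y ω‖ δ) ≤ Real.log (max (‖s‖ + T) δ) :=
    Real.log_le_log (lt_max_of_lt_right hδ)
      (max_le_max_right _ ((norm_sub_le _ _).trans (by linarith)))
  rw [Real.norm_eq_abs, abs_le]
  have := neg_abs_le (Real.log δ); have := le_abs_self (Real.log (max (‖s‖ + T) δ))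
  have := abs_nonneg (Real.log δ); have := abs_nonneg (Real.log (max (‖s‖ + T) δ))
  constructor <;> linarith

theorem integrable_log_div_pos (hY : Measurable Y) (hC : 0 ≤ C) (hα : 0 < α)
    (hm : ∀ s : E, ∀ r : ℝ, 0 < r → m {ω | ‖s - Y ω‖ < r} ≤ ENNReal.ofReal (C * r ^ α))
    (s : E) {δ : ℝ} (hδ : 0 < δ) :
    Integrable (fun ω => max (Real.log (δ / ‖s - Y ω‖)) 0) m ∧
      ∫ ω, max (Real.log (δ / ‖s - Y ω‖)) 0 ∂m ≤ C / α * δ ^ α := by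
  have h := lintegral_log_div_le hY hC hα hm s hδ
  have h0 : ∀ ω, ENNReal.ofReal (Real.log (δ / ‖s - Y ω‖)) =
      ENNReal.ofReal (max (Real.log (δ / ‖s - Y ω‖)) 0) := by
    intro ω; rw [ENNReal.ofReal_max]; simp
  simp_rw [h0] at h
  have hnn : 0 ≤ᵐ[m] fun ω => max (Real.log (δ / ‖s - Y ω‖)) 0 :=
    Filter.Eventually.of_forall fun ω => le_max_right _ _
  have hmeas : AEStronglyMeasurable (fun ω => max (Real.log (δ / ‖s - Y ω‖)) 0) m := by
    apply Measurable.aestronglyMeasurable; fun_prop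
  constructor
  · refine ⟨hmeas, ?_⟩
    rw [hasFiniteIntegral_iff_ofReal hnn]
    exact h.trans_lt ENNReal.ofReal_lt_top
  · rw [integral_eq_lintegral_of_nonneg_ae hnn hmeas]
    exact ENNReal.toReal_le_of_le_ofReal (by positivity) h

/-- Separates a truncated logarithm, Lipschitz with constant 1/δ, from a nonnegative singular part
that lives on r < δ and has integral O(δ^α). The regularity estimates for potentials rest on this
splitting. -/
theorem log_eq_log_max_sub {r δ : ℝ} (hr : 0 < r) (hδ : 0 < δ) :
    Real.log r = Real.log (max r δ) - max (Real.log (δ / r)) 0 := by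
  rw [Real.log_div hδ.ne' hr.ne']
  rcases le_total r δ with h | h
  · rw [max_eq_right h, max_eq_left (by linarith [Real.log_le_log hr h])]; ring
  · rw [max_eq_left h, max_eq_right (by linarith [Real.log_le_log hδ h])]; ring

theorem integrable_log_norm_sub (hY : Measurable Y) (hC : 0 ≤ C) (hα : 0 < α)
    (hm : ∀ s : E, ∀ r : ℝ, 0 < r → m {ω | ‖s - Y ω‖ < r} ≤ ENNReal.ofReal (C * r ^ α))
    {T : ℝ} (hT : ∀ᵐ ω ∂m, ‖Y ω‖ ≤ T) (s : E) :
    Integrable (fun ω => Real.log ‖s - Y ω‖) m := by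
  refine ((integrable_log_max hY hT s one_pos).sub
    (integrable_log_div_pos hY hC hα hm s one_pos).1).congr ?_
  filter_upwards [ae_norm_sub_ne_zero hα hm s] with ω hω
  exact (log_eq_log_max_sub ((norm_nonneg _).lt_of_ne' hω) one_pos).symm

/-- The bound depends on s only through ‖s‖, which is what Fubini needs for integrability of the
kernel on products. -/
theorem integral_abs_log_norm_sub_le (hY : Measurable Y) (hC : 0 ≤ C) (hα : 0 < α)
    (hm : ∀ s : E, ∀ r : ℝ, 0 < r → m {ω | ‖s - Y ω‖ < r} ≤ ENNReal.ofReal (C * r ^ α))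
    {T : ℝ} (hT : ∀ᵐ ω ∂m, ‖Y ω‖ ≤ T) (s : E) :
    ∫ ω, |Real.log ‖s - Y ω‖| ∂m ≤ m.real univ * (‖s‖ + T) + C / α := by
  have h1 := integrable_log_div_pos hY hC hα hm s one_pos
  calc ∫ ω, |Real.log ‖s - Y ω‖| ∂m
      ≤ ∫ ω, ((‖s‖ + T) + max (Real.log (1 / ‖s - Y ω‖)) 0) ∂m := by
        refine integral_mono_ae (integrable_log_norm_sub hY hC hα hm hT s).abs
          ((integrable_const _).add h1.1) ?_
        filter_upwards [ae_norm_sub_ne_zero hα hm s, hT] with ω hω hTω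
        have hr := (norm_nonneg (s - Y ω)).lt_of_ne' hω
        have hle : ‖s - Y ω‖ ≤ ‖s‖ + T := (norm_sub_le _ _).trans (by linarith)
        have hlog := Real.log_le_sub_one_of_pos hr
        have hm0 := le_max_right (Real.log (1 / ‖s - Y ω‖)) 0
        have hm1 := le_max_left (Real.log (1 / ‖s - Y ω‖)) 0
        have h2 : Real.log (1 / ‖s - Y ω‖) = - Real.log ‖s - Y ω‖ := by
          rw [one_div, Real.log_inv]
        have := norm_nonneg s
        rw [abs_le]
        constructor <;> linarith
    _ = m.real univ * (‖s‖ + T) + ∫ ω, max (Real.log (1 / ‖s - Y ω‖)) 0 ∂m := by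
        rw [integral_add (integrable_const _) h1.1, integral_const, smul_eq_mul]
    _ ≤ _ := by have := h1.2; simp only [Real.one_rpow, mul_one] at this; linarith

theorem log_max_sub_le {r r' δ : ℝ} (hδ : 0 < δ) :
    Real.log (max r δ) - Real.log (max r' δ) ≤ |r - r'| / δ := by
  have h1 : 0 < max r δ := lt_max_of_lt_right hδ
  have h2 : 0 < max r' δ := lt_max_of_lt_right hδ
  rw [← Real.log_div h1.ne' h2.ne']
  refine (Real.log_le_sub_one_of_pos (by positivity)).trans ?_
  rw [div_sub_one h2.ne']
  have h3 : max r δ - max r' δ ≤ |r - r'| :=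
    (le_abs_self _).trans (abs_max_sub_max_le_abs _ _ _)
  calc (max r δ - max r' δ) / max r' δ ≤ |r - r'| / max r' δ := by gcongr
    _ ≤ |r - r'| / δ := by gcongr; exact le_max_right _ _

/-- The cutoff δ is left free: δ → 0 yields continuity of the potential, and δ = √‖s - s'‖ yields
Hölder continuity of exponent 1/2 when α = 1. -/
theorem integral_log_norm_sub_sub_le (hY : Measurable Y) (hC : 0 ≤ C) (hα : 0 < α)
    (hm : ∀ s : E, ∀ r : ℝ, 0 < r → m {ω | ‖s - Y ω‖ < r} ≤ ENNReal.ofReal (C * r ^ α))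
    {T : ℝ} (hT : ∀ᵐ ω ∂m, ‖Y ω‖ ≤ T) (s s' : E) {δ : ℝ} (hδ : 0 < δ) :
    |∫ ω, Real.log ‖s - Y ω‖ ∂m - ∫ ω, Real.log ‖s' - Y ω‖ ∂m| ≤
      C / α * δ ^ α + m.real univ * (‖s - s'‖ / δ) := by
  have aux : ∀ s s' : E, ∫ ω, Real.log ‖s - Y ω‖ ∂m - ∫ ω, Real.log ‖s' - Y ω‖ ∂m ≤
      C / α * δ ^ α + m.real univ * (‖s - s'‖ / δ) := by
    intro s s'
    have h1 := integrable_log_div_pos hY hC hα hm s' hδ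
    rw [← integral_sub (integrable_log_norm_sub hY hC hα hm hT s)
      (integrable_log_norm_sub hY hC hα hm hT s')]
    calc ∫ ω, (Real.log ‖s - Y ω‖ - Real.log ‖s' - Y ω‖) ∂m
        ≤ ∫ ω, (max (Real.log (δ / ‖s' - Y ω‖)) 0 + ‖s - s'‖ / δ) ∂m := by
          refine integral_mono_ae ((integrable_log_norm_sub hY hC hα hm hT s).sub
            (integrable_log_norm_sub hY hC hα hm hT s')) (h1.1.add (integrable_const _)) ?_
          filter_upwards [ae_norm_sub_ne_zero hα hm s, ae_norm_sub_ne_zero hα hm s'] with ω hω hω'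
          have hr := (norm_nonneg (s - Y ω)).lt_of_ne' hω
          have hr' := (norm_nonneg (s' - Y ω)).lt_of_ne' hω'
          have e1 := log_eq_log_max_sub hr hδ
          have e2 := log_eq_log_max_sub hr' hδ
          have h3 := log_max_sub_le (r := ‖s - Y ω‖) (r' := ‖s' - Y ω‖) hδ
          have h4 : |‖s - Y ω‖ - ‖s' - Y ω‖| / δ ≤ ‖s - s'‖ / δ := by
            gcongr
            refine (abs_norm_sub_norm_le _ _).trans (le_of_eq ?_)
            congr 1; abel
          have := le_max_right (Real.log (δ / ‖s - Y ω‖)) 0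
          linarith
      _ ≤ _ := by
          rw [integral_add h1.1 (integrable_const _), integral_const, smul_eq_mul]
          linarith [h1.2]
  rw [abs_le]
  constructor
  · have := aux s' s
    rw [norm_sub_rev] at this
    linarith
  · exact aux s s'

theorem continuous_integral_log_norm_sub (hY : Measurable Y) (hC : 0 ≤ C) (hα : 0 < α)
    (hm : ∀ s : E, ∀ r : ℝ, 0 < r → m {ω | ‖s - Y ω‖ < r} ≤ ENNReal.ofReal (C * r ^ α))
    {T : ℝ} (hT : ∀ᵐ ω ∂m, ‖Y ω‖ ≤ T) :
    Continuous fun s : E => ∫ ω, Real.log ‖s - Y ω‖ ∂m := by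
  rw [continuous_iff_continuousAt]
  intro s
  rw [ContinuousAt, Metric.tendsto_nhds]
  intro ε hε
  have h1 : Filter.Tendsto (fun δ : ℝ => C / α * δ ^ α) (nhdsWithin 0 (Ioi 0)) (nhds 0) := by
    have h2 : ContinuousAt (fun δ : ℝ => C / α * δ ^ α) 0 :=
      continuousAt_const.mul (Real.continuousAt_rpow_const 0 α (Or.inr hα.le))
    have h3 := h2.tendsto
    simp only [Real.zero_rpow hα.ne', mul_zero] at h3
    exact h3.mono_left nhdsWithin_le_nhds
  obtain ⟨δ, hδ1, hδ⟩ := ((h1.eventually (gt_mem_nhds (half_pos hε))).and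
    self_mem_nhdsWithin).exists
  have hδ : 0 < δ := hδ
  have h4 : Filter.Tendsto (fun s' : E => m.real univ * (‖s' - s‖ / δ)) (nhds s) (nhds 0) := by
    have : Continuous fun s' : E => m.real univ * (‖s' - s‖ / δ) := by fun_prop
    simpa using this.tendsto s
  filter_upwards [h4.eventually (gt_mem_nhds (half_pos hε))] with s' hs'
  rw [Real.dist_eq]
  refine (integral_log_norm_sub_sub_le hY hC hα hm hT s' s hδ).trans_lt ?_
  linarith

end LogPotential

/-! ### Coordinates -/

section Coordinates

variable {ι κ : Type*}

/-- The coordinates of `ℝ^ι × ℂ^κ`, with the real ones embedded in `ℂ`. -/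
noncomputable def coord : ι ⊕ κ → V ι κ →L[ℝ] ℂ
  | .inl i => Complex.ofRealCLM ∘L ContinuousLinearMap.proj i ∘L
      ContinuousLinearMap.fst ℝ (ι → ℝ) (κ → ℂ)
  | .inr j => ContinuousLinearMap.proj j ∘L ContinuousLinearMap.snd ℝ (ι → ℝ) (κ → ℂ)

@[simp] theorem coord_inl (i : ι) (x : V ι κ) : coord (.inl i) x = (x.1 i : ℂ) := rfl

@[simp] theorem coord_inr (j : κ) (x : V ι κ) : coord (.inr j) x = x.2 j := rfl

theorem ext_coord {x y : V ι κ} (h : ∀ a, coord a x = coord a y) : x = y := by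
  refine Prod.ext (funext fun i => ?_) (funext fun j => ?_)
  · simpa using h (.inl i)
  · simpa using h (.inr j)

/-- The embedding of a real coordinate axis. -/
noncomputable def realAxis (i : ι) : ℝ →L[ℝ] V ι κ :=
  open scoped Classical in
  (ContinuousLinearMap.inl ℝ (ι → ℝ) (κ → ℂ)) ∘L ContinuousLinearMap.single ℝ (fun _ => ℝ) i

/-- The embedding of a complex coordinate axis. -/
noncomputable def complexAxis (j : κ) : ℂ →L[ℝ] V ι κ :=
  open scoped Classical in
  (ContinuousLinearMap.inr ℝ (ι → ℝ) (κ → ℂ)) ∘L ContinuousLinearMap.single ℝ (fun _ => ℂ) j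

/-- The projection to a coordinate axis. -/
noncomputable def coordProj : ι ⊕ κ → V ι κ →L[ℝ] V ι κ
  | .inl i => realAxis i ∘L ContinuousLinearMap.proj i ∘L
      ContinuousLinearMap.fst ℝ (ι → ℝ) (κ → ℂ)
  | .inr j => complexAxis j ∘L ContinuousLinearMap.proj j ∘L
      ContinuousLinearMap.snd ℝ (ι → ℝ) (κ → ℂ)

theorem coord_realAxis_self (i : ι) (t : ℝ) : coord (κ := κ) (.inl i) (realAxis i t) = t := by
  simp [realAxis]

theorem coord_realAxis_of_ne {i : ι} {b : ι ⊕ κ} (h : b ≠ .inl i) (t : ℝ) :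
    coord b (realAxis i t) = 0 := by
  classical
  rcases b with b | b
  · have : b ≠ i := fun e => h (by rw [e])
    simp [realAxis, this]
  · simp [realAxis]

theorem coord_complexAxis_self (j : κ) (t : ℂ) :
    coord (ι := ι) (.inr j) (complexAxis j t) = t := by
  simp [complexAxis]

theorem coord_complexAxis_of_ne {j : κ} {b : ι ⊕ κ} (h : b ≠ .inr j) (t : ℂ) :
    coord b (complexAxis j t) = 0 := by
  classical
  rcases b with b | b
  · simp [complexAxis]
  · have : b ≠ j := fun e => h (by rw [e])
    simp [complexAxis, this]

theorem coord_coordProj_self (a : ι ⊕ κ) (x : V ι κ) : coord a (coordProj a x) = coord a x := by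
  rcases a with i | j
  · exact coord_realAxis_self i _
  · exact coord_complexAxis_self j _

theorem coord_coordProj_of_ne {a b : ι ⊕ κ} (h : b ≠ a) (x : V ι κ) :
    coord b (coordProj a x) = 0 := by
  rcases a with i | j
  · exact coord_realAxis_of_ne h _
  · exact coord_complexAxis_of_ne h _

/-- The local degree of a coordinate. -/
noncomputable def weight : ι ⊕ κ → ℝ
  | .inl _ => 1
  | .inr _ => 2

theorem weight_pos (a : ι ⊕ κ) : 0 < weight a := by
  rcases a with i | j <;> simp [weight]

variable [Fintype ι] [Fintype κ]

theorem norm_coord_le (a : ι ⊕ κ) (x : V ι κ) : ‖coord a x‖ ≤ ‖x‖ := by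
  rcases a with i | j
  · rw [coord_inl, Complex.norm_real]
    exact (norm_le_pi_norm x.1 i).trans (le_max_left _ _)
  · exact (norm_le_pi_norm x.2 j).trans (le_max_right _ _)

theorem norm_le_of_coord {x : V ι κ} {T : ℝ} (hT : 0 ≤ T) (h : ∀ a, ‖coord a x‖ ≤ T) :
    ‖x‖ ≤ T := by
  refine max_le ((pi_norm_le_iff_of_nonneg hT).2 fun i => ?_)
    ((pi_norm_le_iff_of_nonneg hT).2 fun j => ?_)
  · simpa using h (.inl i)
  · exact h (.inr j)

theorem normV_ne_zero_iff {x : V ι κ} : normV x ≠ 0 ↔ ∀ a, coord a x ≠ 0 := by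
  simp [normV, Finset.prod_ne_zero_iff]

/-- Decouples the coordinates. Nonvanishing is needed because `Real.log 0 = 0` breaks additivity on
the coordinate hyperplanes. -/
theorem log_normV {x : V ι κ} (h : ∀ a, coord a x ≠ 0) :
    Real.log (normV x) = ∑ a, weight a * Real.log ‖coord a x‖ := by
  have h1 : ∀ i, |x.1 i| ≠ 0 := fun i => by simpa using h (.inl i)
  have h2 : ∀ j, ‖x.2 j‖ ^ 2 ≠ 0 := fun j => by simpa using h (.inr j)
  rw [normV, Real.log_mul (Finset.prod_ne_zero_iff.2 fun i _ => h1 i)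
    (Finset.prod_ne_zero_iff.2 fun j _ => h2 j), Real.log_prod fun i _ => h1 i,
    Real.log_prod fun j _ => h2 j, Fintype.sum_sum_type]
  simp [weight]

instance : (volume : Measure (V ι κ)).IsAddHaarMeasure :=
  Measure.prod.instIsAddHaarMeasure volume volume

theorem ae_coord_ne_zero (a : ι ⊕ κ) : ∀ᵐ x : V ι κ, coord a x ≠ 0 := by
  have hne : LinearMap.ker (coord a : V ι κ →L[ℝ] ℂ).toLinearMap ≠ ⊤ := by
    intro h
    rcases a with i | j
    · have : realAxis i (1 : ℝ) ∈ LinearMap.ker (coord (.inl i) : V ι κ →L[ℝ] ℂ).toLinearMap := by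
        rw [h]; trivial
      have h' : coord (κ := κ) (.inl i) (realAxis i 1) = 0 := this
      rw [coord_realAxis_self] at h'
      simp at h'
    · have : complexAxis j (1 : ℂ) ∈
          LinearMap.ker (coord (.inr j) : V ι κ →L[ℝ] ℂ).toLinearMap := by
        rw [h]; trivial
      have h' : coord (ι := ι) (.inr j) (complexAxis j 1) = 0 := this
      rw [coord_complexAxis_self] at h'
      simp at h'
  have := Measure.addHaar_submodule (volume : Measure (V ι κ)) _ hne
  rw [ae_iff]
  refine measure_mono_null (fun x hx => ?_) this
  simpa using hx

end Coordinates

/-! ### Integration along an axis -/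

section Slab

/-- Exchanging a coordinate with an extra variable preserves the measure. -/
theorem measurePreserving_exchange {E W : Type*} [NormedAddCommGroup E] [NormedSpace ℝ E]
    [FiniteDimensional ℝ E] [MeasurableSpace E] [BorelSpace E] [NormedAddCommGroup W]
    [NormedSpace ℝ W] [FiniteDimensional ℝ W] [MeasurableSpace W] [BorelSpace W]
    (μ : Measure E) [μ.IsAddHaarMeasure] (ν : Measure W) [ν.IsAddHaarMeasure]
    (p : W →L[ℝ] E) (s : E →L[ℝ] W) (hps : ∀ t, p (s t) = t) :
    MeasurePreserving (fun z : E × W => (p z.2, z.2 + s (z.1 - p z.2))) (μ.prod ν)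
      (μ.prod ν) := by
  have : ProperSpace E := FiniteDimensional.proper ℝ E
  have : ProperSpace W := FiniteDimensional.proper ℝ W
  have hA : MeasurePreserving (fun z : E × W => (z.1, z.2 + s z.1)) (μ.prod ν) (μ.prod ν) :=
    (MeasurePreserving.id μ).skew_product (g := fun t x => x + s t) (by fun_prop)
      (Filter.Eventually.of_forall fun t => (measurePreserving_add_right ν (s t)).map_eq)
  have hB' : MeasurePreserving (fun z : W × E => (z.1, p z.1 - z.2)) (ν.prod μ) (ν.prod μ) :=
    (MeasurePreserving.id ν).skew_product (g := fun x t => p x - t) (by fun_prop)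
      (Filter.Eventually.of_forall fun x => (Measure.measurePreserving_sub_left μ (p x)).map_eq)
  have hB : MeasurePreserving (fun z : E × W => (p z.2 - z.1, z.2)) (μ.prod ν) (μ.prod ν) :=
    (Measure.measurePreserving_swap.comp hB').comp Measure.measurePreserving_swap
  have hN : MeasurePreserving (fun z : E × W => (- z.1, z.2)) (μ.prod ν) (μ.prod ν) :=
    (Measure.measurePreserving_neg μ).prod (MeasurePreserving.id ν)
  -- With z = (t, x), the exchange is t ↦ p x - t, then a sign change, then the shear x ↦ x + s t,
  -- then t ↦ p x - t again; p ∘ s = id turns the first entry into p x.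
  have := hB.comp (hA.comp (hN.comp hB))
  convert this using 1
  ext z <;> simp [hps]

variable {E W : Type*} [NormedAddCommGroup E] [NormedSpace ℝ E]
    [FiniteDimensional ℝ E] [MeasureSpace E] [BorelSpace E] [NormedAddCommGroup W]
    [NormedSpace ℝ W] [FiniteDimensional ℝ W] [MeasureSpace W] [BorelSpace W]
    [(volume : Measure E).IsAddHaarMeasure] [(volume : Measure W).IsAddHaarMeasure]

/-- Fubini's theorem for a coordinate `p` with section `s`. -/
theorem lintegral_exchange (p : W →L[ℝ] E) (s : E →L[ℝ] W) (hps : ∀ t, p (s t) = t)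
    {ρ : E → ENNReal} (hρ : Measurable ρ) {F : W → ENNReal} (hF : Measurable F) :
    ∫⁻ x, ρ (p x) * ∫⁻ t, F (x + s (t - p x)) = (∫⁻ t, ρ t) * ∫⁻ x, F x := by
  have : ProperSpace E := FiniteDimensional.proper ℝ E
  have : ProperSpace W := FiniteDimensional.proper ℝ W
  have h := (measurePreserving_exchange volume volume p s hps).lintegral_comp
    (f := fun z : E × W => ρ z.1 * F z.2) (by fun_prop)
  rw [lintegral_prod_symm _ (by fun_prop), lintegral_prod _ (by fun_prop)] at h
  simp only at h
  calc _ = _ := ?_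
    _ = _ := h
    _ = _ := ?_
  · refine lintegral_congr fun x => ?_
    rw [lintegral_const_mul]
    fun_prop
  · rw [← lintegral_mul_const _ hρ]
    refine lintegral_congr fun t => ?_
    rw [lintegral_const_mul _ hF]

/-- By scaling, the shell has volume (r₂^d - r₁^d) times that of the unit ball, and r ↦ r^d is
Lipschitz on [0, T]. -/
theorem volume_shell_le {T : ℝ} : ∃ C : ℝ, 0 ≤ C ∧ ∀ (z : E) (r₁ r₂ δ : ℝ), 0 ≤ r₁ → r₁ ≤ r₂ →
    r₂ ≤ T → r₂ ≤ r₁ + δ → 0 < Module.finrank ℝ E →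
    volume {t : E | r₁ ≤ ‖t - z‖ ∧ ‖t - z‖ ≤ r₂} ≤ ENNReal.ofReal (C * δ) := by
  set d := Module.finrank ℝ E
  set v := (volume (Metric.ball (0 : E) 1)).toReal
  have : ProperSpace E := FiniteDimensional.proper ℝ E
  refine ⟨d * |T| ^ (d - 1) * v, by positivity, fun z r₁ r₂ δ h0 h12 hT hδ hd => ?_⟩
  have hset : {t : E | r₁ ≤ ‖t - z‖ ∧ ‖t - z‖ ≤ r₂} = Metric.closedBall z r₂ \ Metric.ball z r₁ := by
    ext t; simp [dist_eq_norm, and_comm]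
  have hv : volume (Metric.ball (0 : E) 1) = ENNReal.ofReal v :=
    (ENNReal.ofReal_toReal measure_ball_lt_top.ne).symm
  have h02 : 0 ≤ r₂ := h0.trans h12
  have : Nontrivial E := Module.nontrivial_of_finrank_pos hd
  rw [hset, measure_sdiff ((Metric.ball_subset_ball h12).trans Metric.ball_subset_closedBall)
    measurableSet_ball.nullMeasurableSet measure_ball_lt_top.ne,
    Measure.addHaar_closedBall _ _ (h0.trans h12), Measure.addHaar_ball _ _ h0, hv,
    ← ENNReal.ofReal_mul (by positivity), ← ENNReal.ofReal_mul (by positivity),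
    ← ENNReal.ofReal_sub _ (by positivity)]
  apply ENNReal.ofReal_le_ofReal
  have hpow : r₂ ^ d - r₁ ^ d ≤ d * |T| ^ (d - 1) * (r₂ - r₁) := by
    have := (abs_le.1 (abs_pow_sub_pow_le r₂ r₁ d)).2
    have hm : max |r₂| |r₁| ≤ |T| := by
      rw [abs_of_nonneg (h0.trans h12), abs_of_nonneg h0]
      exact max_le (hT.trans (le_abs_self _)) (h12.trans (hT.trans (le_abs_self _)))
    have h3 : (max |r₂| |r₁|) ^ (d - 1) ≤ |T| ^ (d - 1) :=
      pow_le_pow_left₀ (le_max_of_le_left (abs_nonneg _)) hm _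
    rw [abs_of_nonneg (sub_nonneg.2 h12)] at this
    have h4 := mul_le_mul_of_nonneg_left h3 (mul_nonneg (sub_nonneg.2 h12) (Nat.cast_nonneg d (α := ℝ)))
    have : r₂ ^ d - r₁ ^ d ≤ (r₂ - r₁) * d * max |r₂| |r₁| ^ (d-1) := this
    linarith
  have hv0 : 0 ≤ v := ENNReal.toReal_nonneg
  have : d * |T| ^ (d - 1) * (r₂ - r₁) ≤ d * |T| ^ (d - 1) * δ := by
    gcongr; linarith
  calc _ = (r₂ ^ d - r₁ ^ d) * v := by ring
    _ ≤ (d * |T| ^ (d - 1) * δ) * v := by gcongr; linarith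
    _ = _ := by ring

/-- A bounded set whose sections along an axis lie in thin shells has small volume. -/
theorem volume_le_of_section_subset_shell (p : W →L[ℝ] E) (s : E →L[ℝ] W) (hps : ∀ t, p (s t) = t)
    (hE : 0 < Module.finrank ℝ E) (T : ℝ) :
    ∃ C : ℝ, 0 ≤ C ∧ ∀ (A : Set W), MeasurableSet A → (∀ x ∈ A, ‖x‖ ≤ T) → ∀ (z : E) (δ : ℝ),
      (∀ x : W, ∃ r₁ r₂, 0 ≤ r₁ ∧ r₁ ≤ r₂ ∧ r₂ ≤ T ∧ r₂ ≤ r₁ + δ ∧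
        ∀ t, x + s (t - p x) ∈ A → r₁ ≤ ‖t - z‖ ∧ ‖t - z‖ ≤ r₂) →
      volume A ≤ ENNReal.ofReal (C * δ) := by
  have : ProperSpace E := FiniteDimensional.proper ℝ E
  have : ProperSpace W := FiniteDimensional.proper ℝ W
  obtain ⟨C, hC0, hC⟩ := volume_shell_le (E := E) (T := T)
  set b := (volume (Metric.closedBall (0 : E) 1)).toReal with hb
  have hbE : volume (Metric.closedBall (0 : E) 1) = ENNReal.ofReal b :=
    (ENNReal.ofReal_toReal measure_closedBall_lt_top.ne).symm
  have hbpos : 0 < b :=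
    ENNReal.toReal_pos (Metric.measure_closedBall_pos _ _ one_pos).ne' measure_closedBall_lt_top.ne
  -- If ‖p x‖ ≤ 1 and the line through x meets A at parameter t, then ‖t‖ ≤ ‖p‖ T, and this confines
  -- x to the ball of radius R.
  set R := T + ‖s‖ * (‖p‖ * T + 1)
  set B := (volume (Metric.closedBall (0 : W) R)).toReal
  have hBW : volume (Metric.closedBall (0 : W) R) = ENNReal.ofReal B :=
    (ENNReal.ofReal_toReal measure_closedBall_lt_top.ne).symm
  have hB0 : 0 ≤ B := ENNReal.toReal_nonneg
  refine ⟨B * C / b, by positivity, fun A hA hAT z δ hsec => ?_⟩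
  -- Each line is counted once for each of its base points; the cutoff to the unit ball of E makes
  -- this count the finite number b.
  have key := lintegral_exchange p s hps (ρ := (Metric.closedBall (0 : E) 1).indicator 1)
    (measurable_one.indicator measurableSet_closedBall) (F := A.indicator 1)
    (measurable_one.indicator hA)
  rw [lintegral_indicator_one measurableSet_closedBall, lintegral_indicator_one hA, hbE] at key
  have hle : ∫⁻ x, (Metric.closedBall (0 : E) 1).indicator 1 (p x) *
      ∫⁻ t, A.indicator (1 : W → ENNReal) (x + s (t - p x)) ≤
      ∫⁻ x, (Metric.closedBall (0 : W) R).indicator (fun _ => ENNReal.ofReal (C * δ)) x := by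
    refine lintegral_mono fun x => ?_
    by_cases hx : p x ∈ Metric.closedBall (0 : E) 1
    swap
    · simp [hx]
    by_cases hne : ∃ t, x + s (t - p x) ∈ A
    swap
    · have : ∀ t, A.indicator (1 : W → ENNReal) (x + s (t - p x)) = 0 := fun t =>
        indicator_of_notMem (fun h => hne ⟨t, h⟩) _
      rw [lintegral_congr this]; simp
    obtain ⟨t₀, ht₀⟩ := hne
    have hxR : x ∈ Metric.closedBall (0 : W) R := by
      have h1 := hAT _ ht₀
      have h2 : p (x + s (t₀ - p x)) = t₀ := by simp [hps]
      have h3 : ‖t₀‖ ≤ ‖p‖ * T := by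
        rw [← h2]; exact (p.le_opNorm _).trans (by gcongr)
      have h4 : ‖t₀ - p x‖ ≤ ‖p‖ * T + 1 :=
        (norm_sub_le _ _).trans (add_le_add h3 (by simpa using hx))
      have h5 : ‖s (t₀ - p x)‖ ≤ ‖s‖ * (‖p‖ * T + 1) := (s.le_opNorm _).trans (by gcongr)
      rw [mem_closedBall_zero_iff]
      calc ‖x‖ = ‖(x + s (t₀ - p x)) - s (t₀ - p x)‖ := by rw [add_sub_cancel_right]
        _ ≤ R := (norm_sub_le _ _).trans (add_le_add h1 h5)
    rw [indicator_of_mem hx, indicator_of_mem hxR, Pi.one_apply, one_mul]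
    obtain ⟨r₁, r₂, h0, h12, h2T, hδ, hr⟩ := hsec x
    refine le_trans ?_ (hC z r₁ r₂ δ h0 h12 h2T hδ hE)
    have hm : MeasurableSet {t : E | x + s (t - p x) ∈ A} :=
      (show Measurable fun t : E => x + s (t - p x) by fun_prop) hA
    calc ∫⁻ t, A.indicator (1 : W → ENNReal) (x + s (t - p x))
        = ∫⁻ t, {t : E | x + s (t - p x) ∈ A}.indicator 1 t := rfl
      _ = volume {t : E | x + s (t - p x) ∈ A} := lintegral_indicator_one hm
      _ ≤ _ := measure_mono hr
  rw [key, lintegral_indicator_const measurableSet_closedBall, hBW] at hle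
  have hfin : ENNReal.ofReal b ≠ 0 := by simpa using hbpos
  rw [mul_comm, ← ENNReal.le_div_iff_mul_le (Or.inl hfin) (Or.inl ENNReal.ofReal_ne_top)] at hle
  refine hle.trans ?_
  rw [← ENNReal.ofReal_mul' hB0, ← ENNReal.ofReal_div_of_pos hbpos]
  apply ENNReal.ofReal_le_ofReal
  apply le_of_eq; ring

variable {ι κ : Type*} [Fintype ι] [Fintype κ]

/-- A bounded set whose sections along a coordinate axis lie in thin shells has small volume. -/
theorem volume_le_of_coord_mem_shell (a : ι ⊕ κ) (T : ℝ) :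
    ∃ C : ℝ, 0 ≤ C ∧ ∀ (A : Set (V ι κ)), MeasurableSet A → (∀ x ∈ A, ‖x‖ ≤ T) →
      ∀ (z : V ι κ) (δ : ℝ), (∀ x : V ι κ, ∃ r₁ r₂, 0 ≤ r₁ ∧ r₁ ≤ r₂ ∧ r₂ ≤ T ∧ r₂ ≤ r₁ + δ ∧
        ∀ y ∈ A, (∀ b, b ≠ a → coord b y = coord b x) →
          r₁ ≤ ‖coord a (y - z)‖ ∧ ‖coord a (y - z)‖ ≤ r₂) →
      volume A ≤ ENNReal.ofReal (C * δ) := by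
  rcases a with i | j
  · obtain ⟨C, hC0, hC⟩ := volume_le_of_section_subset_shell (W := V ι κ)
      (ContinuousLinearMap.proj i ∘L ContinuousLinearMap.fst ℝ (ι → ℝ) (κ → ℂ)) (realAxis i)
      (fun t => by simp [realAxis]) (by simp) T
    refine ⟨C, hC0, fun A hA hAT z δ h => hC A hA hAT (z.1 i) δ fun x => ?_⟩
    obtain ⟨r₁, r₂, h0, h12, h2T, hδ, hr⟩ := h x
    refine ⟨r₁, r₂, h0, h12, h2T, hδ, fun t ht => ?_⟩
    have := hr _ ht fun b hb => by simp [map_add, coord_realAxis_of_ne hb]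
    have e : coord (.inl i) (x + realAxis i (t - x.1 i) - z) = ((t - z.1 i : ℝ) : ℂ) := by
      rw [map_sub, map_add, coord_realAxis_self]; simp
    simp only [ContinuousLinearMap.comp_apply, ContinuousLinearMap.coe_fst',
      ContinuousLinearMap.proj_apply] at this
    rwa [e, Complex.norm_real] at this
  · obtain ⟨C, hC0, hC⟩ := volume_le_of_section_subset_shell (W := V ι κ)
      (ContinuousLinearMap.proj j ∘L ContinuousLinearMap.snd ℝ (ι → ℝ) (κ → ℂ)) (complexAxis j)
      (fun t => by simp [complexAxis]) (by simp) T
    refine ⟨C, hC0, fun A hA hAT z δ h => hC A hA hAT (z.2 j) δ fun x => ?_⟩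
    obtain ⟨r₁, r₂, h0, h12, h2T, hδ, hr⟩ := h x
    refine ⟨r₁, r₂, h0, h12, h2T, hδ, fun t ht => ?_⟩
    have := hr _ ht fun b hb => by simp [map_add, coord_complexAxis_of_ne hb]
    have e : coord (.inr j) (x + complexAxis j (t - x.2 j) - z) = t - z.2 j := by
      rw [map_sub, map_add, coord_complexAxis_self]; simp
    simp only [ContinuousLinearMap.comp_apply, ContinuousLinearMap.coe_snd',
      ContinuousLinearMap.proj_apply] at this
    rwa [e] at this

end Slab

/-! ### Logarithmic potentials and energies of densities on `V` -/

section Densities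

set_option linter.unusedSectionVars false

variable {ι κ : Type*} [Fintype ι] [Fintype κ]

/-- Shell estimates need a center in V. On a real axis, replacing a complex s by its real part does
not increase distances. -/
theorem exists_coord_sub_le (a : ι ⊕ κ) (s : ℂ) :
    ∃ z : V ι κ, ∀ y : V ι κ, ‖coord a (y - z)‖ ≤ ‖s - coord a y‖ := by
  rcases a with i | j
  · refine ⟨realAxis i s.re, fun y => ?_⟩
    rw [map_sub, coord_realAxis_self, norm_sub_rev, coord_inl, ← Complex.ofReal_sub,
      Complex.norm_real]
    refine le_trans (le_of_eq ?_) (Complex.abs_re_le_norm _)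
    simp
  · refine ⟨complexAxis j s, fun y => ?_⟩
    rw [map_sub, coord_complexAxis_self, norm_sub_rev]

/-- Provides the small-ball hypothesis with α = 1 and a constant that depends only on a and T:
shells [0, r] serve for small r, the total volume for large r. -/
theorem measure_coord_ball_le (a : ι ⊕ κ) (T : ℝ) : ∃ C : ℝ, 0 ≤ C ∧ ∀ m : Measure (V ι κ),
    m ≤ volume.restrict (Metric.closedBall 0 T) → ∀ s : ℂ, ∀ r : ℝ, 0 < r →
      m {y | ‖s - coord a y‖ < r} ≤ ENNReal.ofReal (C * r ^ (1 : ℝ)) := by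
  -- The maximum with 1 guarantees r ≥ 1 once r ≥ T', so that b ≤ b r there.
  set T' := max T 1
  obtain ⟨C, hC0, hC⟩ := volume_le_of_coord_mem_shell (ι := ι) (κ := κ) a T'
  set b := (volume (Metric.closedBall (0 : V ι κ) T)).toReal
  have hb : volume (Metric.closedBall (0 : V ι κ) T) = ENNReal.ofReal b :=
    (ENNReal.ofReal_toReal measure_closedBall_lt_top.ne).symm
  have hb0 : 0 ≤ b := ENNReal.toReal_nonneg
  refine ⟨C + b, by positivity, fun m hm s r hr => (hm _).trans ?_⟩
  have hms : MeasurableSet {y : V ι κ | ‖s - coord a y‖ < r} :=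
    measurableSet_lt (by fun_prop) (by fun_prop)
  rw [Measure.restrict_apply hms, Real.rpow_one]
  rcases le_total r T' with h | h
  · obtain ⟨z, hz⟩ := exists_coord_sub_le a s
    refine (hC _ (hms.inter measurableSet_closedBall) (fun x hx => ?_) z r
      fun x => ⟨0, r, le_rfl, hr.le, h, by simp, fun y hy _ =>
        ⟨norm_nonneg _, (hz y).trans hy.1.le⟩⟩).trans ?_
    · exact (mem_closedBall_zero_iff.1 hx.2).trans (le_max_left _ _)
    · apply ENNReal.ofReal_le_ofReal
      nlinarith
  · refine (measure_mono inter_subset_right).trans ?_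
    rw [hb]
    apply ENNReal.ofReal_le_ofReal
    have : 1 ≤ r := (le_max_right _ _).trans h
    nlinarith

/-- The logarithm of the absolute value of a coordinate. -/
noncomputable def logCoord (a : ι ⊕ κ) (z : V ι κ) : ℝ := Real.log ‖coord a z‖

@[fun_prop]
theorem measurable_logCoord (a : ι ⊕ κ) : Measurable (logCoord (ι := ι) (κ := κ) a) := by
  unfold logCoord; fun_prop

theorem ae_norm_coord_le_of_le {T : ℝ} {m : Measure (V ι κ)}
    (hm : m ≤ volume.restrict (Metric.closedBall 0 T)) (a : ι ⊕ κ) :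
    ∀ᵐ y ∂m, ‖coord a y‖ ≤ T := by
  refine ae_mono hm ?_
  filter_upwards [ae_restrict_mem measurableSet_closedBall] with y hy
  exact (norm_coord_le a y).trans (mem_closedBall_zero_iff.1 hy)

theorem isFiniteMeasure_of_le {T : ℝ} {m : Measure (V ι κ)}
    (hm : m ≤ volume.restrict (Metric.closedBall 0 T)) : IsFiniteMeasure m :=
  ⟨(hm univ).trans_lt (by simpa using measure_closedBall_lt_top)⟩

theorem integrable_logCoord_sub {T : ℝ} {m : Measure (V ι κ)}
    (hm : m ≤ volume.restrict (Metric.closedBall 0 T)) (a : ι ⊕ κ) (x : V ι κ) :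
    Integrable (fun y => logCoord a (x - y)) m := by
  have := isFiniteMeasure_of_le hm
  obtain ⟨C, hC0, hC⟩ := measure_coord_ball_le a T
  have := integrable_log_norm_sub (Y := coord a) (by fun_prop) hC0 one_pos (hC m hm)
    (ae_norm_coord_le_of_le hm a) (coord a x)
  simpa [logCoord] using this

/-- A bounded measurable function of bounded support. -/
structure IsBddDensity (f : V ι κ → ℝ) : Prop where
  measurable : Measurable f
  abs_le_one : ∀ x, |f x| ≤ 1
  bounded : ∃ T, ∀ x, T < ‖x‖ → f x = 0

namespace IsBddDensity

variable {f g : V ι κ → ℝ}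

theorem integrable (hf : IsBddDensity f) : Integrable f := by
  obtain ⟨T, hT⟩ := hf.bounded
  have : IntegrableOn f (Metric.closedBall 0 T) :=
    Measure.integrableOn_of_bounded measure_closedBall_lt_top.ne
      hf.measurable.aestronglyMeasurable (Filter.Eventually.of_forall fun x => hf.abs_le_one x)
  refine (integrableOn_iff_integrable_of_support_subset fun x hx => ?_).1 this
  rw [mem_closedBall_zero_iff]
  by_contra h
  exact hx (hT x (not_le.1 h))

theorem exists_common_bound (hf : IsBddDensity f) (hg : IsBddDensity g) :
    ∃ T, 0 < T ∧ (∀ x, T < ‖x‖ → f x = 0) ∧ ∀ x, T < ‖x‖ → g x = 0 := by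
  obtain ⟨T, hT⟩ := hf.bounded
  obtain ⟨T', hT'⟩ := hg.bounded
  exact ⟨max 1 (max T T'), by positivity,
    fun x hx => hT x (((le_max_left _ _).trans (le_max_right _ _)).trans_lt hx),
    fun x hx => hT' x (((le_max_right _ _).trans (le_max_right _ _)).trans_lt hx)⟩

theorem integrable_logCoord_mul (hf : IsBddDensity f) (a : ι ⊕ κ) (x : V ι κ) :
    Integrable fun y => logCoord a (x - y) * f y := by
  obtain ⟨T, hT⟩ := hf.bounded
  have h1 := integrable_logCoord_sub (le_refl (volume.restrict (Metric.closedBall 0 T))) a x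
  have h2 : IntegrableOn (fun y => logCoord a (x - y) * f y) (Metric.closedBall 0 T) :=
    h1.mul_bdd (c := 1) hf.measurable.aestronglyMeasurable
      (Filter.Eventually.of_forall fun y => hf.abs_le_one y)
  refine (integrableOn_iff_integrable_of_support_subset fun y hy => ?_).1 h2
  rw [mem_closedBall_zero_iff]
  by_contra h
  exact hy (by simp [hT y (not_le.1 h)])

/-- The L¹ norms of the slices are bounded uniformly over the ball, so Tonelli applies. -/
theorem _root_.LogNormEnergy.integrableOn_logCoord_prod (a : ι ⊕ κ) (T : ℝ) :
    IntegrableOn (fun p : V ι κ × V ι κ => logCoord a (p.1 - p.2))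
      (Metric.closedBall 0 T ×ˢ Metric.closedBall 0 T) := by
  set m := (volume : Measure (V ι κ)).restrict (Metric.closedBall 0 T)
  have : IsFiniteMeasure m := isFiniteMeasure_of_le le_rfl
  have hmeas : Measurable fun p : V ι κ × V ι κ => logCoord a (p.1 - p.2) :=
    (measurable_logCoord a).comp (measurable_fst.sub measurable_snd)
  rw [IntegrableOn, Measure.volume_eq_prod, ← Measure.prod_restrict]
  rw [integrable_prod_iff hmeas.aestronglyMeasurable]
  refine ⟨Filter.Eventually.of_forall fun x => integrable_logCoord_sub le_rfl a x, ?_⟩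
  obtain ⟨C, hC0, hC⟩ := measure_coord_ball_le (ι := ι) (κ := κ) a T
  refine Integrable.of_bound (C := m.real univ * (T + T) + C / 1)
    hmeas.aestronglyMeasurable.norm.integral_prod_right' ?_
  filter_upwards [ae_norm_coord_le_of_le (le_refl m) a] with x hx
  have := integral_abs_log_norm_sub_le (Y := coord a) (by fun_prop) hC0 one_pos (hC m le_rfl)
    (ae_norm_coord_le_of_le le_rfl a) (coord a x)
  rw [Real.norm_eq_abs, abs_of_nonneg (integral_nonneg fun _ => norm_nonneg _)]
  simp only [logCoord, Real.norm_eq_abs, map_sub]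
  refine this.trans ?_
  gcongr

theorem integrable_logCoord_prod (hf : IsBddDensity f) (hg : IsBddDensity g) (a : ι ⊕ κ) :
    Integrable fun p : V ι κ × V ι κ => logCoord a (p.1 - p.2) * (f p.1 * g p.2) := by
  obtain ⟨T, -, hT, hT'⟩ := hf.exists_common_bound hg
  have h1 := integrableOn_logCoord_prod (ι := ι) (κ := κ) a T
  have h2 : IntegrableOn (fun p : V ι κ × V ι κ => logCoord a (p.1 - p.2) * (f p.1 * g p.2))
      (Metric.closedBall 0 T ×ˢ Metric.closedBall 0 T) := by
    refine h1.mul_bdd (c := 1) ?_ (Filter.Eventually.of_forall fun p => ?_)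
    · exact ((hf.measurable.comp measurable_fst).mul
        (hg.measurable.comp measurable_snd)).aestronglyMeasurable
    · rw [norm_mul]
      exact mul_le_one₀ (hf.abs_le_one _) (norm_nonneg _) (hg.abs_le_one _)
  refine (integrableOn_iff_integrable_of_support_subset fun p hp => ?_).1 h2
  simp only [mem_prod, mem_closedBall_zero_iff]
  by_contra h
  rw [not_and_or, not_le, not_le] at h
  rcases h with h | h
  · exact hp (by simp [hT _ h])
  · exact hp (by simp [hT' _ h])

theorem add (hf : IsBddDensity f) (hg : IsBddDensity g) {s t : ℝ}
    (h : ∀ x, |s * f x + t * g x| ≤ 1) : IsBddDensity fun x => s * f x + t * g x := by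
  obtain ⟨T, -, hT, hT'⟩ := hf.exists_common_bound hg
  exact ⟨(hf.measurable.const_mul s).add (hg.measurable.const_mul t), h,
    T, fun x hx => by simp [hT x hx, hT' x hx]⟩

end IsBddDensity

/-- The mutual energy of two densities in a single coordinate. -/
noncomputable def mutualEnergy (a : ι ⊕ κ) (f g : V ι κ → ℝ) : ℝ :=
  ∫ p : V ι κ × V ι κ, logCoord a (p.1 - p.2) * (f p.1 * g p.2)

/-- The logarithmic potential of a density in a single coordinate. -/
noncomputable def potential (a : ι ⊕ κ) (f : V ι κ → ℝ) (x : V ι κ) : ℝ :=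
  ∫ y, logCoord a (x - y) * f y

theorem mutualEnergy_eq_integral {f g : V ι κ → ℝ} (hf : IsBddDensity f) (hg : IsBddDensity g)
    (a : ι ⊕ κ) : mutualEnergy a f g = ∫ x, potential a g x * f x := by
  rw [mutualEnergy, Measure.volume_eq_prod, integral_prod _ (hf.integrable_logCoord_prod hg a)]
  refine integral_congr_ae (Filter.Eventually.of_forall fun x => ?_)
  simp only [potential]
  rw [← integral_mul_const]
  congr 1; ext y; ring

theorem logCoord_neg (a : ι ⊕ κ) (z : V ι κ) : logCoord a (-z) = logCoord a z := by
  simp [logCoord]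

theorem mutualEnergy_comm (a : ι ⊕ κ) (f g : V ι κ → ℝ) :
    mutualEnergy a f g = mutualEnergy a g f := by
  rw [mutualEnergy, mutualEnergy, Measure.volume_eq_prod, ← integral_prod_swap]
  refine integral_congr_ae (Filter.Eventually.of_forall fun p => ?_)
  simp only [Prod.fst_swap, Prod.snd_swap]
  rw [← logCoord_neg, neg_sub]; ring

theorem mutualEnergy_combination {f g : V ι κ → ℝ} (hf : IsBddDensity f) (hg : IsBddDensity g)
    (a : ι ⊕ κ) (s t : ℝ) :
    mutualEnergy a (fun x => s * f x + t * g x) (fun x => s * f x + t * g x) =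
      s ^ 2 * mutualEnergy a f f + 2 * s * t * mutualEnergy a f g +
        t ^ 2 * mutualEnergy a g g := by
  have h1 := (hf.integrable_logCoord_prod hf a).const_mul (s ^ 2)
  have h2 := (hf.integrable_logCoord_prod hg a).const_mul (s * t)
  have h3 := (hg.integrable_logCoord_prod hf a).const_mul (s * t)
  have h4 := (hg.integrable_logCoord_prod hg a).const_mul (t ^ 2)
  have e : mutualEnergy a (fun x => s * f x + t * g x) (fun x => s * f x + t * g x) =
      s ^ 2 * mutualEnergy a f f + s * t * mutualEnergy a f g + s * t * mutualEnergy a g f +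
        t ^ 2 * mutualEnergy a g g := by
    simp only [mutualEnergy, ← integral_const_mul]
    rw [← integral_add h1 h2, ← integral_add (h1.fun_add h2) h3,
      ← integral_add ((h1.fun_add h2).fun_add h3) h4]
    congr 1; ext p; ring
  rw [e, mutualEnergy_comm a g f]; ring

/-- A probability density bounded by one and of bounded support. -/
structure IsProbDensity (f : V ι κ → ℝ) : Prop extends IsBddDensity f where
  nonneg : ∀ x, 0 ≤ f x
  integral_eq_one : ∫ x, f x = 1

theorem IsProbDensity.le_one {f : V ι κ → ℝ} (hf : IsProbDensity f) (x : V ι κ) : f x ≤ 1 :=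
  (le_abs_self _).trans (hf.abs_le_one x)

/-- The measure with a given density. -/
noncomputable def densityMeasure (f : V ι κ → ℝ) : Measure (V ι κ) :=
  volume.withDensity fun x => ENNReal.ofReal (f x)

theorem IsProbDensity.densityMeasure_univ {f : V ι κ → ℝ} (hf : IsProbDensity f) :
    densityMeasure f univ = 1 := by
  rw [densityMeasure, withDensity_apply _ MeasurableSet.univ, setLIntegral_univ,
    ← ofReal_integral_eq_lintegral_ofReal hf.integrable
      (Filter.Eventually.of_forall hf.nonneg), hf.integral_eq_one, ENNReal.ofReal_one]

theorem IsProbDensity.isProbabilityMeasure {f : V ι κ → ℝ} (hf : IsProbDensity f) :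
    IsProbabilityMeasure (densityMeasure f) := ⟨hf.densityMeasure_univ⟩

theorem integral_densityMeasure {f : V ι κ → ℝ} (hf : IsProbDensity f) (g : V ι κ → ℝ) :
    ∫ x, g x ∂(densityMeasure f) = ∫ x, g x * f x := by
  rw [densityMeasure, integral_withDensity_eq_integral_toReal_smul
    (hf.measurable.ennreal_ofReal) (Filter.Eventually.of_forall fun x => ENNReal.ofReal_lt_top)]
  refine integral_congr_ae (Filter.Eventually.of_forall fun x => ?_)
  simp only [ENNReal.toReal_ofReal (hf.nonneg x), smul_eq_mul]
  ring

theorem IsProbDensity.densityMeasure_le {f : V ι κ → ℝ} (hf : IsProbDensity f) {T : ℝ}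
    (hT : ∀ x, T < ‖x‖ → f x = 0) :
    densityMeasure f ≤ volume.restrict (Metric.closedBall 0 T) := by
  rw [densityMeasure, ← withDensity_indicator_one measurableSet_closedBall]
  refine withDensity_mono (Filter.Eventually.of_forall fun x => ?_)
  by_cases hx : ‖x‖ ≤ T
  · rw [indicator_of_mem (mem_closedBall_zero_iff.2 hx), Pi.one_apply]
    exact ENNReal.ofReal_le_one.2 (hf.le_one x)
  · simp [hT x (not_le.1 hx)]

theorem IsProbDensity.isAdmissible {f : V ι κ → ℝ} (hf : IsProbDensity f) :
    IsAdmissible (densityMeasure f) := by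
  obtain ⟨T, hT⟩ := hf.bounded
  refine ⟨hf.isProbabilityMeasure, ?_, withDensity_absolutelyContinuous _ _, ?_⟩
  · refine (isCompact_closedBall (0 : V ι κ) T).of_isClosed_subset Measure.isClosed_support
      (Measure.support_subset_of_isClosed Metric.isClosed_closedBall ?_)
    rw [mem_ae_iff]
    refine le_antisymm ((hf.densityMeasure_le hT _).trans (le_of_eq ?_)) zero_le
    rw [Measure.restrict_apply measurableSet_closedBall.compl, compl_inter_self, measure_empty]
  · filter_upwards [Measure.rnDeriv_withDensity volume hf.measurable.ennreal_ofReal] with x hx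
    rw [densityMeasure, hx]
    exact ENNReal.ofReal_le_one.2 (hf.le_one x)

/-- The Radon–Nikodym derivative is cut off outside a ball and truncated at 1; this changes it only
on a null set and makes the bounds hold at every point. -/
theorem IsAdmissible.exists_density {ν : Measure (V ι κ)} (hν : IsAdmissible ν) :
    ∃ f, IsProbDensity f ∧ ν = densityMeasure f := by
  have := hν.isProbabilityMeasure
  obtain ⟨T, hT⟩ := hν.isCompact_support.isBounded.subset_closedBall (0 : V ι κ)
  set f : V ι κ → ℝ := (Metric.closedBall 0 T).indicator
    fun x => min (ν.rnDeriv volume x).toReal 1 with hfdef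
  have hfm : Measurable f := ((Measure.measurable_rnDeriv ν volume).ennreal_toReal.min
    measurable_const).indicator measurableSet_closedBall
  have hf0 : ∀ x, 0 ≤ f x := fun x =>
    indicator_nonneg (fun x _ => le_min ENNReal.toReal_nonneg zero_le_one) x
  have hf1 : ∀ x, f x ≤ 1 := fun x =>
    indicator_apply_le' (fun _ => min_le_right _ _) fun _ => zero_le_one
  have hfb : ∀ x, T < ‖x‖ → f x = 0 := fun x hx =>
    indicator_of_notMem (by rw [mem_closedBall_zero_iff]; exact not_le.2 hx) _
  have hwd := Measure.withDensity_rnDeriv_eq ν volume hν.absolutelyContinuous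
  have hout : ν (Metric.closedBall 0 T)ᶜ = 0 :=
    measure_mono_null (compl_subset_compl.2 hT) Measure.measure_compl_support
  have hout' : ∀ᵐ x, x ∈ (Metric.closedBall (0 : V ι κ) T)ᶜ → ν.rnDeriv volume x = 0 := by
    rw [← hwd, withDensity_apply _ measurableSet_closedBall.compl,
      lintegral_eq_zero_iff (Measure.measurable_rnDeriv ν volume)] at hout
    exact (ae_restrict_iff' measurableSet_closedBall.compl).1 hout
  have heq : ν = densityMeasure f := by
    conv_lhs => rw [← hwd]
    refine withDensity_congr_ae ?_
    filter_upwards [hν.density_le_one, hout'] with x hx1 hx2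
    by_cases hx : x ∈ Metric.closedBall (0 : V ι κ) T
    · have h1 : (ν.rnDeriv volume x).toReal ≤ 1 :=
        ENNReal.toReal_le_of_le_ofReal zero_le_one (by simpa using hx1)
      rw [hfdef, indicator_of_mem hx, min_eq_left h1,
        ENNReal.ofReal_toReal (hx1.trans_lt ENNReal.one_lt_top).ne]
    · rw [hfdef, indicator_of_notMem hx, hx2 hx, ENNReal.ofReal_zero]
  have hbdd : IsBddDensity f := ⟨hfm, fun x => abs_le.2 ⟨by linarith [hf0 x], hf1 x⟩, T, hfb⟩
  refine ⟨f, ⟨hbdd, hf0, ?_⟩, heq⟩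
  have h1 : densityMeasure f univ = 1 := by rw [← heq]; exact measure_univ
  rw [densityMeasure, withDensity_apply _ MeasurableSet.univ, setLIntegral_univ] at h1
  rw [integral_eq_lintegral_of_nonneg_ae (Filter.Eventually.of_forall hf0)
    hfm.aestronglyMeasurable, h1, ENNReal.toReal_one]

instance : (volume : Measure (V ι κ)).IsNegInvariant :=
  Measure.IsAddHaarMeasure.isNegInvariant_of_innerRegular _

theorem ae_prod_coord_ne_zero (a : ι ⊕ κ) (x : V ι κ) :
    ∀ᵐ y : V ι κ, coord a (x - y) ≠ 0 :=
  (Measure.measurePreserving_sub_left (volume : Measure (V ι κ)) x).quasiMeasurePreserving.ae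
    (ae_coord_ne_zero a)

theorem ae_coord_sub_ne_zero (a : ι ⊕ κ) :
    ∀ᵐ p : V ι κ × V ι κ, coord a (p.1 - p.2) ≠ 0 := by
  rw [Measure.volume_eq_prod]
  refine (Measure.ae_prod_iff_ae_ae ?_).2
    (Filter.Eventually.of_forall fun x => ae_prod_coord_ne_zero a x)
  exact (measurableSet_eq_fun (by fun_prop) (by fun_prop)).compl

/-- The energy of a density. -/
noncomputable def densityEnergy (f : V ι κ → ℝ) : ℝ := ∑ a, weight a * mutualEnergy a f f

theorem energy_densityMeasure {f : V ι κ → ℝ} (hf : IsProbDensity f) :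
    energy (densityMeasure f) = densityEnergy f := by
  have h1 : (densityMeasure f).prod (densityMeasure f) =
      (volume : Measure (V ι κ × V ι κ)).withDensity
        fun p => ENNReal.ofReal (f p.1) * ENNReal.ofReal (f p.2) := by
    have := hf.isProbabilityMeasure
    rw [densityMeasure] at *
    rw [prod_withDensity hf.measurable.ennreal_ofReal hf.measurable.ennreal_ofReal,
      ← Measure.volume_eq_prod]
  have hm : Measurable fun p : V ι κ × V ι κ => ENNReal.ofReal (f p.1) * ENNReal.ofReal (f p.2) :=
    (hf.measurable.comp measurable_fst).ennreal_ofReal.mul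
      (hf.measurable.comp measurable_snd).ennreal_ofReal
  rw [energy, h1, integral_withDensity_eq_integral_toReal_smul hm
    (Filter.Eventually.of_forall fun p =>
      ENNReal.mul_lt_top ENNReal.ofReal_lt_top ENNReal.ofReal_lt_top), densityEnergy]
  simp only [mutualEnergy, ← integral_const_mul]
  rw [← integral_finsetSum _ fun a _ =>
    (hf.toIsBddDensity.integrable_logCoord_prod hf.toIsBddDensity a).const_mul (weight a)]
  refine integral_congr_ae ?_
  filter_upwards [ae_all_iff.2 fun a => ae_coord_sub_ne_zero (ι := ι) (κ := κ) a] with p hp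
  rw [log_normV hp, ENNReal.toReal_mul, ENNReal.toReal_ofReal (hf.nonneg _),
    ENNReal.toReal_ofReal (hf.nonneg _), smul_eq_mul, Finset.mul_sum]
  refine Finset.sum_congr rfl fun a _ => ?_
  simp only [logCoord]; ring

/-- A probability density of minimal energy. -/
def IsMinimalDensity (f : V ι κ → ℝ) : Prop :=
  IsProbDensity f ∧ ∀ g : V ι κ → ℝ, IsProbDensity g → densityEnergy f ≤ densityEnergy g

theorem IsEnergyMinimizer.exists_density {ν : Measure (V ι κ)} (hν : IsEnergyMinimizer ν) :
    ∃ f, IsMinimalDensity f ∧ ν = densityMeasure f := by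
  obtain ⟨f, hf, rfl⟩ := hν.1.exists_density
  refine ⟨f, ⟨hf, fun g hg => ?_⟩, rfl⟩
  have := hν.2 _ hg.isAdmissible
  rwa [energy_densityMeasure hf, energy_densityMeasure hg] at this

end Densities

/-! ### Polarization -/

section Polarization

set_option linter.unusedSectionVars false

variable {ι κ : Type*} [Fintype ι] [Fintype κ] {a : ι ⊕ κ} {n : V ι κ} {m : ℝ} {f g : V ι κ → ℝ}

/-- The signed distance to the hyperplane `⟪coord a x, coord a n⟫ = m`. -/
noncomputable def level (a : ι ⊕ κ) (n : V ι κ) (m : ℝ) (x : V ι κ) : ℝ :=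
  m - inner ℝ (coord a x) (coord a n)

/-- The reflection in the hyperplane `⟪coord a x, coord a n⟫ = m`. -/
noncomputable def refl (a : ι ⊕ κ) (n : V ι κ) (m : ℝ) (x : V ι κ) : V ι κ :=
  x + (2 * level a n m x) • n

/-- `n` is a unit vector on the axis of the coordinate `a`. -/
structure IsUnitNormal (a : ι ⊕ κ) (n : V ι κ) : Prop where
  norm_eq_one : ‖coord a n‖ = 1
  coord_eq_zero : ∀ b, b ≠ a → coord b n = 0

@[fun_prop]
theorem continuous_level : Continuous (level a n m) := by unfold level; fun_prop

@[fun_prop]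
theorem continuous_refl : Continuous (refl a n m) := by unfold refl; fun_prop

theorem level_refl (hn : IsUnitNormal a n) (x : V ι κ) :
    level a n m (refl a n m x) = - level a n m x := by
  have h : inner ℝ (coord a n) (coord a n) = (1 : ℝ) := by
    rw [real_inner_self_eq_norm_sq, hn.norm_eq_one]; norm_num
  unfold refl
  rw [level, map_add, map_smul, inner_add_left, real_inner_smul_left, h]
  simp only [level]; ring

theorem refl_refl (hn : IsUnitNormal a n) (x : V ι κ) : refl a n m (refl a n m x) = x := by
  rw [refl, level_refl hn, refl, add_assoc, ← add_smul]
  simp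

theorem refl_eq_self {x : V ι κ} (h : level a n m x = 0) : refl a n m x = x := by
  simp [refl, h]

theorem coord_refl_of_ne (hn : IsUnitNormal a n) {b : ι ⊕ κ} (hb : b ≠ a) (x : V ι κ) :
    coord b (refl a n m x) = coord b x := by
  simp [refl, hn.coord_eq_zero b hb]

/-- The sign of the product of the levels decides whether reflecting one of two points increases
their distance. Every comparison of kernels below reduces to this identity. -/
theorem norm_coord_sub_refl_sq (hn : IsUnitNormal a n) (x y : V ι κ) :
    ‖coord a (x - refl a n m y)‖ ^ 2 =
      ‖coord a (x - y)‖ ^ 2 + 4 * level a n m x * level a n m y := by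
  have h : coord a (x - refl a n m y) = coord a (x - y) - (2 * level a n m y) • coord a n := by
    rw [refl, ← sub_sub, map_sub, map_smul]
  rw [h, norm_sub_sq_real, norm_smul, hn.norm_eq_one, real_inner_smul_right, mul_one,
    Real.norm_eq_abs, sq_abs, map_sub, inner_sub_left]
  have e1 : inner ℝ (coord a x) (coord a n) = m - level a n m x := by simp [level]
  have e2 : inner ℝ (coord a y) (coord a n) = m - level a n m y := by simp [level]
  rw [e1, e2]; ring

theorem norm_coord_refl_sub (hn : IsUnitNormal a n) (x y : V ι κ) :
    ‖coord a (refl a n m x - y)‖ = ‖coord a (x - refl a n m y)‖ := by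
  rw [← sq_eq_sq₀ (norm_nonneg _) (norm_nonneg _), ← neg_sub y, map_neg, norm_neg,
    norm_coord_sub_refl_sq hn, norm_coord_sub_refl_sq hn, ← neg_sub x y, map_neg, norm_neg]
  ring

theorem logCoord_refl_sub (hn : IsUnitNormal a n) (x y : V ι κ) :
    logCoord a (refl a n m x - y) = logCoord a (x - refl a n m y) := by
  rw [logCoord, norm_coord_refl_sub hn, logCoord]

theorem logCoord_refl_sub_of_ne (hn : IsUnitNormal a n) {b : ι ⊕ κ} (hb : b ≠ a) (x y : V ι κ) :
    logCoord b (refl a n m x - y) = logCoord b (x - y) := by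
  rw [logCoord, map_sub, coord_refl_of_ne hn hb, ← map_sub, logCoord]

theorem logCoord_refl_sub_refl (hn : IsUnitNormal a n) (b : ι ⊕ κ) (x y : V ι κ) :
    logCoord b (refl a n m x - refl a n m y) = logCoord b (x - y) := by
  by_cases hb : b = a
  · subst hb
    rw [logCoord_refl_sub hn, refl_refl hn]
  · rw [logCoord_refl_sub_of_ne hn hb, ← logCoord_neg, neg_sub, logCoord_refl_sub_of_ne hn hb,
      ← logCoord_neg, neg_sub]

/-- A reflection as a measurable equivalence. -/
noncomputable def reflEquiv (hn : IsUnitNormal a n) (m : ℝ) : V ι κ ≃ᵐ V ι κ where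
  toFun := refl a n m
  invFun := refl a n m
  left_inv := refl_refl hn
  right_inv := refl_refl hn
  measurable_toFun := continuous_refl.measurable
  measurable_invFun := continuous_refl.measurable

/-- The linear part is an involution, so its determinant is ±1; the remaining part is a translation.
-/
theorem measurePreserving_refl (hn : IsUnitNormal a n) :
    MeasurePreserving (reflEquiv hn m) := by
  set L : V ι κ →ₗ[ℝ] V ι κ :=
    { toFun := refl a n 0
      map_add' := fun x y => by
        simp only [refl, level, map_add, inner_add_left, zero_sub, mul_neg, neg_smul]
        rw [mul_add, add_smul]; abel
      map_smul' := fun c x => by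
        simp only [refl, level, map_smul, real_inner_smul_left, zero_sub, mul_neg, neg_smul,
          smul_add, smul_neg, smul_smul, RingHom.id_apply]
        congr 3; ring } with hL
  have hLL : L * L = 1 := LinearMap.ext fun x => refl_refl hn x
  have hdet : LinearMap.det L * LinearMap.det L = 1 := by rw [← map_mul, hLL, map_one]
  have habs : |(LinearMap.det L)⁻¹| = 1 := by
    rcases mul_self_eq_one_iff.1 hdet with h | h <;> simp [h]
  have h1 : MeasurePreserving (refl a n 0) := by
    refine ⟨continuous_refl.measurable, ?_⟩
    have := Measure.map_linearMap_addHaar_eq_smul_addHaar (volume : Measure (V ι κ)) (f := L)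
      (left_ne_zero_of_mul_eq_one hdet)
    rwa [habs, ENNReal.ofReal_one, one_smul] at this
  have h2 := (measurePreserving_add_right (volume : Measure (V ι κ)) ((2 * m) • n)).comp h1
  have e : ⇑(reflEquiv hn m) = (fun x => x + (2 * m) • n) ∘ refl a n 0 := by
    refine funext fun x => ?_
    change refl a n m x = refl a n 0 x + (2 * m) • n
    simp only [refl, level]
    rw [add_assoc, ← add_smul]; congr 2; ring
  rw [e]; exact h2

theorem integral_comp_refl (hn : IsUnitNormal a n) (F : V ι κ → ℝ) :
    ∫ x, F (refl a n m x) = ∫ x, F x :=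
  (measurePreserving_refl hn (m := m)).integral_comp' F

theorem integral_prod_comp_refl (hn : IsUnitNormal a n) (F : V ι κ × V ι κ → ℝ) :
    ∫ p : V ι κ × V ι κ, F (refl a n m p.1, refl a n m p.2) = ∫ p, F p :=
  MeasurePreserving.integral_comp' (f := (reflEquiv hn m).prodCongr (reflEquiv hn m))
    ((measurePreserving_refl hn).prod (measurePreserving_refl hn)) F

theorem integral_prod_comp_refl_left (hn : IsUnitNormal a n) (F : V ι κ × V ι κ → ℝ) :
    ∫ p : V ι κ × V ι κ, F (refl a n m p.1, p.2) = ∫ p, F p :=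
  MeasurePreserving.integral_comp' (f := (reflEquiv hn m).prodCongr (MeasurableEquiv.refl _))
    ((measurePreserving_refl hn).prod (MeasurePreserving.id _)) F

theorem measurePreserving_prod_refl (hn : IsUnitNormal a n) :
    MeasurePreserving fun p : V ι κ × V ι κ => (refl a n m p.1, p.2) :=
  (measurePreserving_refl hn).prod (MeasurePreserving.id _)

theorem IsBddDensity.comp_refl (hf : IsBddDensity f) (hn : IsUnitNormal a n) (m : ℝ) :
    IsBddDensity fun x => f (refl a n m x) := by
  obtain ⟨T, hT0, hT, -⟩ := hf.exists_common_bound hf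
  refine ⟨hf.measurable.comp continuous_refl.measurable, fun x => hf.abs_le_one _,
    T + 2 * (|m| + T) * ‖n‖, fun x hx => hT _ ?_⟩
  by_contra h
  push Not at h
  have h1 : |level a n m (refl a n m x)| ≤ |m| + T := by
    refine (abs_sub _ _).trans (add_le_add le_rfl ?_)
    refine (abs_real_inner_le_norm _ _).trans ?_
    rw [hn.norm_eq_one, mul_one]
    exact (norm_coord_le a _).trans h
  have h2 : ‖x‖ ≤ T + 2 * (|m| + T) * ‖n‖ := by
    conv_lhs => rw [← refl_refl (m := m) hn x, refl]
    refine (norm_add_le _ _).trans (add_le_add h ?_)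
    rw [norm_smul, norm_mul, Real.norm_eq_abs, Real.norm_eq_abs, abs_two]
    gcongr
  linarith

/-- Reflecting both variables preserves every kernel and changes the sign of the integrand. -/
theorem mutualEnergy_eq_zero_of_even_odd (hn : IsUnitNormal a n) (b : ι ⊕ κ)
    (hf : ∀ x, f (refl a n m x) = f x) (hg : ∀ x, g (refl a n m x) = - g x) :
    mutualEnergy b f g = 0 := by
  have h := integral_prod_comp_refl (m := m) hn
    fun p : V ι κ × V ι κ => logCoord b (p.1 - p.2) * (f p.1 * g p.2)
  simp only [logCoord_refl_sub_refl hn, hf, hg, mul_neg, integral_neg] at h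
  rw [mutualEnergy]; linarith

/-- The kernel of a coordinate b ≠ a does not change when only one variable is reflected, so the odd
factor integrates to zero. -/
theorem mutualEnergy_eq_zero_of_odd (hn : IsUnitNormal a n) {b : ι ⊕ κ} (hb : b ≠ a)
    (hf : ∀ x, f (refl a n m x) = - f x) : mutualEnergy b f g = 0 := by
  have h := integral_prod_comp_refl_left (m := m) hn
    fun p : V ι κ × V ι κ => logCoord b (p.1 - p.2) * (f p.1 * g p.2)
  simp only [logCoord_refl_sub_of_ne hn hb, hf, neg_mul, mul_neg, integral_neg] at h
  rw [mutualEnergy]; linarith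

/-- The kernel that governs the energy of odd densities. -/
noncomputable def reflKernel (a : ι ⊕ κ) (n : V ι κ) (m : ℝ) (x y : V ι κ) : ℝ :=
  logCoord a (refl a n m x - y) - logCoord a (x - y)

theorem integrable_reflKernel (hn : IsUnitNormal a n) (m : ℝ) (hf : IsBddDensity f)
    (hg : IsBddDensity g) :
    Integrable fun p : V ι κ × V ι κ => reflKernel a n m p.1 p.2 * (f p.1 * g p.2) := by
  have h1 := (hf.comp_refl hn m).integrable_logCoord_prod hg a
  have h2 := (measurePreserving_prod_refl hn (m := m)).integrable_comp_of_integrable h1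
  refine (h2.sub (hf.integrable_logCoord_prod hg a)).congr
    (Filter.Eventually.of_forall fun p => ?_)
  simp only [Function.comp, refl_refl hn, reflKernel, Pi.sub_apply]
  ring

/-- Averages the integral with its image under reflection of the first variable. The new kernel,
unlike the logarithm, has a known sign. -/
theorem mutualEnergy_odd (hn : IsUnitNormal a n) (hf : IsBddDensity f) (hg : IsBddDensity g)
    (hodd : ∀ x, f (refl a n m x) = - f x) :
    mutualEnergy a f g =
      - (1 / 2) * ∫ p : V ι κ × V ι κ, reflKernel a n m p.1 p.2 * (f p.1 * g p.2) := by
  have h := integral_prod_comp_refl_left (m := m) hn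
    fun p : V ι κ × V ι κ => logCoord a (p.1 - p.2) * (f p.1 * g p.2)
  have h1 := (hf.comp_refl hn m).integrable_logCoord_prod hg a
  have h2 := (measurePreserving_prod_refl hn (m := m)).integrable_comp_of_integrable h1
  have h3 : ∫ p : V ι κ × V ι κ, reflKernel a n m p.1 p.2 * (f p.1 * g p.2) =
      - mutualEnergy a f g - mutualEnergy a f g := by
    simp only [hodd] at h
    rw [mutualEnergy]
    conv_rhs => enter [1]; rw [← h, ← integral_neg]
    have h2' : Integrable fun p : V ι κ × V ι κ =>
        - (logCoord a (refl a n m p.1 - p.2) * (- f p.1 * g p.2)) := by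
      refine h2.congr (Filter.Eventually.of_forall fun p => ?_)
      simp only [Function.comp, refl_refl hn]; ring
    rw [← integral_sub h2' (hf.integrable_logCoord_prod hg a)]
    congr 1; ext p; simp only [reflKernel]; ring
  rw [h3]; ring

/-- The sign of the level. -/
noncomputable def side (a : ι ⊕ κ) (n : V ι κ) (m : ℝ) (x : V ι κ) : ℝ :=
  Real.sign (level a n m x)

theorem measurable_side : Measurable (side a n m) := by
  have : Measurable Real.sign := by
    unfold Real.sign
    exact Measurable.ite measurableSet_Iio measurable_const
      (Measurable.ite measurableSet_Ioi measurable_const measurable_const)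
  exact this.comp continuous_level.measurable

theorem side_refl (hn : IsUnitNormal a n) (x : V ι κ) :
    side a n m (refl a n m x) = - side a n m x := by
  rw [side, level_refl hn, side]
  exact Real.sign_neg

theorem abs_side_le (x : V ι κ) : |side a n m x| ≤ 1 := by
  unfold side
  rcases Real.sign_apply_eq (level a n m x) with h | h | h <;> simp [h]

theorem side_mul_abs_level (x : V ι κ) : side a n m x * |level a n m x| = level a n m x := by
  unfold side
  rcases lt_trichotomy (level a n m x) 0 with h | h | h
  · rw [Real.sign_of_neg h, abs_of_neg h]; ring
  · simp [h]
  · rw [Real.sign_of_pos h, abs_of_pos h]; ring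

theorem reflKernel_pos_of_level {x y : V ι κ} (hn : IsUnitNormal a n)
    (h1 : coord a (x - y) ≠ 0)
    (h : 0 < level a n m x * level a n m y) : 0 < reflKernel a n m x y := by
  have := norm_coord_sub_refl_sq (m := m) hn x y
  rw [← norm_coord_refl_sub hn] at this
  have h1' := norm_pos_iff.2 h1
  refine sub_pos.2 (Real.log_lt_log h1' ?_)
  refine lt_of_pow_lt_pow_left₀ 2 (norm_nonneg _) ?_
  nlinarith

theorem reflKernel_neg_of_level {x y : V ι κ} (hn : IsUnitNormal a n)
    (h2 : coord a (refl a n m x - y) ≠ 0)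
    (h : level a n m x * level a n m y < 0) : reflKernel a n m x y < 0 := by
  have := norm_coord_sub_refl_sq (m := m) hn x y
  rw [← norm_coord_refl_sub hn] at this
  have h2' := norm_pos_iff.2 h2
  refine sub_neg.2 (Real.log_lt_log h2' ?_)
  refine lt_of_pow_lt_pow_left₀ 2 (norm_nonneg _) ?_
  nlinarith

theorem reflKernel_eq_zero_of_level {x y : V ι κ} (hn : IsUnitNormal a n)
    (h : level a n m x * level a n m y = 0) : reflKernel a n m x y = 0 := by
  have := norm_coord_sub_refl_sq (m := m) hn x y
  rw [← norm_coord_refl_sub hn, mul_assoc, h, mul_zero, add_zero,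
    sq_eq_sq₀ (norm_nonneg _) (norm_nonneg _)] at this
  rw [reflKernel, logCoord, this, logCoord, sub_self]

theorem side_mul_side_of_pos {x y : V ι κ} (h : 0 < level a n m x * level a n m y) :
    side a n m x * side a n m y = 1 := by
  unfold side
  rcases mul_pos_iff.1 h with ⟨h1, h2⟩ | ⟨h1, h2⟩
  · simp [Real.sign_of_pos h1, Real.sign_of_pos h2]
  · simp [Real.sign_of_neg h1, Real.sign_of_neg h2]

theorem side_mul_side_of_neg {x y : V ι κ} (h : level a n m x * level a n m y < 0) :
    side a n m x * side a n m y = -1 := by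
  unfold side
  rcases mul_neg_iff.1 h with ⟨h1, h2⟩ | ⟨h1, h2⟩
  · simp [Real.sign_of_pos h1, Real.sign_of_neg h2]
  · simp [Real.sign_of_neg h1, Real.sign_of_pos h2]

theorem side_mul_side_of_zero {x y : V ι κ} (h : level a n m x * level a n m y = 0) :
    side a n m x * side a n m y = 0 := by
  unfold side
  rcases mul_eq_zero.1 h with h1 | h1 <;> simp [h1]

/-- The oriented difference of a density and its reflection. -/
noncomputable def polarDiff (a : ι ⊕ κ) (n : V ι κ) (m : ℝ) (f : V ι κ → ℝ) (x : V ι κ) : ℝ :=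
  side a n m x * (f x - f (refl a n m x))

/-- The reflection inequality behind polarization, with its case of equality. -/
theorem polar_cases (hn : IsUnitNormal a n) {x y : V ι κ} (h1 : coord a (x - y) ≠ 0)
    (h2 : coord a (refl a n m x - y) ≠ 0) (u w : ℝ) :
    0 ≤ reflKernel a n m x y * ((side a n m x * |u|) * (side a n m y * |w|)) -
      reflKernel a n m x y * (u * w) ∧
    (reflKernel a n m x y * ((side a n m x * |u|) * (side a n m y * |w|)) -
      reflKernel a n m x y * (u * w) = 0 → 0 ≤ (side a n m x * u) * (side a n m y * w)) := by
  have e1 : (side a n m x * |u|) * (side a n m y * |w|) =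
      (side a n m x * side a n m y) * |u * w| := by rw [abs_mul]; ring
  have e2 : (side a n m x * u) * (side a n m y * w) =
      (side a n m x * side a n m y) * (u * w) := by ring
  rw [e1, e2, ← mul_sub]
  have h3 := le_abs_self (u * w)
  have h4 := neg_abs_le (u * w)
  have h5 := abs_nonneg (u * w)
  rcases lt_trichotomy (level a n m x * level a n m y) 0 with h | h | h
  · have hk := reflKernel_neg_of_level hn h2 h
    rw [side_mul_side_of_neg h]
    refine ⟨by nlinarith, fun h0 => ?_⟩
    rcases mul_eq_zero.1 h0 with h0 | h0 <;> linarith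
  · rw [reflKernel_eq_zero_of_level hn h, side_mul_side_of_zero h]
    simp
  · have hk := reflKernel_pos_of_level hn h1 h
    rw [side_mul_side_of_pos h]
    refine ⟨by nlinarith, fun h0 => ?_⟩
    rcases mul_eq_zero.1 h0 with h0 | h0 <;> linarith

/-- The expression stays between the minimum and the maximum of u and w, so polarizing preserves the
constraint 0 ≤ f ≤ 1. -/
theorem abs_combination_le {u w s : ℝ} (hu : 0 ≤ u) (hu1 : u ≤ 1) (hw : 0 ≤ w) (hw1 : w ≤ 1)
    (hs : |s| ≤ 1) : 0 ≤ (1 / 2 * u + 1 / 2 * w) + s * |1 / 2 * u + -(1 / 2) * w| ∧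
      (1 / 2 * u + 1 / 2 * w) + s * |1 / 2 * u + -(1 / 2) * w| ≤ 1 := by
  have h1 := abs_le.1 hs
  have h2 : |s * (|1 / 2 * u + -(1 / 2) * w|)| ≤ |1 / 2 * u + -(1 / 2) * w| := by
    rw [abs_mul, abs_abs]
    exact mul_le_of_le_one_left (abs_nonneg _) hs
  have h3 := abs_le.1 h2
  rcases abs_cases (1 / 2 * u + -(1 / 2) * w) with h | h <;> constructor <;> linarith [h.1, h.2]

/-- A minimal density is polarized with respect to each reflection in one coordinate. -/
theorem polarDiff_nonneg_or_nonpos (hf : IsMinimalDensity f) (hn : IsUnitNormal a n) (m : ℝ) :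
    (∀ᵐ x, 0 ≤ polarDiff a n m f x) ∨ ∀ᵐ x, polarDiff a n m f x ≤ 0 := by
  have hf1 := hf.1.toIsBddDensity
  have hfr := hf1.comp_refl hn m
  have hn0 := hf.1.nonneg
  have hle := hf.1.le_one
  -- A and O are the even and odd halves of f. The sum A + P has the larger of f x and f (refl x) on
  -- the side of positive level.
  set A : V ι κ → ℝ := fun x => 1 / 2 * f x + 1 / 2 * f (refl a n m x) with hA
  set O : V ι κ → ℝ := fun x => 1 / 2 * f x + -(1 / 2) * f (refl a n m x) with hO
  set P : V ι κ → ℝ := fun x => side a n m x * |O x| with hP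
  have hAb : IsBddDensity A := hf1.add hfr fun x => abs_le.2
    ⟨by linarith [hn0 x, hn0 (refl a n m x)], by linarith [hle x, hle (refl a n m x)]⟩
  have hOb : IsBddDensity O := hf1.add hfr fun x => abs_le.2
    ⟨by linarith [hn0 x, hle (refl a n m x)], by linarith [hle x, hn0 (refl a n m x)]⟩
  have hPb : IsBddDensity P := by
    obtain ⟨T, hT⟩ := hOb.bounded
    refine ⟨measurable_side.mul hOb.measurable.abs, fun x => ?_, T, fun x hx => by
      simp [hP, hT x hx]⟩
    rw [abs_mul, abs_abs]
    exact mul_le_one₀ (abs_side_le x) (abs_nonneg _) (hOb.abs_le_one x)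
  have hAe : ∀ x, A (refl a n m x) = A x := fun x => by simp only [hA, refl_refl hn]; ring
  have hOo : ∀ x, O (refl a n m x) = - O x := fun x => by simp only [hO, refl_refl hn]; ring
  have hPo : ∀ x, P (refl a n m x) = - P x := fun x => by
    simp only [hP, hOo, abs_neg, side_refl hn]; ring
  have hfAO : f = fun x => 1 * A x + 1 * O x := by ext x; simp only [hA, hO]; ring
  set F : V ι κ → ℝ := fun x => 1 * A x + 1 * P x with hF
  have hF01 : ∀ x, 0 ≤ F x ∧ F x ≤ 1 := fun x => by
    have := abs_combination_le (hn0 x) (hle x) (hn0 (refl a n m x)) (hle (refl a n m x))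
      (abs_side_le (a := a) (n := n) (m := m) x)
    simpa only [hF, hA, hP, hO, one_mul] using this
  have hFd : IsProbDensity F := by
    refine ⟨hAb.add hPb fun x => abs_le.2 ⟨by linarith [(hF01 x).1], (hF01 x).2⟩,
      fun x => (hF01 x).1, ?_⟩
    have i1 : ∫ x, P x = 0 := by
      have := integral_comp_refl (m := m) hn P
      simp only [hPo, integral_neg] at this
      linarith
    have i2 : ∫ x, A x = 1 := by
      rw [hA, integral_add (hf1.integrable.const_mul _) (hfr.integrable.const_mul _),
        integral_const_mul, integral_const_mul, integral_comp_refl hn, hf.1.integral_eq_one]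
      norm_num
    rw [hF, integral_add (hAb.integrable.const_mul _) (hPb.integrable.const_mul _),
      integral_const_mul, integral_const_mul, i1, i2]
    norm_num
  -- The even terms agree and the cross terms vanish by parity.
  have hE : ∀ b, mutualEnergy b F F - mutualEnergy b f f =
      mutualEnergy b P P - mutualEnergy b O O := fun b => by
    rw [hF, hfAO, mutualEnergy_combination hAb hPb, mutualEnergy_combination hAb hOb,
      mutualEnergy_eq_zero_of_even_odd hn b hAe hPo,
      mutualEnergy_eq_zero_of_even_odd hn b hAe hOo]
    ring
  have hmin := hf.2 F hFd
  -- For b ≠ a both odd energies are zero, so only the reflected coordinate is left.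
  have hdiff : 0 ≤ weight a * (mutualEnergy a P P - mutualEnergy a O O) := by
    rw [← sub_nonneg, densityEnergy, densityEnergy, ← Finset.sum_sub_distrib,
      Finset.sum_eq_single a] at hmin
    · rwa [← mul_sub, hE] at hmin
    · intro b _ hb
      rw [← mul_sub, hE, mutualEnergy_eq_zero_of_odd hn hb hPo,
        mutualEnergy_eq_zero_of_odd hn hb hOo]
      simp
    · simp
  have hdiff := nonneg_of_mul_nonneg_right hdiff (weight_pos a)
  rw [mutualEnergy_odd hn hPb hPb hPo, mutualEnergy_odd hn hOb hOb hOo, ← mul_sub,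
    ← integral_sub (integrable_reflKernel hn m hPb hPb) (integrable_reflKernel hn m hOb hOb)]
    at hdiff
  have hne : ∀ᵐ p : V ι κ × V ι κ, coord a (p.1 - p.2) ≠ 0 ∧
      coord a (refl a n m p.1 - p.2) ≠ 0 :=
    (ae_coord_sub_ne_zero a).and
      ((measurePreserving_prod_refl hn (m := m)).quasiMeasurePreserving.ae
        (ae_coord_sub_ne_zero a))
  have hnonneg : 0 ≤ᵐ[volume] fun p : V ι κ × V ι κ =>
      reflKernel a n m p.1 p.2 * (P p.1 * P p.2) - reflKernel a n m p.1 p.2 * (O p.1 * O p.2) := by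
    filter_upwards [hne] with p hp
    exact (polar_cases hn hp.1 hp.2 _ _).1
  -- Minimality gives a nonpositive integral of a nonnegative integrand, hence equality almost
  -- everywhere in `polar_cases`.
  have hzero := (integral_eq_zero_iff_of_nonneg_ae hnonneg
    ((integrable_reflKernel hn m hPb hPb).sub (integrable_reflKernel hn m hOb hOb))).1
    (le_antisymm (by linarith) (integral_nonneg_of_ae hnonneg))
  have hfin : ∀ᵐ p : V ι κ × V ι κ, 0 ≤ polarDiff a n m f p.1 * polarDiff a n m f p.2 := by
    filter_upwards [hne, hzero] with p hp hz
    have := (polar_cases hn hp.1 hp.2 _ _).2 hz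
    simp only [hO] at this
    simp only [polarDiff]
    linarith
  rw [Measure.volume_eq_prod] at hfin
  have hfin := Measure.ae_ae_of_ae_prod hfin
  by_cases hcase : ∀ᵐ x, 0 ≤ polarDiff a n m f x
  · exact Or.inl hcase
  -- One point x with a negative value, chosen so that the product inequality holds for almost every
  -- y, fixes the sign for almost every y.
  · obtain ⟨x, hx1, hx2⟩ := ((Filter.not_eventually.1 hcase).and_eventually hfin).exists
    refine Or.inr ?_
    filter_upwards [hx2] with y hy
    push Not at hx1
    by_contra h
    push Not at h
    nlinarith

end Polarization

/-! ### Potentials of minimal densities -/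

section Radial

set_option linter.unusedSectionVars false

variable {ι κ : Type*} [Fintype ι] [Fintype κ] {a : ι ⊕ κ} {n v : V ι κ} {m R : ℝ} {f : V ι κ → ℝ}

/-- The barycenter of a density. -/
noncomputable def barycenter (f : V ι κ → ℝ) : V ι κ := ∫ y, f y • y

theorem IsBddDensity.integrable_mul {h : V ι κ → ℝ} (hf : IsBddDensity f) (hh : Continuous h) :
    Integrable fun x => h x * f x := by
  obtain ⟨T, hT⟩ := hf.bounded
  have h1 : IntegrableOn (fun x => h x * f x) (Metric.closedBall 0 T) :=
    (hh.continuousOn.integrableOn_compact (isCompact_closedBall 0 T)).mul_bdd (c := 1)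
      hf.measurable.aestronglyMeasurable (Filter.Eventually.of_forall hf.abs_le_one)
  refine (integrableOn_iff_integrable_of_support_subset fun x hx => ?_).1 h1
  rw [mem_closedBall_zero_iff]
  by_contra h
  exact hx (by simp [hT x (not_le.1 h)])

theorem IsBddDensity.integrable_smul_id (hf : IsBddDensity f) : Integrable fun x => f x • x := by
  refine (hf.integrable_mul continuous_norm).mono
    (hf.measurable.smul measurable_id).aestronglyMeasurable
    (Filter.Eventually.of_forall fun x => le_of_eq ?_)
  rw [norm_smul, norm_mul, norm_norm, mul_comm]

theorem integral_level_mul (hf : IsProbDensity f) :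
    ∫ x, level a n m x * f x = level a n m (barycenter f) := by
  set φ : V ι κ →L[ℝ] ℝ := (innerSL ℝ (coord a n)) ∘L coord a with hφ
  have hl : ∀ x, level a n m x = m - φ x := fun x => by
    simp [level, hφ, real_inner_comm]
  have h1 := φ.integral_comp_comm hf.integrable_smul_id
  have h2 : Integrable fun x => φ x * f x := hf.integrable_mul φ.continuous
  simp only [hl, sub_mul]
  rw [integral_sub (hf.integrable.const_mul m) h2, integral_const_mul, hf.integral_eq_one, mul_one,
    barycenter, ← h1]
  simp [mul_comm]

theorem abs_level_mul_polarDiff (x : V ι κ) :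
    |level a n m x| * polarDiff a n m f x = level a n m x * (f x - f (refl a n m x)) := by
  rw [polarDiff, ← mul_assoc, mul_comm |_|, side_mul_abs_level]

theorem integral_level_mul_comp_refl (hn : IsUnitNormal a n) :
    ∫ x, level a n m x * f (refl a n m x) = - ∫ x, level a n m x * f x := by
  rw [← integral_comp_refl (m := m) hn fun x => level a n m x * f x, ← integral_neg]
  simp only [level_refl hn, neg_mul, neg_neg]

theorem integrable_abs_level_mul_polarDiff (hf : IsBddDensity f) (hn : IsUnitNormal a n) :
    Integrable fun x => |level a n m x| * polarDiff a n m f x := by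
  simp only [abs_level_mul_polarDiff, mul_sub]
  exact (hf.integrable_mul continuous_level).sub
    ((hf.comp_refl hn m).integrable_mul continuous_level)

/-- The level is affine and odd under the reflection, so each of the two terms contributes its value
at the barycenter. The sign of this integral selects the side, and its size gives the quantitative
gap. -/
theorem integral_abs_level_mul_polarDiff (hf : IsProbDensity f) (hn : IsUnitNormal a n) :
    ∫ x, |level a n m x| * polarDiff a n m f x = 2 * level a n m (barycenter f) := by
  simp only [abs_level_mul_polarDiff, mul_sub]
  rw [integral_sub (hf.integrable_mul continuous_level)
    ((hf.comp_refl hn m).integrable_mul continuous_level), integral_level_mul_comp_refl hn,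
    integral_level_mul hf]
  ring

/-- A minimal density is concentrated on the side of its barycenter. -/
theorem IsMinimalDensity.polarDiff_nonneg (hf : IsMinimalDensity f) (hn : IsUnitNormal a n)
    (hm : 0 ≤ level a n m (barycenter f)) : ∀ᵐ x, 0 ≤ polarDiff a n m f x := by
  rcases polarDiff_nonneg_or_nonpos hf hn m with h | h
  · exact h
  have h1 := integral_abs_level_mul_polarDiff (m := m) hf.1 hn
  -- In the opposite case the integral is both nonpositive and nonnegative, so `polarDiff` vanishes
  -- off the hyperplane, and on the hyperplane `side` is 0.
  have h2 : 0 ≤ᵐ[volume] fun x => - (|level a n m x| * polarDiff a n m f x) := by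
    filter_upwards [h] with x hx
    simp only [Pi.zero_apply]
    nlinarith [abs_nonneg (level a n m x)]
  have h3 := (integral_eq_zero_iff_of_nonneg_ae h2
    (integrable_abs_level_mul_polarDiff hf.1.toIsBddDensity hn).neg).1
    (le_antisymm (by rw [integral_neg, h1]; linarith) (integral_nonneg_of_ae h2))
  filter_upwards [h3] with x hx
  simp only [Pi.zero_apply, neg_eq_zero, mul_eq_zero, abs_eq_zero] at hx
  rcases hx with hx | hx
  · simp [polarDiff, side, hx]
  · exact hx.ge

theorem reflKernel_refl (hn : IsUnitNormal a n) (x y : V ι κ) :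
    reflKernel a n m x (refl a n m y) = - reflKernel a n m x y := by
  rw [reflKernel, reflKernel, logCoord_refl_sub_refl hn, ← logCoord_refl_sub hn]; ring

theorem integrable_reflKernel_mul (hf : IsBddDensity f) (x : V ι κ) :
    Integrable fun y => reflKernel a n m x y * f y := by
  simp only [reflKernel, sub_mul]
  exact (hf.integrable_logCoord_mul a _).sub (hf.integrable_logCoord_mul a x)

/-- The kernel is odd under reflection of y, so only the odd part of f contributes. -/
theorem potential_refl_sub (hf : IsBddDensity f) (hn : IsUnitNormal a n) (x : V ι κ) :
    potential a f (refl a n m x) - potential a f x =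
      1 / 2 * ∫ y, reflKernel a n m x y * (f y - f (refl a n m y)) := by
  have h1 : potential a f (refl a n m x) - potential a f x =
      ∫ y, reflKernel a n m x y * f y := by
    rw [potential, potential, ← integral_sub (hf.integrable_logCoord_mul a _)
      (hf.integrable_logCoord_mul a x)]
    simp only [reflKernel, sub_mul]
  have h2 : ∫ y, reflKernel a n m x y * f (refl a n m y) =
      - ∫ y, reflKernel a n m x y * f y := by
    rw [← integral_comp_refl (m := m) hn fun y => reflKernel a n m x y * f y, ← integral_neg]
    simp only [reflKernel_refl hn, neg_mul, neg_neg]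
  simp only [mul_sub]
  rw [integral_sub (integrable_reflKernel_mul hf x) (integrable_reflKernel_mul
    (hf.comp_refl hn m) x), h2, h1]
  ring

/-- The kernel is half of log (r'² / r²), with r'² - r² = 4 level(x) level(y); the bound follows
from log t ≥ 1 - 1/t and r' ≤ 2T. -/
theorem reflKernel_ge (hn : IsUnitNormal a n) {x y : V ι κ} {T : ℝ}
    (h1 : coord a (x - y) ≠ 0) (hx : 0 < level a n m x) (hy : 0 < level a n m y)
    (hT : ‖coord a (refl a n m x - y)‖ ≤ 2 * T) :
    level a n m x * level a n m y / (2 * T ^ 2) ≤ reflKernel a n m x y := by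
  have hq := norm_coord_sub_refl_sq (m := m) hn x y
  rw [← norm_coord_refl_sub hn] at hq
  have hp := mul_pos hx hy
  have h1' := norm_pos_iff.2 h1
  have h2' : 0 < ‖coord a (refl a n m x - y)‖ := by
    refine (norm_nonneg _).lt_of_ne fun h => ?_
    rw [← h] at hq; nlinarith
  set r := ‖coord a (x - y)‖
  set r' := ‖coord a (refl a n m x - y)‖
  have hk : reflKernel a n m x y = 1 / 2 * Real.log (r' ^ 2 / r ^ 2) := by
    rw [Real.log_div (by positivity) (by positivity), Real.log_pow, Real.log_pow, reflKernel,
      logCoord, logCoord]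
    push_cast; ring
  have hlog : 1 - (r' ^ 2 / r ^ 2)⁻¹ ≤ Real.log (r' ^ 2 / r ^ 2) :=
    Real.one_sub_inv_le_log_of_pos (by positivity)
  have e : 1 - (r' ^ 2 / r ^ 2)⁻¹ = 4 * (level a n m x * level a n m y) / r' ^ 2 := by
    rw [inv_div, eq_div_iff (by positivity), sub_mul, div_mul_cancel₀ _ (by positivity), hq]; ring
  rw [hk]
  calc level a n m x * level a n m y / (2 * T ^ 2)
      = 1 / 2 * (4 * (level a n m x * level a n m y) / (2 * T) ^ 2) := by
        rw [mul_pow]; ring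
    _ ≤ 1 / 2 * (4 * (level a n m x * level a n m y) / r' ^ 2) := by gcongr
    _ ≤ _ := by rw [← e]; linarith

theorem norm_coord_sub_le (a : ι ⊕ κ) {x y v : V ι κ} {T : ℝ} (hx : ‖coord a (x - v)‖ ≤ T)
    (hy : ‖coord a (y - v)‖ ≤ T) : ‖coord a (x - y)‖ ≤ 2 * T := by
  have : coord a (x - y) = coord a (x - v) - coord a (y - v) := by rw [← map_sub]; congr 1; abel
  rw [this]
  exact (norm_sub_le _ _).trans (by linarith)

/-- The potential of a minimal density increases away from the barycenter. -/
theorem IsMinimalDensity.potential_refl_sub_ge (hf : IsMinimalDensity f) (hn : IsUnitNormal a n)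
    (hm : 0 ≤ level a n m (barycenter f)) {T : ℝ}
    (hT : ∀ y, f y ≠ 0 → ‖coord a (y - barycenter f)‖ ≤ T) {x : V ι κ}
    (hx : 0 < level a n m x) (hx2 : ‖coord a (refl a n m x - barycenter f)‖ ≤ T) :
    level a n m x * level a n m (barycenter f) / (2 * T ^ 2) ≤
      potential a f (refl a n m x) - potential a f x := by
  have hfb := hf.1.toIsBddDensity
  have hi : Integrable fun y => reflKernel a n m x y * (f y - f (refl a n m y)) := by
    simp only [mul_sub]
    exact (integrable_reflKernel_mul hfb x).sub
      (integrable_reflKernel_mul (hfb.comp_refl hn m) x)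
  rw [potential_refl_sub hfb hn]
  have key : ∫ y, level a n m x / (2 * T ^ 2) * (|level a n m y| * polarDiff a n m f y) ≤
      ∫ y, reflKernel a n m x y * (f y - f (refl a n m y)) := by
    refine integral_mono_ae ((integrable_abs_level_mul_polarDiff hfb hn).const_mul _) hi ?_
    filter_upwards [hf.polarDiff_nonneg hn hm, ae_prod_coord_ne_zero a x,
      (measurePreserving_refl hn (m := m)).quasiMeasurePreserving.ae (ae_prod_coord_ne_zero a x)]
      with y hy h1 h2
    have h2 : coord a (x - refl a n m y) ≠ 0 := h2
    rw [abs_level_mul_polarDiff]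
    rcases lt_trichotomy (level a n m y) 0 with h | h | h
    -- On the far side the kernel bound is applied to the reflected point of y; both factors change
    -- sign.
    · have hs : side a n m y = -1 := Real.sign_of_neg h
      rw [polarDiff, hs] at hy
      rcases eq_or_ne (f (refl a n m y)) 0 with h0 | h0
      · have : f y = 0 := le_antisymm (by linarith) (hf.1.nonneg y)
        rw [h0, this]; simp
      · have hl : 0 < level a n m (refl a n m y) := by rw [level_refl hn]; linarith
        have := reflKernel_ge hn h2 hx hl (norm_coord_sub_le a hx2 (hT _ h0))
        rw [reflKernel_refl hn, level_refl hn] at this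
        have e : level a n m x / (2 * T ^ 2) * (level a n m y * (f y - f (refl a n m y))) =
          level a n m x * -level a n m y / (2 * T ^ 2) * -(f y - f (refl a n m y)) := by ring
        rw [e]
        nlinarith
    · simp [h, refl_eq_self h]
    · have hs : side a n m y = 1 := Real.sign_of_pos h
      rw [polarDiff, hs] at hy
      rcases eq_or_ne (f y) 0 with h0 | h0
      · have : f (refl a n m y) = 0 := le_antisymm (by linarith) (hf.1.nonneg _)
        rw [h0, this]; simp
      · have := reflKernel_ge hn h1 hx h (norm_coord_sub_le a hx2 (hT _ h0))
        have e : level a n m x / (2 * T ^ 2) * (level a n m y * (f y - f (refl a n m y))) =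
          level a n m x * level a n m y / (2 * T ^ 2) * (f y - f (refl a n m y)) := by ring
        rw [e]
        exact mul_le_mul_of_nonneg_right this (by linarith)
  rw [integral_const_mul, integral_abs_level_mul_polarDiff hf.1 hn] at key
  calc _ = 1 / 2 * (level a n m x / (2 * T ^ 2) * (2 * level a n m (barycenter f))) := by ring
    _ ≤ _ := by linarith

theorem potential_congr {x x' : V ι κ} (h : coord a x = coord a x') :
    potential a f x = potential a f x' := by
  simp only [potential, logCoord, map_sub, h]

/-- A probability density whose coordinate potentials increase strictly away from `v`. -/
structure IsRadial (f : V ι κ → ℝ) (v : V ι κ) (R : ℝ) : Prop extends IsProbDensity f where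
  radius_pos : 0 < R
  norm_le : ∀ y, f y ≠ 0 → ∀ a, ‖coord a (y - v)‖ ≤ R
  potential_sub_ge : ∀ (a : ι ⊕ κ) (T : ℝ), R ≤ T → ∀ x x' : V ι κ,
    ‖coord a (x - v)‖ ≤ ‖coord a (x' - v)‖ → ‖coord a (x' - v)‖ ≤ T →
      (‖coord a (x' - v)‖ ^ 2 - ‖coord a (x - v)‖ ^ 2) / (8 * T ^ 2) ≤
        potential a f x' - potential a f x

/-- Reflect in the perpendicular bisector of x_a and x'_a. It exchanges the two coordinates and has
the barycenter on the side of x, since x_a is no farther from v_a than x'_a. The level of x is d/2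
and that of v is the difference of squares over 2d, whence the constant 8T². -/
theorem IsMinimalDensity.exists_isRadial (hf : IsMinimalDensity f) :
    ∃ R, IsRadial f (barycenter f) R := by
  obtain ⟨T₀, hT₀, hfT, -⟩ := hf.1.toIsBddDensity.exists_common_bound hf.1.toIsBddDensity
  set v := barycenter f
  have hR : ∀ y, f y ≠ 0 → ∀ a, ‖coord a (y - v)‖ ≤ T₀ + ‖v‖ := fun y hy a => by
    refine (norm_coord_le a _).trans ((norm_sub_le _ _).trans ?_)
    gcongr
    by_contra h
    exact hy (hfT y (not_le.1 h))
  refine ⟨T₀ + ‖v‖, hf.1, by positivity, hR, fun a T hT x x' hxx' hx' => ?_⟩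
  rcases eq_or_ne (coord a x) (coord a x') with h | h
  · rw [potential_congr h, map_sub, map_sub, h]; simp
  set d := ‖coord a (x' - x)‖ with hd
  have hd0 : 0 < d := by
    rw [hd, map_sub]; exact norm_pos_iff.2 (sub_ne_zero.2 h.symm)
  set n : V ι κ := (1 / d) • coordProj a (x' - x)
  have hcn : coord a n = (1 / d) • coord a (x' - x) := by
    rw [map_smul, coord_coordProj_self]
  have hn : IsUnitNormal a n := by
    refine ⟨?_, fun b hb => ?_⟩
    · rw [hcn, norm_smul, Real.norm_of_nonneg (by positivity), ← hd]
      field_simp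
    · rw [map_smul, coord_coordProj_of_ne hb, smul_zero]
  set m : ℝ := inner ℝ (coord a ((1 / 2 : ℝ) • (x + x'))) (coord a n)
  have hlev : ∀ z, level a n m z =
      1 / d * inner ℝ (coord a ((1 / 2 : ℝ) • (x + x') - z)) (coord a (x' - x)) := fun z => by
    rw [level, ← inner_sub_left, ← map_sub, hcn, real_inner_smul_right]
  have hlx : level a n m x = d / 2 := by
    have e : (1 / 2 : ℝ) • (x + x') - x = (1 / 2 : ℝ) • (x' - x) := by module
    rw [hlev, e, map_smul, real_inner_smul_left, real_inner_self_eq_norm_sq, ← hd]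
    field_simp
  have hlv : level a n m v = (‖coord a (x' - v)‖ ^ 2 - ‖coord a (x - v)‖ ^ 2) / (2 * d) := by
    have e1 : (1 / 2 : ℝ) • (x + x') - v = (1 / 2 : ℝ) • ((x' - v) + (x - v)) := by module
    have e2 : x' - x = (x' - v) - (x - v) := by abel
    have e3 : inner ℝ (coord a (x' - v) + coord a (x - v)) (coord a (x' - v) - coord a (x - v)) =
        ‖coord a (x' - v)‖ ^ 2 - ‖coord a (x - v)‖ ^ 2 := by
      rw [inner_add_left, inner_sub_right, inner_sub_right, real_inner_self_eq_norm_sq,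
        real_inner_self_eq_norm_sq, real_inner_comm (coord a (x - v))]
      ring
    rw [hlev, e1, e2, map_smul, map_add, map_sub (coord a) (x' - v), real_inner_smul_left, e3]
    field_simp
  have hrefl : coord a (refl a n m x) = coord a x' := by
    rw [refl, map_add, map_smul, hlx, hcn, smul_smul, map_sub]
    have : 2 * (d / 2) * (1 / d) = 1 := by field_simp
    rw [this, one_smul]; abel
  have hnn : 0 ≤ level a n m v := by
    rw [hlv]
    refine div_nonneg (sub_nonneg.2 ?_) (by positivity)
    gcongr
  have := hf.potential_refl_sub_ge hn hnn (fun y hy => (hR y hy a).trans hT) (x := x)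
    (by rw [hlx]; positivity) (by rw [map_sub, hrefl, ← map_sub]; exact hx')
  rw [potential_congr hrefl, hlx] at this
  refine le_trans (le_of_eq ?_) this
  rw [show level a n m (barycenter f) = level a n m v from rfl, hlv]
  field_simp; ring

theorem potential_eq_integral (hf : IsProbDensity f) (a : ι ⊕ κ) (x : V ι κ) :
    potential a f x = ∫ y, Real.log ‖coord a x - coord a y‖ ∂(densityMeasure f) := by
  rw [integral_densityMeasure hf]
  simp only [potential, logCoord, map_sub]

theorem continuous_potential (hf : IsProbDensity f) (a : ι ⊕ κ) : Continuous (potential a f) := by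
  obtain ⟨T, hT⟩ := hf.bounded
  have hle := hf.densityMeasure_le hT
  have := hf.isProbabilityMeasure
  obtain ⟨C, hC0, hC⟩ := measure_coord_ball_le (ι := ι) (κ := κ) a T
  have h := (continuous_integral_log_norm_sub (Y := coord a) (by fun_prop) hC0 one_pos (hC _ hle)
    (ae_norm_coord_le_of_le hle a)).comp (coord a).continuous
  refine h.congr fun x => ?_
  rw [potential_eq_integral hf]; rfl

theorem exists_abs_potential_sub_le (hf : IsProbDensity f) (a : ι ⊕ κ) :
    ∃ K : ℝ, 0 ≤ K ∧ ∀ x x' : V ι κ,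
      |potential a f x - potential a f x'| ≤ K * √‖coord a (x - x')‖ := by
  obtain ⟨T, hT⟩ := hf.bounded
  have hle := hf.densityMeasure_le hT
  have := hf.isProbabilityMeasure
  obtain ⟨C, hC0, hC⟩ := measure_coord_ball_le (ι := ι) (κ := κ) a T
  refine ⟨C + 1, by positivity, fun x x' => ?_⟩
  rcases eq_or_ne (coord a (x - x')) 0 with h | h
  · rw [potential_congr (x := x) (x' := x') (sub_eq_zero.1 (by rw [← map_sub, h]))]
    simp [h]
  set d := ‖coord a (x - x')‖ with hd
  have hd0 : 0 < d := norm_pos_iff.2 h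
  -- The cutoff √d balances the two error terms C δ and d / δ.
  have := integral_log_norm_sub_sub_le (Y := coord a) (by fun_prop) hC0 one_pos (hC _ hle)
    (ae_norm_coord_le_of_le hle a) (coord a x) (coord a x') (Real.sqrt_pos.2 hd0)
  rw [← map_sub, ← hd, probReal_univ, Real.rpow_one, one_mul, Real.div_sqrt] at this
  rw [potential_eq_integral hf, potential_eq_integral hf]
  linarith

namespace IsRadial

theorem potential_le (hf : IsRadial f v R) (a : ι ⊕ κ) {x x' : V ι κ}
    (h : ‖coord a (x - v)‖ ≤ ‖coord a (x' - v)‖) : potential a f x ≤ potential a f x' := by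
  have := hf.potential_sub_ge a (max R ‖coord a (x' - v)‖) (le_max_left _ _) x x' h
    (le_max_right _ _)
  have h2 : 0 ≤ (‖coord a (x' - v)‖ ^ 2 - ‖coord a (x - v)‖ ^ 2) /
      (8 * (max R ‖coord a (x' - v)‖) ^ 2) := by
    refine div_nonneg (sub_nonneg.2 ?_) (by positivity)
    gcongr
  linarith

theorem potential_lt (hf : IsRadial f v R) (a : ι ⊕ κ) {x x' : V ι κ}
    (h : ‖coord a (x - v)‖ < ‖coord a (x' - v)‖) : potential a f x < potential a f x' := by
  have := hf.potential_sub_ge a (max R ‖coord a (x' - v)‖) (le_max_left _ _) x x' h.le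
    (le_max_right _ _)
  have h2 : 0 < (‖coord a (x' - v)‖ ^ 2 - ‖coord a (x - v)‖ ^ 2) /
      (8 * (max R ‖coord a (x' - v)‖) ^ 2) := by
    have : 0 < max R ‖coord a (x' - v)‖ := lt_max_of_lt_left hf.radius_pos
    refine div_pos (sub_pos.2 ?_) (by positivity)
    gcongr
  linarith

theorem norm_coord_eq (hf : IsRadial f v R) (a : ι ⊕ κ) {x x' : V ι κ}
    (h : potential a f x = potential a f x') : ‖coord a (x - v)‖ = ‖coord a (x' - v)‖ :=
  le_antisymm (le_of_not_gt fun h' => (hf.potential_lt a h').ne' h)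
    (le_of_not_gt fun h' => (hf.potential_lt a h').ne h)

/-- All the mass lies within R of v in the coordinate a, so every y that counts is at distance at
least ‖coord a (x - v)‖ - R from x. This is the source of coercivity. -/
theorem log_le_potential (hf : IsRadial f v R) (a : ι ⊕ κ) {x : V ι κ}
    (hx : R < ‖coord a (x - v)‖) : Real.log (‖coord a (x - v)‖ - R) ≤ potential a f x := by
  have h1 : ∫ y, Real.log (‖coord a (x - v)‖ - R) * f y = Real.log (‖coord a (x - v)‖ - R) := by
    rw [integral_const_mul, hf.integral_eq_one, mul_one]
  rw [← h1]
  refine integral_mono (hf.integrable.const_mul _)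
    (hf.toIsBddDensity.integrable_logCoord_mul a x) fun y => ?_
  rcases eq_or_ne (f y) 0 with h | h
  · simp [h]
  refine mul_le_mul_of_nonneg_right (Real.log_le_log (by linarith) ?_) (hf.nonneg y)
  have h2 := hf.norm_le y h a
  have h3 : coord a (x - v) = coord a (x - y) + coord a (y - v) := by
    rw [← map_add]; congr 1; abel
  have h4 := norm_add_le (coord a (x - y)) (coord a (y - v))
  rw [← h3] at h4
  linarith

end IsRadial

end Radial

/-! ### The variational characterization of minimal densities -/

section EulerLagrange

set_option linter.unusedSectionVars false

variable {ι κ : Type*} [Fintype ι] [Fintype κ] {v : V ι κ} {R : ℝ} {f : V ι κ → ℝ}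

/-- The logarithmic potential of a density. -/
noncomputable def totalPotential (f : V ι κ → ℝ) (x : V ι κ) : ℝ :=
  ∑ a, weight a * potential a f x

theorem continuous_totalPotential (hf : IsProbDensity f) : Continuous (totalPotential f) :=
  continuous_finsetSum _ fun a _ => (continuous_potential hf a).const_mul (weight a)

namespace IsRadial

theorem totalPotential_le (hf : IsRadial f v R) {x x' : V ι κ}
    (h : ∀ a, ‖coord a (x - v)‖ ≤ ‖coord a (x' - v)‖) :
    totalPotential f x ≤ totalPotential f x' :=
  Finset.sum_le_sum fun a _ =>
    mul_le_mul_of_nonneg_left (hf.potential_le a (h a)) (weight_pos a).le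

theorem totalPotential_lt (hf : IsRadial f v R) {x x' : V ι κ}
    (h : ∀ a, ‖coord a (x - v)‖ ≤ ‖coord a (x' - v)‖) {a : ι ⊕ κ}
    (ha : ‖coord a (x - v)‖ < ‖coord a (x' - v)‖) :
    totalPotential f x < totalPotential f x' :=
  Finset.sum_lt_sum
    (fun b _ => mul_le_mul_of_nonneg_left (hf.potential_le b (h b)) (weight_pos b).le)
    ⟨a, Finset.mem_univ a, mul_lt_mul_of_pos_left (hf.potential_lt a ha) (weight_pos a)⟩

theorem potential_sub_le (hf : IsRadial f v R) (a : ι ⊕ κ) (x : V ι κ) :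
    weight a * (potential a f x - potential a f v) ≤ totalPotential f x - totalPotential f v := by
  rw [totalPotential, totalPotential, ← Finset.sum_sub_distrib, mul_sub]
  refine Finset.single_le_sum
    (f := fun b => weight b * potential b f x - weight b * potential b f v) (fun b _ => ?_)
    (Finset.mem_univ a)
  rw [← mul_sub]
  refine mul_nonneg (weight_pos b).le (sub_nonneg.2 (hf.potential_le b ?_))
  simp

theorem _root_.LogNormEnergy.one_le_weight (a : ι ⊕ κ) : 1 ≤ weight a := by
  rcases a with i | j <;> simp [weight]

/-- Every coordinate potential is minimal at v, so a bound on the sum bounds each term, and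
logarithmic growth bounds each coordinate. -/
theorem exists_norm_le_of_totalPotential_le (hf : IsRadial f v R) (c : ℝ) :
    ∃ T, ∀ x, totalPotential f x ≤ c → ‖x‖ ≤ T := by
  set B : ι ⊕ κ → ℝ := fun a =>
    Real.exp (potential a f v + |c - totalPotential f v|) with hB
  have hBpos : ∀ a, 0 ≤ B a := fun a => (Real.exp_pos _).le
  refine ⟨R + ∑ a, B a + ‖v‖, fun x hx => ?_⟩
  have h1 : ‖x - v‖ ≤ R + ∑ a, B a := by
    refine norm_le_of_coord (add_nonneg hf.radius_pos.le (Finset.sum_nonneg fun a _ => hBpos a))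
      fun a => ?_
    by_contra h
    push Not at h
    have hBa : B a ≤ ∑ a, B a :=
      Finset.single_le_sum (f := B) (fun b _ => hBpos b) (Finset.mem_univ a)
    have hRa : R < ‖coord a (x - v)‖ := by linarith [hBpos a]
    have h2 := hf.log_le_potential a hRa
    have h3 := hf.potential_sub_le a x
    have h4 : potential a f x - potential a f v ≤ |c - totalPotential f v| := by
      have h5 : weight a * (potential a f x - potential a f v) ≤ |c - totalPotential f v| :=
        h3.trans (le_trans (by linarith) (le_abs_self _))
      have h6 := one_le_weight a
      have h7 : 0 ≤ potential a f x - potential a f v :=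
        sub_nonneg.2 (hf.potential_le a (by simp))
      nlinarith
    have h8 : ‖coord a (x - v)‖ - R ≤ B a := by
      rw [hB, ← Real.log_le_iff_le_exp (by linarith)]
      linarith
    linarith
  calc ‖x‖ = ‖(x - v) + v‖ := by rw [sub_add_cancel]
    _ ≤ _ := (norm_add_le _ _).trans (by linarith)

/-- Strict monotonicity in the coordinate a puts each section of the level set on a single sphere
about v_a, that is, in a shell of width zero. -/
theorem volume_level_eq_zero [Nonempty (ι ⊕ κ)] (hf : IsRadial f v R) (c : ℝ) :
    volume {x | totalPotential f x = c} = 0 := by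
  obtain ⟨a⟩ := ‹Nonempty (ι ⊕ κ)›
  obtain ⟨T, hT0, hT⟩ : ∃ T, 0 ≤ T ∧ ∀ x, totalPotential f x ≤ c → ‖x‖ ≤ T := by
    obtain ⟨T, hT⟩ := hf.exists_norm_le_of_totalPotential_le c
    exact ⟨max T 0, le_max_right _ _, fun x hx => (hT x hx).trans (le_max_left _ _)⟩
  obtain ⟨C, hC0, hC⟩ := volume_le_of_coord_mem_shell (ι := ι) (κ := κ) a (T + ‖v‖)
  have hmem : ∀ y : V ι κ, totalPotential f y = c → ‖coord a (y - v)‖ ≤ T + ‖v‖ := fun y hy =>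
    (norm_coord_le a _).trans ((norm_sub_le _ _).trans (by linarith [hT y hy.le]))
  have := hC {x | totalPotential f x = c}
    (measurableSet_eq_fun (continuous_totalPotential hf.toIsProbDensity).measurable
      measurable_const) (fun x hx => (hT x hx.le).trans (by simp)) v 0 fun x => ?_
  · simpa using this
  by_cases hex : ∃ y, totalPotential f y = c ∧ ∀ b, b ≠ a → coord b y = coord b x
  · obtain ⟨y, hy, hyx⟩ := hex
    refine ⟨‖coord a (y - v)‖, ‖coord a (y - v)‖, norm_nonneg _, le_rfl, hmem y hy, by simp,
      fun z hz hzx => ?_⟩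
    have hz : totalPotential f z = c := hz
    have : ‖coord a (z - v)‖ = ‖coord a (y - v)‖ := by
      have haux : ∀ z y : V ι κ, totalPotential f z = c → totalPotential f y = c →
          (∀ b, b ≠ a → coord b z = coord b y) → ‖coord a (z - v)‖ ≤ ‖coord a (y - v)‖ := by
        intro z y hz hy hzy
        by_contra h
        push Not at h
        refine (hf.totalPotential_lt (x := y) (x' := z) (fun b => ?_) h).ne (hy.trans hz.symm)
        rcases eq_or_ne b a with rfl | hb
        · exact h.le
        · rw [map_sub, map_sub, hzy b hb]
      exact le_antisymm (haux z y hz hy fun b hb => (hzx b hb).trans (hyx b hb).symm)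
        (haux y z hy hz fun b hb => (hyx b hb).trans (hzx b hb).symm)
    rw [this]
    exact ⟨le_rfl, le_rfl⟩
  · exact ⟨0, 0, le_rfl, le_rfl, by positivity, by simp, fun y hy hyx => (hex ⟨y, hy, hyx⟩).elim⟩

theorem exists_volume_sublevel_eq_one [Nonempty (ι ⊕ κ)] (hf : IsRadial f v R) :
    ∃ c, volume {x | totalPotential f x < c} = 1 := by
  have hcont := continuous_totalPotential hf.toIsProbDensity
  have hfin : ∀ c, volume {x | totalPotential f x < c} ≠ ⊤ := fun c => by
    obtain ⟨T, hT⟩ := hf.exists_norm_le_of_totalPotential_le c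
    refine ((measure_mono fun x hx => ?_).trans_lt
      (measure_closedBall_lt_top (x := (0 : V ι κ)) (r := T))).ne
    exact mem_closedBall_zero_iff.2 (hT x (le_of_lt hx))
  have hmono : Monotone fun c => {x | totalPotential f x < c} :=
    fun c c' h x hx => lt_of_lt_of_le hx h
  -- The threshold is the supremum of S: approaching it from below gives volume at most 1, from
  -- above at least 1.
  set S : Set ℝ := {c | volume {x | totalPotential f x < c} ≤ 1}
  have hS : S.Nonempty := by
    refine ⟨totalPotential f v, ?_⟩
    have : {x | totalPotential f x < totalPotential f v} = ∅ := by
      ext x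
      simp only [mem_ofPred_eq, mem_empty_iff_false, iff_false, not_lt]
      exact hf.totalPotential_le fun a => by simp
    simp only [S, mem_ofPred_eq, this, measure_empty, zero_le]
  -- Otherwise the whole space, the union of the sublevel sets, would have volume at most 1.
  have hSb : BddAbove S := by
    by_contra hnb
    rw [not_bddAbove_iff] at hnb
    have hall : ∀ k : ℕ, volume {x | totalPotential f x < k} ≤ 1 := fun k => by
      obtain ⟨c, hc, hkc⟩ := hnb k
      exact (measure_mono (hmono hkc.le)).trans hc
    have huniv : ⋃ k : ℕ, {x | totalPotential f x < k} = univ := by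
      refine eq_univ_of_forall fun x => ?_
      obtain ⟨k, hk⟩ := exists_nat_gt (totalPotential f x)
      exact mem_iUnion.2 ⟨k, hk⟩
    have hlim := tendsto_measure_iUnion_atTop (μ := volume)
      (s := fun k : ℕ => {x | totalPotential f x < k})
      (fun k l h => hmono (Nat.cast_le.2 h))
    rw [huniv] at hlim
    have h1 := le_of_tendsto' hlim hall
    have hnt : Nontrivial (V ι κ) := by
      obtain ⟨a⟩ := ‹Nonempty (ι ⊕ κ)›
      rcases a with i | j
      · exact ⟨⟨realAxis i 1, 0, fun h => by
          have := congrArg (coord (.inl i)) h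
          rw [coord_realAxis_self] at this; simp at this⟩⟩
      · exact ⟨⟨complexAxis j 1, 0, fun h => by
          have := congrArg (coord (.inr j)) h
          rw [coord_complexAxis_self] at this; simp at this⟩⟩
    have : NoncompactSpace (V ι κ) := NormedSpace.noncompactSpace ℝ _
    rw [measure_univ_of_isAddLeftInvariant] at h1
    simp at h1
  set c := sSup S
  refine ⟨c, le_antisymm ?_ ?_⟩
  · obtain ⟨u, hu, huc, hulim⟩ := exists_seq_strictMono_tendsto c
    have hle : ∀ k, volume {x | totalPotential f x < u k} ≤ 1 := fun k => by
      obtain ⟨c', hc', hk⟩ := exists_lt_of_lt_csSup hS (huc k)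
      exact (measure_mono (hmono hk.le)).trans hc'
    have hun : ⋃ k, {x | totalPotential f x < u k} = {x | totalPotential f x < c} := by
      ext x
      simp only [mem_iUnion, mem_ofPred_eq]
      exact ⟨fun ⟨k, hk⟩ => hk.trans (huc k),
        fun h => (hulim.eventually (lt_mem_nhds h)).exists⟩
    rw [← hun]
    exact le_of_tendsto' (tendsto_measure_iUnion_atTop
      (s := fun k => {x | totalPotential f x < u k}) fun k l h => hmono (hu.monotone h)) hle
  · obtain ⟨u, hu, hcu, hulim⟩ := exists_seq_strictAnti_tendsto c
    have hge : ∀ k, 1 ≤ volume {x | totalPotential f x < u k} := fun k => by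
      by_contra h
      exact absurd (le_csSup hSb (show u k ∈ S from (not_le.1 h).le)) (not_le.2 (hcu k))
    have hin : ⋂ k, {x | totalPotential f x < u k} = {x | totalPotential f x ≤ c} := by
      ext x
      simp only [mem_iInter, mem_ofPred_eq]
      exact ⟨fun h => ge_of_tendsto' hulim fun k => (h k).le, fun h k => h.trans_lt (hcu k)⟩
    have hlim := tendsto_measure_iInter_atTop (μ := volume)
      (s := fun k => {x | totalPotential f x < u k})
      (fun k => (measurableSet_lt hcont.measurable measurable_const).nullMeasurableSet)
      (fun k l h => hmono (hu.antitone h)) ⟨0, hfin _⟩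
    rw [hin] at hlim
    have h1 := ge_of_tendsto' hlim hge
    -- The limit from above is the closed sublevel set; it differs from the open one by a null level
    -- set.
    have h2 : volume {x | totalPotential f x ≤ c} ≤ volume {x | totalPotential f x < c} +
        volume {x | totalPotential f x = c} := by
      refine (measure_mono fun x hx => ?_).trans (measure_union_le _ _)
      exact (show totalPotential f x ≤ c from hx).lt_or_eq
    rw [hf.volume_level_eq_zero, add_zero] at h2
    exact h1.trans h2

end IsRadial

theorem sum_mutualEnergy_eq {g : V ι κ → ℝ} (hf : IsProbDensity f) (hg : IsBddDensity g) :
    ∑ a, weight a * mutualEnergy a f g = ∫ x, totalPotential f x * g x := by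
  simp only [totalPotential, Finset.sum_mul]
  rw [integral_finsetSum _ fun a _ => by
    simpa only [mul_assoc] using
      (hg.integrable_mul (continuous_potential hf a)).const_mul (weight a)]
  refine Finset.sum_congr rfl fun a _ => ?_
  rw [mutualEnergy_comm, mutualEnergy_eq_integral hg hf.toIsBddDensity, ← integral_const_mul]
  simp only [mul_assoc]

/-- The Euler-Lagrange inequality for minimal densities. -/
theorem IsMinimalDensity.integral_totalPotential_le {g : V ι κ → ℝ} (hf : IsMinimalDensity f)
    (hg : IsProbDensity g) :
    ∫ x, totalPotential f x * f x ≤ ∫ x, totalPotential f x * g x := by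
  have hf1 := hf.1.toIsBddDensity
  have hg1 := hg.toIsBddDensity
  rw [← sum_mutualEnergy_eq hf.1 hf1, ← sum_mutualEnergy_eq hf.1 hg1]
  set A := ∑ a, weight a * mutualEnergy a f f with hA
  set B := ∑ a, weight a * mutualEnergy a f g with hB
  set C := ∑ a, weight a * mutualEnergy a g g with hC
  -- Compares f with the convex combination (1 - t) f + t g; the energy is quadratic in t.
  have key : ∀ t : ℝ, 0 ≤ t → t ≤ 1 →
      A ≤ (1 - t) ^ 2 * A + 2 * (1 - t) * t * B + t ^ 2 * C := by
    intro t h0 h1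
    have hbd : ∀ x, 0 ≤ (1 - t) * f x + t * g x ∧ (1 - t) * f x + t * g x ≤ 1 := fun x => by
      have := hf.1.nonneg x; have := hg.nonneg x
      have := hf.1.le_one x; have := hg.le_one x
      constructor <;> nlinarith
    have hd : IsProbDensity fun x => (1 - t) * f x + t * g x := by
      refine ⟨hf1.add hg1 fun x => abs_le.2 ⟨by linarith [(hbd x).1], (hbd x).2⟩,
        fun x => (hbd x).1, ?_⟩
      rw [integral_add (hf1.integrable.const_mul _) (hg1.integrable.const_mul _),
        integral_const_mul, integral_const_mul, hf.1.integral_eq_one, hg.integral_eq_one]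
      ring
    refine (hf.2 _ hd).trans (le_of_eq ?_)
    rw [densityEnergy, hA, hB, hC, Finset.mul_sum, Finset.mul_sum, Finset.mul_sum,
      ← Finset.sum_add_distrib, ← Finset.sum_add_distrib]
    refine Finset.sum_congr rfl fun a _ => ?_
    rw [mutualEnergy_combination hf1 hg1]; ring
  by_contra h
  push Not at h
  -- If B < A, then t = (A - B) / D lies in (0, 1] and is small enough for the negative linear term
  -- to beat the quadratic one.
  set D := |A - 2 * B + C| + (A - B) + 1
  have hD : 0 < D := by have := abs_nonneg (A - 2 * B + C); simp only [D]; linarith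
  have hAB : 0 < A - B := by linarith
  have hle : A - B ≤ D := by have := abs_nonneg (A - 2 * B + C); simp only [D]; linarith
  have ht0 : 0 < (A - B) / D := by positivity
  have h1 := key ((A - B) / D) ht0.le ((div_le_one hD).2 hle)
  have h2 : (A - B) / D * (A - 2 * B + C) < A - B := by
    rw [div_mul_eq_mul_div, div_lt_iff₀ hD]
    refine mul_lt_mul_of_pos_left ?_ hAB
    have := le_abs_self (A - 2 * B + C); simp only [D]; linarith
  set t := (A - B) / D
  have h3 : 0 ≤ t * (2 * (B - A) + t * (A - 2 * B + C)) := by nlinarith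
  have h4 : 2 * (B - A) + t * (A - 2 * B + C) < 0 := by linarith
  nlinarith

/-- A minimal density is the indicator function of a sublevel set of its potential. -/
theorem IsMinimalDensity.ae_eq_indicator [Nonempty (ι ⊕ κ)] (hf : IsMinimalDensity f)
    (hr : IsRadial f v R) :
    ∃ c, f =ᵐ[volume] {x | totalPotential f x < c}.indicator 1 := by
  obtain ⟨c, hc⟩ := hr.exists_volume_sublevel_eq_one
  refine ⟨c, ?_⟩
  have hcont := continuous_totalPotential hf.1
  set U := {x | totalPotential f x < c}
  have hU : MeasurableSet U := measurableSet_lt hcont.measurable measurable_const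
  have hg : IsProbDensity (U.indicator (1 : V ι κ → ℝ)) := by
    obtain ⟨T, hT⟩ := hr.exists_norm_le_of_totalPotential_le c
    refine ⟨⟨measurable_one.indicator hU, fun x => ?_, T, fun x hx => ?_⟩, fun x => ?_, ?_⟩
    · by_cases h : x ∈ U <;> simp [h]
    · have h : x ∉ U := fun h => not_le.2 hx (hT x (le_of_lt h))
      simp [h]
    · exact indicator_nonneg (fun _ _ => zero_le_one) x
    · rw [integral_indicator_one hU, Measure.real, hc, ENNReal.toReal_one]
  set g := U.indicator (1 : V ι κ → ℝ) with hgdef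
  -- Bathtub principle: this product is pointwise nonnegative, but its integral is nonpositive
  -- because f and g have equal mass.
  have hnn : ∀ x, 0 ≤ (totalPotential f x - c) * (f x - g x) := fun x => by
    by_cases h : x ∈ U
    · have h1 : totalPotential f x < c := h
      have h2 : g x = 1 := indicator_of_mem h _
      rw [h2]
      exact mul_nonneg_of_nonpos_of_nonpos (by linarith) (by linarith [hf.1.le_one x])
    · have h1 : c ≤ totalPotential f x := not_lt.1 h
      have h2 : g x = 0 := indicator_of_notMem h _
      rw [h2]
      exact mul_nonneg (by linarith) (by linarith [hf.1.nonneg x])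
  have hexp : ∀ x, (totalPotential f x - c) * (f x - g x) =
      (totalPotential f x * f x - totalPotential f x * g x) - (c * f x - c * g x) :=
    fun x => by ring
  have i1 := hf.1.toIsBddDensity.integrable_mul hcont
  have i2 := hg.toIsBddDensity.integrable_mul hcont
  have i3 := hf.1.integrable.const_mul c
  have i4 := hg.integrable.const_mul c
  have i12 : Integrable fun x => totalPotential f x * f x - totalPotential f x * g x := i1.sub i2
  have i34 : Integrable fun x => c * f x - c * g x := i3.sub i4
  have hint : Integrable fun x => (totalPotential f x - c) * (f x - g x) := by
    simp only [hexp]; exact i12.sub i34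
  have hle : ∫ x, (totalPotential f x - c) * (f x - g x) ≤ 0 := by
    simp only [hexp]
    rw [integral_sub i12 i34, integral_sub i1 i2, integral_sub i3 i4,
      integral_const_mul, integral_const_mul, hf.1.integral_eq_one, hg.integral_eq_one]
    linarith [hf.integral_totalPotential_le hg]
  have hz := (integral_eq_zero_iff_of_nonneg hnn hint).1
    (le_antisymm hle (integral_nonneg hnn))
  have hlev : ∀ᵐ x, totalPotential f x ≠ c := by
    rw [ae_iff]; simpa using hr.volume_level_eq_zero c
  filter_upwards [hz, hlev] with x hx hxc
  rcases mul_eq_zero.1 hx with h | h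
  · exact absurd (sub_eq_zero.1 h) hxc
  · exact sub_eq_zero.1 h

end EulerLagrange

/-! ### Differentiability of the potential in a complex coordinate -/

section LogPotentialProd

variable {Θ Ω E : Type*} [MeasurableSpace Θ] [MeasurableSpace Ω] [NormedAddCommGroup E]
  [MeasurableSpace E] [BorelSpace E] [SecondCountableTopology E] {m : Measure Ω} {θ : Measure Θ}
  {Y : Ω → E} {C α : ℝ}

theorem integrable_prod_log_norm_sub [IsFiniteMeasure m] [IsFiniteMeasure θ] (hY : Measurable Y)
    (hC : 0 ≤ C) (hα : 0 < α)
    (hm : ∀ s : E, ∀ r : ℝ, 0 < r → m {ω | ‖s - Y ω‖ < r} ≤ ENNReal.ofReal (C * r ^ α))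
    {T : ℝ} (hT : ∀ᵐ ω ∂m, ‖Y ω‖ ≤ T) {s : Θ → E} (hs : Measurable s) {B : ℝ}
    (hB : ∀ᵐ t ∂θ, ‖s t‖ ≤ B) :
    Integrable (fun p : Θ × Ω => Real.log ‖s p.1 - Y p.2‖) (θ.prod m) := by
  have hmeas : AEStronglyMeasurable (fun p : Θ × Ω => Real.log ‖s p.1 - Y p.2‖) (θ.prod m) :=
    ((hs.comp measurable_fst).sub (hY.comp measurable_snd)).norm.log.aestronglyMeasurable
  rw [integrable_prod_iff hmeas]
  refine ⟨Filter.Eventually.of_forall fun t => integrable_log_norm_sub hY hC hα hm hT (s t), ?_⟩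
  refine Integrable.of_bound (C := m.real univ * (B + T) + C / α)
    hmeas.norm.integral_prod_right' ?_
  filter_upwards [hB] with t ht
  rw [Real.norm_eq_abs, abs_of_nonneg (integral_nonneg fun _ => norm_nonneg _)]
  refine (integral_abs_log_norm_sub_le hY hC hα hm hT (s t)).trans ?_
  gcongr

end LogPotentialProd

section ComplexCoordinate

set_option linter.unusedSectionVars false

variable {ι κ : Type*} [Fintype ι] [Fintype κ] {v : V ι κ} {R : ℝ} {f : V ι κ → ℝ}

/-- A radial function is continuously differentiable away from the center if its profile is. -/
theorem contDiffOn_of_eq_comp_norm {a : ι ⊕ κ} {u : V ι κ → ℝ} {φ φ' : ℝ → ℝ}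
    (hu : ∀ x, coord a (x - v) ≠ 0 → u x = φ ‖coord a (x - v)‖)
    (hφ : ∀ r, 0 < r → HasDerivAt φ (φ' r) r) (hφ' : ContinuousOn φ' (Ioi 0)) :
    ContDiffOn ℝ 1 u {x | coord a (x - v) ≠ 0} := by
  have h1 : ContDiffOn ℝ 1 φ (Ioi 0) := by
    rw [show (1 : WithTop ℕ∞) = 0 + 1 from rfl, contDiffOn_succ_iff_deriv_of_isOpen isOpen_Ioi]
    refine ⟨fun r hr => (hφ r hr).differentiableAt.differentiableWithinAt, by simp, ?_⟩
    rw [contDiffOn_zero]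
    exact hφ'.congr fun r hr => (hφ r hr).deriv
  have h2 : ContDiffOn ℝ 1 (fun x : V ι κ => ‖coord a (x - v)‖) {x | coord a (x - v) ≠ 0} :=
    fun x hx => (ContDiffAt.norm ℝ ((coord a).contDiff.contDiffAt.comp x
      (contDiffAt_id.sub contDiffAt_const)) hx).contDiffWithinAt
  exact (h1.comp h2 fun x hx => norm_pos_iff.2 hx).congr fun x hx => hu x hx

/-- Thin shells have small measure. -/
theorem IsRadial.measure_shell_le (hf : IsRadial f v R) (a : ι ⊕ κ) :
    ∃ C : ℝ, 0 ≤ C ∧ ∀ r₁ r₂ : ℝ, 0 ≤ r₁ → r₁ ≤ r₂ → densityMeasure f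
      {y | r₁ ≤ ‖coord a (y - v)‖ ∧ ‖coord a (y - v)‖ ≤ r₂} ≤ ENNReal.ofReal (C * (r₂ - r₁)) := by
  obtain ⟨T, hT0, hT, -⟩ := hf.toIsBddDensity.exists_common_bound hf.toIsBddDensity
  set T' := T + ‖v‖
  obtain ⟨C, hC0, hC⟩ := volume_le_of_coord_mem_shell (ι := ι) (κ := κ) a T'
  refine ⟨C, hC0, fun r₁ r₂ h0 h12 => (hf.densityMeasure_le hT _).trans ?_⟩
  have hm : MeasurableSet {y : V ι κ | r₁ ≤ ‖coord a (y - v)‖ ∧ ‖coord a (y - v)‖ ≤ r₂} :=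
    MeasurableSet.inter (s₁ := {y : V ι κ | r₁ ≤ ‖coord a (y - v)‖})
      (s₂ := {y : V ι κ | ‖coord a (y - v)‖ ≤ r₂}) (measurableSet_le (by fun_prop) (by fun_prop))
      (measurableSet_le (by fun_prop) (by fun_prop))
  rw [Measure.restrict_apply hm]
  refine hC _ (hm.inter measurableSet_closedBall) (fun x hx => ?_) v _ fun x => ?_
  · exact (mem_closedBall_zero_iff.1 hx.2).trans (by simp [T'])
  -- Radii are truncated at T', as the shell estimate requires; this loses nothing because the
  -- relevant y satisfy the bound T' anyway.
  · refine ⟨min r₁ T', min r₂ T', le_min h0 (by positivity), min_le_min_right _ h12,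
      min_le_right _ _, ?_, fun y hy _ => ⟨(min_le_left _ _).trans hy.1.1, le_min hy.1.2 ?_⟩⟩
    · rcases le_total r₁ T' with h | h
      · rw [min_eq_left h]; linarith [min_le_left r₂ T']
      · rw [min_eq_right h]; linarith [min_le_right r₂ T']
    · exact (norm_coord_le a _).trans ((norm_sub_le _ _).trans
        (by simpa [T'] using mem_closedBall_zero_iff.1 hy.2))

/-- Makes the mass function r ↦ mass(r) Lipschitz, hence the derivative mass(r) / r continuous. -/
theorem IsRadial.measureReal_lt_sub_le (hf : IsRadial f v R) (a : ι ⊕ κ) :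
    ∃ C : ℝ, 0 ≤ C ∧ ∀ r₁ r₂ : ℝ, 0 ≤ r₁ → r₁ ≤ r₂ →
      |(densityMeasure f).real {y | ‖coord a (y - v)‖ < r₂} -
        (densityMeasure f).real {y | ‖coord a (y - v)‖ < r₁}| ≤ C * (r₂ - r₁) := by
  have := hf.isProbabilityMeasure
  obtain ⟨C, hC0, hC⟩ := hf.measure_shell_le a
  refine ⟨C, hC0, fun r₁ r₂ h0 h12 => ?_⟩
  have hsub : {y : V ι κ | ‖coord a (y - v)‖ < r₁} ⊆ {y | ‖coord a (y - v)‖ < r₂} :=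
    fun y hy => lt_of_lt_of_le hy h12
  have hle := measureReal_mono (μ := densityMeasure f) hsub
  have hun : {y : V ι κ | ‖coord a (y - v)‖ < r₂} ⊆ {y | ‖coord a (y - v)‖ < r₁} ∪
      {y | r₁ ≤ ‖coord a (y - v)‖ ∧ ‖coord a (y - v)‖ ≤ r₂} := fun y hy => by
    rcases lt_or_ge ‖coord a (y - v)‖ r₁ with h | h
    · exact Or.inl h
    · exact Or.inr ⟨h, le_of_lt hy⟩
  have h1 := (measureReal_mono (μ := densityMeasure f) hun).trans (measureReal_union_le _ _)
  have h2 : (densityMeasure f).real {y | r₁ ≤ ‖coord a (y - v)‖ ∧ ‖coord a (y - v)‖ ≤ r₂} ≤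
      C * (r₂ - r₁) :=
    ENNReal.toReal_le_of_le_ofReal (mul_nonneg hC0 (sub_nonneg.2 h12)) (hC r₁ r₂ h0 h12)
  rw [abs_of_nonneg (by linarith)]
  linarith

theorem circleAverage_log_eq {r : ℝ} (hr : 0 < r) (w : ℂ) :
    Real.circleAverage (fun z => Real.log ‖z - w‖) 0 r = Real.log (max r ‖w‖) := by
  rw [circleAverage_log_norm_sub_const_eq_log_radius_add_posLog hr.ne', zero_sub, norm_neg,
    Real.posLog]
  rcases (norm_nonneg w).eq_or_lt with h | h
  · rw [← h]; simp [max_eq_left hr.le]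
  · rw [Real.log_mul (by positivity) h.ne', Real.log_inv]
    rcases le_total r ‖w‖ with h' | h'
    · rw [max_eq_right h', max_eq_right (by linarith [Real.log_le_log hr h'])]; ring
    · rw [max_eq_left h', max_eq_left (by linarith [Real.log_le_log h h'])]; ring

/-- The potential in a complex coordinate, by averaging over circles. -/
theorem IsRadial.potential_eq_integral_log_max (hf : IsRadial f v R) (j : κ) (x : V ι κ)
    (hx : coord (.inr j) (x - v) ≠ 0) :
    potential (.inr j) f x = ∫ y, Real.log (max ‖coord (.inr j) (x - v)‖
      ‖coord (.inr j) (y - v)‖) ∂(densityMeasure f) := by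
  set a : ι ⊕ κ := .inr j
  set r := ‖coord a (x - v)‖ with hr
  have hr0 : 0 < r := norm_pos_iff.2 hx
  have := hf.isProbabilityMeasure
  obtain ⟨T, hT⟩ := hf.bounded
  have hle := hf.densityMeasure_le hT
  obtain ⟨C, hC0, hC⟩ := measure_coord_ball_le (ι := ι) (κ := κ) a T
  -- Monotonicity in both directions makes the potential constant on the circle through x, so it
  -- equals its circle average; Fubini then moves the average onto the kernel.
  have hpt : ∀ t : ℝ, ∫ y, Real.log ‖circleMap 0 r t - coord a (y - v)‖ ∂(densityMeasure f) =
      potential a f x := fun t => by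
    have h1 : coord a (v + complexAxis j (circleMap 0 r t) - v) = circleMap 0 r t := by
      rw [add_sub_cancel_left, coord_complexAxis_self]
    have h2 : ‖coord a (v + complexAxis j (circleMap 0 r t) - v)‖ = ‖coord a (x - v)‖ := by
      rw [h1, norm_circleMap_zero, abs_of_pos hr0]
    rw [le_antisymm (hf.potential_le a h2.ge) (hf.potential_le a h2.le),
      potential_eq_integral hf.toIsProbDensity]
    congr 1; ext y
    rw [map_add, coord_complexAxis_self, map_sub]
    congr 2; ring
  have hint := integrable_prod_log_norm_sub (θ := volume.restrict (Ioc 0 (2 * Real.pi)))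
    (m := densityMeasure f) (Y := coord a) (by fun_prop) hC0 one_pos (hC _ hle)
    (ae_norm_coord_le_of_le hle a) (s := fun t => coord a v + circleMap 0 r t) (by fun_prop)
    (B := ‖coord a v‖ + r) (Filter.Eventually.of_forall fun t => (norm_add_le _ _).trans (by
      rw [norm_circleMap_zero, abs_of_pos hr0]))
  have hswap := integral_integral_swap (f := fun (t : ℝ) (y : V ι κ) =>
    Real.log ‖circleMap 0 r t - coord a (y - v)‖) (μ := volume.restrict (Ioc 0 (2 * Real.pi)))
    (ν := densityMeasure f) (by
      refine hint.congr (Filter.Eventually.of_forall fun p => ?_)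
      simp only [Function.uncurry, map_sub]
      congr 2; ring)
  simp only [hpt, integral_const, measureReal_restrict_apply MeasurableSet.univ, univ_inter,
    Real.volume_real_Ioc_of_le Real.two_pi_pos.le, sub_zero, smul_eq_mul] at hswap
  have h3 : ∀ y : V ι κ, ∫ t in Ioc 0 (2 * Real.pi), Real.log ‖circleMap 0 r t - coord a (y - v)‖ =
      2 * Real.pi * Real.log (max r ‖coord a (y - v)‖) := fun y => by
    rw [← circleAverage_log_eq hr0, Real.circleAverage,
      intervalIntegral.integral_of_le Real.two_pi_pos.le, smul_eq_mul, ← mul_assoc,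
      mul_inv_cancel₀ Real.two_pi_pos.ne', one_mul]
  simp only [h3, integral_const_mul] at hswap
  exact mul_left_cancel₀ Real.two_pi_pos.ne' hswap

/-- The integrand has derivative 1/r where |y_a - v_a| < r and 0 where it is larger; the set of
equality is null, and near r the Lipschitz constant 2/r dominates. -/
theorem IsRadial.hasDerivAt_integral_log_max (hf : IsRadial f v R) (a : ι ⊕ κ) {r : ℝ}
    (hr : 0 < r) :
    HasDerivAt (fun r => ∫ y, Real.log (max r ‖coord a (y - v)‖) ∂(densityMeasure f))
      ((densityMeasure f).real {y | ‖coord a (y - v)‖ < r} * r⁻¹) r := by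
  have := hf.isProbabilityMeasure
  obtain ⟨T, hT⟩ := hf.bounded
  have hle := hf.densityMeasure_le hT
  obtain ⟨C, hC0, hC⟩ := hf.measure_shell_le a
  have hne : ∀ᵐ y ∂(densityMeasure f), ‖coord a (y - v)‖ ≠ r := by
    rw [ae_iff]
    have := hC r r hr.le le_rfl
    rw [sub_self, mul_zero, ENNReal.ofReal_zero] at this
    refine measure_mono_null (fun y hy => ?_) (le_antisymm this zero_le)
    simp only [mem_ofPred_eq, not_not] at hy
    exact ⟨hy.ge, hy.le⟩
  have hms : MeasurableSet {y : V ι κ | ‖coord a (y - v)‖ < r} :=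
    measurableSet_lt (by fun_prop) (by fun_prop)
  have key := hasDerivAt_integral_of_dominated_loc_of_lip (μ := densityMeasure f)
    (F := fun (r : ℝ) (y : V ι κ) => Real.log (max r ‖coord a (y - v)‖)) (x₀ := r)
    (F' := {y : V ι κ | ‖coord a (y - v)‖ < r}.indicator fun _ => r⁻¹)
    (bound := fun _ => (r / 2)⁻¹) (Metric.ball_mem_nhds r (half_pos hr))
    (Filter.Eventually.of_forall fun r => by
      apply Measurable.aestronglyMeasurable; fun_prop)
    (by
      have := integrable_log_max (m := densityMeasure f) (Y := coord a) (by fun_prop)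
        (ae_norm_coord_le_of_le hle a) (coord a v) hr
      refine this.congr (Filter.Eventually.of_forall fun y => ?_)
      simp only [map_sub]
      rw [max_comm, norm_sub_rev])
    (measurable_const.indicator hms).aestronglyMeasurable
    (Filter.Eventually.of_forall fun y => by
      refine LipschitzOnWith.of_dist_le_mul fun r₁ h₁ r₂ h₂ => ?_
      rw [Metric.mem_ball, Real.dist_eq, abs_lt] at h₁ h₂
      have hr2 := half_pos hr
      have e : ∀ s, r / 2 < s → max s ‖coord a (y - v)‖ =
          max (max s ‖coord a (y - v)‖) (r / 2) := fun s hs =>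
        (max_eq_left (hs.le.trans (le_max_left _ _))).symm
      rw [Real.dist_eq, Real.dist_eq, Real.coe_nnabs, abs_of_pos (inv_pos.2 hr2),
        e r₁ (by linarith), e r₂ (by linarith), inv_mul_eq_div, abs_le]
      have hmx := abs_max_sub_max_le_abs r₁ r₂ ‖coord a (y - v)‖
      have l1 := log_max_sub_le (r := max r₁ ‖coord a (y - v)‖)
        (r' := max r₂ ‖coord a (y - v)‖) hr2
      have l2 := log_max_sub_le (r := max r₂ ‖coord a (y - v)‖)
        (r' := max r₁ ‖coord a (y - v)‖) hr2
      rw [abs_sub_comm] at l2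
      have l3 : |max r₁ ‖coord a (y - v)‖ - max r₂ ‖coord a (y - v)‖| / (r / 2) ≤
        |r₁ - r₂| / (r / 2) := by gcongr
      constructor <;> linarith)
    (integrable_const _)
    (by
      filter_upwards [hne] with y hy
      rcases lt_or_gt_of_ne hy with h | h
      · rw [indicator_of_mem (show y ∈ {y : V ι κ | ‖coord a (y - v)‖ < r} from h)]
        refine (Real.hasDerivAt_log hr.ne').congr_of_eventuallyEq ?_
        filter_upwards [lt_mem_nhds h] with s hs
        rw [max_eq_left hs.le]
      · rw [indicator_of_notMem (by simpa using h.le)]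
        refine (hasDerivAt_const r (Real.log ‖coord a (y - v)‖)).congr_of_eventuallyEq ?_
        filter_upwards [gt_mem_nhds h] with s hs
        rw [max_eq_right hs.le])
  have h := key.2
  rwa [integral_indicator_const _ hms, smul_eq_mul] at h

theorem IsRadial.contDiffOn_potential_inr (hf : IsRadial f v R) (j : κ) :
    ContDiffOn ℝ 1 (potential (.inr j) f) {x : V ι κ | coord (.inr j) (x - v) ≠ 0} := by
  refine contDiffOn_of_eq_comp_norm (fun x hx => hf.potential_eq_integral_log_max j x hx)
    (fun r hr => hf.hasDerivAt_integral_log_max (.inr j) hr) ?_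
  refine ContinuousOn.mul ?_ (continuousOn_inv₀.mono fun r hr => (ne_of_gt hr))
  obtain ⟨C, hC0, hC⟩ := hf.measureReal_lt_sub_le (.inr j)
  refine (LipschitzOnWith.of_dist_le_mul (K := ⟨C, hC0⟩) fun r₁ h₁ r₂ h₂ => ?_).continuousOn
  rw [Real.dist_eq, Real.dist_eq]
  have h₁ : 0 < r₁ := h₁
  have h₂ : 0 < r₂ := h₂
  rcases le_total r₁ r₂ with h | h
  · rw [abs_sub_comm, abs_sub_comm r₁, abs_of_nonneg (sub_nonneg.2 h)]
    exact hC r₁ r₂ h₁.le h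
  · rw [abs_of_nonneg (sub_nonneg.2 h)]
    exact hC r₂ r₁ h₂.le h

end ComplexCoordinate

/-! ### Differentiability of the potential in a real coordinate -/

section Exchange

variable {E W : Type*} [NormedAddCommGroup E] [NormedSpace ℝ E]
    [FiniteDimensional ℝ E] [MeasureSpace E] [BorelSpace E] [NormedAddCommGroup W]
    [NormedSpace ℝ W] [FiniteDimensional ℝ W] [MeasureSpace W] [BorelSpace W]
    [(volume : Measure E).IsAddHaarMeasure] [(volume : Measure W).IsAddHaarMeasure]

/-- Fubini's theorem for a coordinate `p` with section `s`. -/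
theorem integral_exchange (p : W →L[ℝ] E) (s : E →L[ℝ] W) (hps : ∀ t, p (s t) = t)
    {ρ : E → ℝ} (hρ : Integrable ρ) {F : W → ℝ} (hF : Integrable F) :
    Integrable (fun x => ρ (p x) * ∫ t, F (x + s (t - p x))) ∧
      ∫ x, ρ (p x) * ∫ t, F (x + s (t - p x)) = (∫ t, ρ t) * ∫ x, F x := by
  have : ProperSpace E := FiniteDimensional.proper ℝ E
  have : ProperSpace W := FiniteDimensional.proper ℝ W
  have hmp := measurePreserving_exchange volume volume p s hps
  have hG : Integrable (fun z : E × W => ρ z.1 * F z.2) (volume.prod volume) := hρ.mul_prod hF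
  have hGe := hmp.integrable_comp_of_integrable hG
  have e1 : ∫ z, ρ (p z.2) * F (z.2 + s (z.1 - p z.2)) ∂((volume : Measure E).prod
      (volume : Measure W)) = (∫ t, ρ t) * ∫ x, F x := by
    rw [← integral_prod_mul]
    conv_rhs => rw [← hmp.map_eq]
    rw [integral_map hmp.measurable.aemeasurable
      (by rw [hmp.map_eq]; exact hG.aestronglyMeasurable)]
  have e2 := integral_prod_symm _ hGe
  have e3 := hGe.integral_prod_right
  simp only [Function.comp, integral_const_mul] at e2 e3
  exact ⟨e3, e2.symm.trans e1⟩

end Exchange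

section RealCoordinate

set_option linter.unusedSectionVars false

variable {ι κ : Type*} [Fintype ι] [Fintype κ] {v : V ι κ} {R : ℝ} {f : V ι κ → ℝ}

/-- The potential along a real axis through `v`. -/
noncomputable def profile (f : V ι κ → ℝ) (v : V ι κ) (i : ι) (r : ℝ) : ℝ :=
  potential (.inl i) f (v + realAxis i r)

theorem norm_coord_realAxis (v : V ι κ) (i : ι) (r : ℝ) :
    ‖coord (.inl i) (v + realAxis i r - v)‖ = |r| := by
  rw [add_sub_cancel_left, coord_realAxis_self, Complex.norm_real, Real.norm_eq_abs]

/-- The half-width of a sublevel set of the profile. -/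
noncomputable def halfWidth (f : V ι κ → ℝ) (v : V ι κ) (i : ι) (s : ℝ) : ℝ :=
  sSup {r | profile f v i r < s}

namespace IsRadial

theorem profile_le (hf : IsRadial f v R) (i : ι) {r r' : ℝ} (h : |r| ≤ |r'|) :
    profile f v i r ≤ profile f v i r' :=
  hf.potential_le _ (by rwa [norm_coord_realAxis, norm_coord_realAxis])

theorem potential_eq_profile_norm (hf : IsRadial f v R) (i : ι) (x : V ι κ) :
    potential (.inl i) f x = profile f v i ‖coord (.inl i) (x - v)‖ :=
  le_antisymm (hf.potential_le _ (by rw [norm_coord_realAxis, abs_norm]))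
    (hf.potential_le _ (by rw [norm_coord_realAxis, abs_norm]))

theorem continuous_profile (hf : IsRadial f v R) (i : ι) : Continuous (profile f v i) :=
  (continuous_potential hf.toIsProbDensity _).comp (by fun_prop)

theorem exists_abs_profile_sub_le (hf : IsRadial f v R) (i : ι) :
    ∃ K : ℝ, 0 ≤ K ∧ ∀ r r', |profile f v i r - profile f v i r'| ≤ K * √|r - r'| := by
  obtain ⟨K, hK0, hK⟩ := exists_abs_potential_sub_le hf.toIsProbDensity (.inl i)
  refine ⟨K, hK0, fun r r' => (hK _ _).trans (le_of_eq ?_)⟩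
  rw [add_sub_add_left_eq_sub, ← map_sub, coord_realAxis_self, Complex.norm_real, Real.norm_eq_abs]

theorem bddAbove_profile_lt (hf : IsRadial f v R) (i : ι) (s : ℝ) :
    BddAbove {r | profile f v i r < s} := by
  refine ⟨R + Real.exp s, fun r hr => ?_⟩
  by_contra h
  push Not at h
  have h1 := Real.exp_pos s
  have h2 : |r| = r := abs_of_pos (by linarith [hf.radius_pos])
  have h3 := hf.log_le_potential (.inl i) (x := v + realAxis i r)
    (by rw [norm_coord_realAxis, h2]; linarith)
  rw [norm_coord_realAxis, h2] at h3
  have h4 : Real.log (r - R) < s := h3.trans_lt hr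
  rw [Real.log_lt_iff_lt_exp (by linarith)] at h4
  linarith

/-- The profile depends monotonically on |r|, and continuity makes the sublevel set open. An empty
sublevel set has half-width `sSup ∅ = 0`, which matches the empty interval. -/
theorem setOf_profile_lt (hf : IsRadial f v R) (i : ι) (s : ℝ) :
    {r | profile f v i r < s} = Ioo (-halfWidth f v i s) (halfWidth f v i s) := by
  ext r
  rw [mem_Ioo, ← abs_lt, mem_ofPred_eq]
  constructor
  · intro hr
    have hr' : profile f v i |r| < s := (hf.profile_le i (abs_abs r).le).trans_lt hr
    have h1 := ((hf.continuous_profile i).tendsto |r|).eventually (gt_mem_nhds hr')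
    obtain ⟨r', h2, h3⟩ := ((h1.filter_mono nhdsWithin_le_nhds).and
      (self_mem_nhdsWithin : Ioi |r| ∈ nhdsWithin |r| (Ioi |r|))).exists
    exact lt_of_lt_of_le h3 (le_csSup (hf.bddAbove_profile_lt i s) h2)
  · intro hr
    have hne : {r | profile f v i r < s}.Nonempty := by
      by_contra h
      rw [not_nonempty_iff_eq_empty] at h
      rw [halfWidth, h, Real.sSup_empty] at hr
      exact absurd hr (not_lt.2 (abs_nonneg r))
    obtain ⟨r', h1, h2⟩ := exists_lt_of_lt_csSup hne hr
    exact (hf.profile_le i (h2.le.trans (le_abs_self _))).trans_lt h1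

theorem halfWidth_nonneg (hf : IsRadial f v R) (i : ι) (s : ℝ) : 0 ≤ halfWidth f v i s := by
  rcases {r | profile f v i r < s}.eq_empty_or_nonempty with h | ⟨r, hr⟩
  · rw [halfWidth, h, Real.sSup_empty]
  · refine le_csSup (hf.bddAbove_profile_lt i s) ?_
    exact (hf.profile_le i (by rw [abs_zero]; exact abs_nonneg r)).trans_lt hr

theorem monotone_halfWidth (hf : IsRadial f v R) (i : ι) : Monotone (halfWidth f v i) := by
  intro s s' h
  rcases {r | profile f v i r < s}.eq_empty_or_nonempty with h0 | h0
  · rw [halfWidth, h0, Real.sSup_empty]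
    exact hf.halfWidth_nonneg i s'
  · exact csSup_le_csSup (hf.bddAbove_profile_lt i s') h0 fun r hr => lt_of_lt_of_le hr h

/-- Recovers the level from the half-width, so that half-widths close to each other force levels
close to each other. -/
theorem profile_halfWidth (hf : IsRadial f v R) (i : ι) {s : ℝ} (hs : 0 < halfWidth f v i s) :
    profile f v i (halfWidth f v i s) = s := by
  have hset := hf.setOf_profile_lt i s
  apply le_antisymm
  · have h1 : halfWidth f v i s ∈ closure {r | profile f v i r < s} := by
      rw [hset, closure_Ioo (by linarith)]
      exact ⟨by linarith, le_rfl⟩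
    exact closure_lt_subset_le (hf.continuous_profile i) continuous_const h1
  · by_contra h
    push Not at h
    have h1 : halfWidth f v i s ∈ {r | profile f v i r < s} := h
    rw [hset] at h1
    exact lt_irrefl _ h1.2

end IsRadial

/-- The part of the potential that does not depend on a given real coordinate. -/
noncomputable def restPotential (f : V ι κ → ℝ) (i : ι) (x : V ι κ) : ℝ :=
  totalPotential f x - potential (.inl i) f x

theorem totalPotential_sub_of_coord_eq {a : ι ⊕ κ} {x y : V ι κ}
    (h : ∀ b, b ≠ a → coord b x = coord b y) :
    totalPotential f x - totalPotential f y =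
      weight a * (potential a f x - potential a f y) := by
  rw [totalPotential, totalPotential, ← Finset.sum_sub_distrib, Finset.sum_eq_single a]
  · ring
  · intro b _ hb
    rw [potential_congr (h b hb), sub_self]
  · simp

theorem totalPotential_replace (f : V ι κ → ℝ) (v : V ι κ) (i : ι) (x : V ι κ) (t : ℝ) :
    totalPotential f (x + realAxis i (t - x.1 i)) =
      restPotential f i x + profile f v i (t - v.1 i) := by
  have h1 := totalPotential_sub_of_coord_eq (f := f) (a := .inl i)
    (x := x + realAxis i (t - x.1 i)) (y := x)
    fun b hb => by rw [map_add, coord_realAxis_of_ne hb, add_zero]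
  have h2 : potential (.inl i) f (x + realAxis i (t - x.1 i)) = profile f v i (t - v.1 i) := by
    refine potential_congr ?_
    rw [map_add, coord_realAxis_self, map_add, coord_realAxis_self]; simp
  rw [h2, show weight (.inl i : ι ⊕ κ) = 1 from rfl] at h1
  rw [restPotential]; linarith

theorem integral_log_sub_interval (r h : ℝ) (hh : 0 ≤ h) :
    ∫ t, Real.log (r - t) * (Ioo (-h) h).indicator 1 t = ∫ s in (r - h)..(r + h), Real.log s := by
  have e : ∀ t, Real.log (r - t) * (Ioo (-h) h).indicator 1 t =
      (Ioo (-h) h).indicator (fun t => Real.log (r - t)) t := fun t => by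
    by_cases ht : t ∈ Ioo (-h) h <;> simp [ht]
  simp only [e]
  rw [integral_indicator measurableSet_Ioo, ← integral_Ioc_eq_integral_Ioo,
    ← intervalIntegral.integral_of_le (by linarith), intervalIntegral.integral_comp_sub_left,
    sub_neg_eq_add]

/-- The derivative in r of the interval integral, in integrated form; this avoids differentiating
under the singular logarithm. -/
theorem integral_log_interval_sub (r₁ r₂ h : ℝ) :
    (∫ s in (r₂ - h)..(r₂ + h), Real.log s) - ∫ s in (r₁ - h)..(r₁ + h), Real.log s =
      ∫ s in r₁..r₂, (Real.log (s + h) - Real.log (s - h)) := by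
  have hi : ∀ a b, IntervalIntegrable Real.log volume a b := fun a b =>
    intervalIntegral.intervalIntegrable_log'
  rw [intervalIntegral.integral_interval_sub_interval_comm (hi _ _) (hi _ _) (hi _ _),
    intervalIntegral.integral_sub, intervalIntegral.integral_comp_add_right,
    intervalIntegral.integral_comp_sub_right, intervalIntegral.integral_symm (r₁ - h),
    intervalIntegral.integral_symm (r₁ + h)]
  · ring
  · simpa using (hi (r₁ + h) (r₂ + h)).comp_add_right h
  · simpa using (hi (r₁ - h) (r₂ - h)).comp_sub_right h

namespace IsRadial

/-- The half-width of the section of the sublevel set through a point. -/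
noncomputable def _root_.LogNormEnergy.sectionWidth (f : V ι κ → ℝ) (v : V ι κ) (i : ι) (c : ℝ)
    (x : V ι κ) : ℝ := halfWidth f v i (c - restPotential f i x)

theorem sectionWidth_nonneg (hf : IsRadial f v R) (i : ι) (c : ℝ) (x : V ι κ) :
    0 ≤ sectionWidth f v i c x := hf.halfWidth_nonneg i _

theorem measurable_sectionWidth (hf : IsRadial f v R) (i : ι) (c : ℝ) :
    Measurable (sectionWidth f v i c) := by
  refine (hf.monotone_halfWidth i).measurable.comp ?_
  have h1 := (continuous_totalPotential hf.toIsProbDensity).measurable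
  have h2 := (continuous_potential hf.toIsProbDensity (.inl i)).measurable
  exact measurable_const.sub (h1.sub h2)

/-- The profile as an integral over sections. -/
theorem profile_eq_integral (hf : IsRadial f v R) (i : ι) {c : ℝ}
    (hc : f =ᵐ[volume] {x | totalPotential f x < c}.indicator 1) (r : ℝ) :
    Integrable (fun x : V ι κ => (Icc (0 : ℝ) 1).indicator 1 (x.1 i) *
      ∫ s in (r - sectionWidth f v i c x)..(r + sectionWidth f v i c x), Real.log s) ∧
    ∫ x : V ι κ, (Icc (0 : ℝ) 1).indicator 1 (x.1 i) *
      ∫ s in (r - sectionWidth f v i c x)..(r + sectionWidth f v i c x), Real.log s =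
        profile f v i r := by
  set U := {x | totalPotential f x < c}
  set F : V ι κ → ℝ := fun y => logCoord (.inl i) (v + realAxis i r - y) * U.indicator 1 y with hFdef
  have hFe : (fun y => logCoord (.inl i) (v + realAxis i r - y) * f y) =ᵐ[volume] F := by
    filter_upwards [hc] with y hy
    rw [hFdef, hy]
  have hF : Integrable F :=
    (hf.toIsBddDensity.integrable_logCoord_mul (.inl i) (v + realAxis i r)).congr hFe
  have hFi : ∫ y, F y = profile f v i r := (integral_congr_ae hFe).symm
  -- A weight of mass one on the base points, so that each line counts once.
  have hρ : Integrable ((Icc (0 : ℝ) 1).indicator (1 : ℝ → ℝ)) :=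
    (integrable_indicator_iff measurableSet_Icc).2 (integrableOn_const (by simp))
  have hρ1 : ∫ t, (Icc (0 : ℝ) 1).indicator (1 : ℝ → ℝ) t = 1 := by
    rw [integral_indicator_one measurableSet_Icc]; simp
  have key := integral_exchange (ContinuousLinearMap.proj i ∘L
    ContinuousLinearMap.fst ℝ (ι → ℝ) (κ → ℂ)) (realAxis i) (fun t => by simp [realAxis]) hρ hF
  simp only [ContinuousLinearMap.comp_apply, ContinuousLinearMap.coe_fst',
    ContinuousLinearMap.proj_apply, hρ1, hFi, one_mul] at key
  have hin : ∀ x : V ι κ, ∫ t, F (x + realAxis i (t - x.1 i)) =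
      ∫ s in (r - sectionWidth f v i c x)..(r + sectionWidth f v i c x), Real.log s := by
    intro x
    rw [← integral_log_sub_interval _ _ (hf.sectionWidth_nonneg i c x),
      ← integral_sub_right_eq_self (fun t => Real.log (r - t) *
        (Ioo (-sectionWidth f v i c x) (sectionWidth f v i c x)).indicator 1 t) (v.1 i)]
    congr 1; ext t
    have h1 : logCoord (.inl i) (v + realAxis i r - (x + realAxis i (t - x.1 i))) =
        Real.log (r - (t - v.1 i)) := by
      rw [logCoord, map_sub, map_add, map_add, coord_realAxis_self, coord_realAxis_self, coord_inl,
        coord_inl]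
      rw [← Real.log_abs (r - (t - v.1 i)), ← Real.norm_eq_abs, ← Complex.norm_real]
      congr 2; push_cast; ring
    have h2 : x + realAxis i (t - x.1 i) ∈ U ↔
        t - v.1 i ∈ Ioo (-sectionWidth f v i c x) (sectionWidth f v i c x) := by
      rw [sectionWidth, ← hf.setOf_profile_lt i]
      change totalPotential f _ < c ↔ _
      rw [totalPotential_replace f v i x t]
      exact lt_sub_iff_add_lt'.symm
    simp only [hFdef]
    rw [h1]
    congr 1
    by_cases h : x + realAxis i (t - x.1 i) ∈ U
    · rw [indicator_of_mem h, indicator_of_mem (h2.1 h)]; rfl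
    · rw [indicator_of_notMem h, indicator_of_notMem fun h' => h (h2.2 h')]
  simp only [hin] at key
  exact key

/-- The points of a slab whose sections are nonempty. -/
def _root_.LogNormEnergy.slab (f : V ι κ → ℝ) (v : V ι κ) (i : ι) (c : ℝ) : Set (V ι κ) :=
  {x | x.1 i ∈ Icc (0 : ℝ) 1} ∩ {x | 0 < sectionWidth f v i c x}

theorem measurableSet_slab (hf : IsRadial f v R) (i : ι) (c : ℝ) :
    MeasurableSet (slab f v i c) := by
  have : Measurable fun x : V ι κ => x.1 i := by fun_prop
  exact (this measurableSet_Icc).inter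
    (measurableSet_lt measurable_const (hf.measurable_sectionWidth i c))

/-- Coordinate i lies in [0, 1]; the others agree with those of the midpoint of the section, which
belongs to a bounded sublevel set. -/
theorem exists_norm_le_of_mem_slab (hf : IsRadial f v R) (i : ι) (c : ℝ) :
    ∃ T, 0 < T ∧ ∀ x ∈ slab f v i c, ‖x‖ ≤ T := by
  obtain ⟨T, hT⟩ := hf.exists_norm_le_of_totalPotential_le c
  refine ⟨max T 1, by positivity, fun x hx => norm_le_of_coord (by positivity) fun b => ?_⟩
  rcases eq_or_ne b (.inl i) with rfl | hb
  · refine le_trans ?_ (le_max_right _ _)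
    rw [coord_inl, Complex.norm_real, Real.norm_of_nonneg hx.1.1]
    exact hx.1.2
  · refine le_trans ?_ (le_max_left _ _)
    have h0 : (0 : ℝ) ∈ Ioo (-sectionWidth f v i c x) (sectionWidth f v i c x) :=
      ⟨by simpa using hx.2, hx.2⟩
    rw [sectionWidth, ← hf.setOf_profile_lt i, mem_ofPred_eq] at h0
    have h1 := totalPotential_replace f v i x (v.1 i)
    rw [sub_self] at h1
    have h2 := hT (x + realAxis i (v.1 i - x.1 i)) (by rw [h1]; linarith)
    have h3 := (norm_coord_le b _).trans h2
    rwa [map_add, coord_realAxis_of_ne hb, add_zero] at h3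

theorem exists_sectionWidth_le (hf : IsRadial f v R) (i : ι) (c : ℝ) :
    ∃ B, ∀ x, ‖sectionWidth f v i c x‖ ≤ B := by
  refine ⟨halfWidth f v i (c - ∑ b, weight b * potential b f v + potential (.inl i) f v),
    fun x => ?_⟩
  rw [Real.norm_of_nonneg (hf.sectionWidth_nonneg i c x)]
  refine hf.monotone_halfWidth i ?_
  have h := hf.totalPotential_le (x := v)
    (x' := x + realAxis i (v.1 i - x.1 i)) fun a => by simp
  rw [totalPotential_replace f v i x, sub_self] at h
  have h2 : profile f v i 0 = potential (.inl i) f v := by simp [profile]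
  rw [h2, totalPotential] at h
  linarith

/-- The section widths of the sublevel set have no atoms, quantitatively. -/
theorem volume_sectionWidth_near_le (hf : IsRadial f v R) (i : ι) (c : ℝ) {b : ι ⊕ κ}
    (hb : b ≠ .inl i) :
    ∃ C : ℝ, 0 ≤ C ∧ ∀ s ε : ℝ, 0 < ε → (volume.restrict (slab f v i c))
      {x | ‖s - sectionWidth f v i c x‖ < ε} ≤ ENNReal.ofReal (C * ε ^ (1 / 4 : ℝ)) := by
  obtain ⟨T, hT0, hT⟩ := hf.exists_norm_le_of_mem_slab i c
  obtain ⟨K, hK0, hK⟩ := hf.exists_abs_profile_sub_le i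
  set T' := max R (T + ‖v‖)
  have hTT' : T ≤ T' := le_trans (by simp) (le_max_right _ _)
  have hT'0 : 0 ≤ T' := hT0.le.trans hTT'
  obtain ⟨C, hC0, hC⟩ := volume_le_of_coord_mem_shell (ι := ι) (κ := κ) b T'
  refine ⟨C * (2 * √(8 * T' ^ 2 * (K * √2))), by positivity, fun s ε hε => ?_⟩
  -- Half-widths within 2ε give levels within K √(2ε) by Hölder continuity, hence b-radii whose
  -- squares differ by at most δ². The two square roots produce the exponent 1/4.
  set δ := √(8 * T' ^ 2 * (K * √(2 * ε))) with hδ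
  have hδ0 : 0 ≤ δ := Real.sqrt_nonneg _
  have hms : MeasurableSet {x | ‖s - sectionWidth f v i c x‖ < ε} :=
    measurableSet_lt (measurable_const.sub (hf.measurable_sectionWidth i c)).norm measurable_const
  rw [Measure.restrict_apply hms]
  have hnorm : ∀ x ∈ slab f v i c, ‖coord b (x - v)‖ ≤ T' := fun x hx =>
    (norm_coord_le b _).trans (((norm_sub_le _ _).trans (by linarith [hT x hx])).trans
      (le_max_right R (T + ‖v‖)))
  have hpair : ∀ x y, x ∈ slab f v i c → y ∈ slab f v i c →
      ‖s - sectionWidth f v i c x‖ < ε → ‖s - sectionWidth f v i c y‖ < ε →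
      (∀ b', b' ≠ b → coord b' x = coord b' y) →
      ‖coord b (x - v)‖ ≤ ‖coord b (y - v)‖ + δ := by
    intro x y hx hy hsx hsy hxy
    by_contra h
    push Not at h
    have hle : ‖coord b (y - v)‖ ≤ ‖coord b (x - v)‖ := by linarith
    have h1 := hf.potential_sub_ge b T' (le_max_left _ _) y x hle (hnorm x hx)
    have h2 := totalPotential_sub_of_coord_eq (f := f) hxy
    have h3 := hf.profile_halfWidth i hx.2
    have h4 := hf.profile_halfWidth i hy.2
    have h5 := hK (sectionWidth f v i c y) (sectionWidth f v i c x)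
    rw [sectionWidth, sectionWidth, h3, h4] at h5
    have h6 : |sectionWidth f v i c y - sectionWidth f v i c x| ≤ 2 * ε := by
      rw [Real.norm_eq_abs, abs_lt] at hsx hsy
      rw [abs_le]; constructor <;> linarith [hsx.1, hsx.2, hsy.1, hsy.2]
    have h7 : √|sectionWidth f v i c y - sectionWidth f v i c x| ≤ √(2 * ε) := Real.sqrt_le_sqrt h6
    have h8 : restPotential f i x - restPotential f i y =
        weight b * (potential b f x - potential b f y) := by
      rw [← h2, restPotential, restPotential, potential_congr (hxy _ hb.symm)]; ring
    have h9 : restPotential f i x - restPotential f i y ≤ K * √(2 * ε) := by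
      have h10 := (le_abs_self _).trans h5
      have h11 : K * √|sectionWidth f v i c y - sectionWidth f v i c x| ≤ K * √(2 * ε) := by gcongr
      have h12 : c - restPotential f i y - (c - restPotential f i x) =
        restPotential f i x - restPotential f i y := by ring
      rw [h12] at h10
      exact h10.trans h11
    have h13 : potential b f x - potential b f y ≤ K * √(2 * ε) := by
      have := one_le_weight b
      have : 0 ≤ potential b f x - potential b f y := sub_nonneg.2 (hf.potential_le b hle)
      nlinarith
    have hT'p : 0 < T' := hT0.trans_le hTT'
    have h14 : ‖coord b (x - v)‖ ^ 2 - ‖coord b (y - v)‖ ^ 2 ≤ 8 * T' ^ 2 * (K * √(2 * ε)) := by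
      have := h1.trans h13
      rwa [div_le_iff₀ (by positivity), mul_comm] at this
    have h15 : δ ^ 2 = 8 * T' ^ 2 * (K * √(2 * ε)) := Real.sq_sqrt (by positivity)
    have h16 := norm_nonneg (coord b (y - v))
    nlinarith
  have hmain := hC ({x | ‖s - sectionWidth f v i c x‖ < ε} ∩ slab f v i c)
    (hms.inter (hf.measurableSet_slab i c)) (fun x hx => (hT x hx.2).trans hTT') v (2 * δ)
    fun x => ?_
  · refine hmain.trans (ENNReal.ofReal_le_ofReal (le_of_eq ?_))
    have e : δ = √(8 * T' ^ 2 * (K * √2)) * ε ^ (1 / 4 : ℝ) := by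
      rw [hδ, Real.sqrt_mul two_pos.le, ← mul_assoc, ← mul_assoc, Real.sqrt_mul (by positivity),
        ← mul_assoc]
      congr 1
      rw [Real.sqrt_eq_rpow, Real.sqrt_eq_rpow, ← Real.rpow_mul hε.le]
      norm_num
    rw [e]; ring
  · by_cases hex : ∃ y, y ∈ {x | ‖s - sectionWidth f v i c x‖ < ε} ∩ slab f v i c ∧
      ∀ b', b' ≠ b → coord b' y = coord b' x
    · obtain ⟨y, ⟨hy1, hy2⟩, hyx⟩ := hex
      have hyn := hnorm y hy2
      -- One point y of the fiber serves as reference: all others have b-radius within δ of it.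
      refine ⟨max 0 (‖coord b (y - v)‖ - δ), min T' (‖coord b (y - v)‖ + δ), le_max_left _ _,
        le_min (max_le hT'0 (by linarith)) (max_le (by positivity) (by linarith)),
        min_le_left _ _, ?_, fun z hz hzx => ⟨max_le (norm_nonneg _) ?_, le_min (hnorm z hz.2) ?_⟩⟩
      · have := min_le_right T' (‖coord b (y - v)‖ + δ)
        have := le_max_right 0 (‖coord b (y - v)‖ - δ)
        linarith
      · have := hpair y z hy2 hz.2 hy1 hz.1 fun b' hb' => (hyx b' hb').trans (hzx b' hb').symm
        linarith
      · exact hpair z y hz.2 hy2 hz.1 hy1 fun b' hb' => (hzx b' hb').trans (hyx b' hb').symm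
    · exact ⟨0, 0, le_rfl, le_rfl, hT'0, by linarith, fun y hy hyx => (hex ⟨y, hy, hyx⟩).elim⟩

/-- The profile is a primitive of Q, which is continuous by the potential estimates applied to the
law of the half-widths with α = 1/4. The second coordinate b is essential: with a lone real
coordinate h is constant and Q has a logarithmic singularity at h. -/
theorem contDiffOn_potential_inl (hf : IsRadial f v R) (i : ι) {c : ℝ}
    (hc : f =ᵐ[volume] {x | totalPotential f x < c}.indicator 1) {b : ι ⊕ κ} (hb : b ≠ .inl i) :
    ContDiffOn ℝ 1 (potential (.inl i) f) {x : V ι κ | coord (.inl i) (x - v) ≠ 0} := by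
  obtain ⟨T, hT0, hT⟩ := hf.exists_norm_le_of_mem_slab i c
  obtain ⟨C, hC0, hC⟩ := hf.volume_sectionWidth_near_le i c hb
  obtain ⟨B, hB⟩ := hf.exists_sectionWidth_le i c
  set m := (volume : Measure (V ι κ)).restrict (slab f v i c)
  have : IsFiniteMeasure m := by
    refine isFiniteMeasure_of_le (T := T) (Measure.restrict_mono (fun x hx => ?_) le_rfl)
    exact mem_closedBall_zero_iff.2 (hT x hx)
  have hY := hf.measurable_sectionWidth i c
  have hq4 : (0 : ℝ) < 1 / 4 := by norm_num
  have hBae : ∀ᵐ x ∂m, ‖sectionWidth f v i c x‖ ≤ B := Filter.Eventually.of_forall hB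
  set L : ℝ → ℝ := fun s => ∫ x, Real.log ‖s - sectionWidth f v i c x‖ ∂m with hL
  have hLc : Continuous L := continuous_integral_log_norm_sub hY hC0 hq4 hC hBae
  set Q : ℝ → ℝ := fun r => L (-r) - L r with hQ
  have hQc : Continuous Q := (hLc.comp continuous_neg).sub hLc
  have hint : ∀ r, 0 ≤ r → profile f v i r = profile f v i 0 + ∫ s in (0 : ℝ)..r, Q s := by
    intro r hr
    obtain ⟨i1, e1⟩ := hf.profile_eq_integral i hc r
    obtain ⟨i0, e0⟩ := hf.profile_eq_integral i hc 0
    have hfin : ∀ᵐ t ∂(volume.restrict (Ioc 0 r)), ‖t‖ ≤ r := by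
      filter_upwards [ae_restrict_mem measurableSet_Ioc] with t ht
      rw [Real.norm_of_nonneg ht.1.le]; exact ht.2
    have j1 := integrable_prod_log_norm_sub (θ := volume.restrict (Ioc 0 r)) hY hC0 hq4 hC hBae
      (s := fun t : ℝ => -t) (by fun_prop) (B := r) (by simpa only [norm_neg] using hfin)
    have j2 := integrable_prod_log_norm_sub (θ := volume.restrict (Ioc 0 r)) hY hC0 hq4 hC hBae
      (s := fun t : ℝ => t) (by fun_prop) (B := r) hfin
    have hswap := integral_integral_swap (μ := volume.restrict (Ioc 0 r)) (ν := m)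
      (f := fun (t : ℝ) (x : V ι κ) => Real.log ‖-t - sectionWidth f v i c x‖ -
        Real.log ‖t - sectionWidth f v i c x‖) (j1.sub j2)
    have hleft : ∫ s in (0 : ℝ)..r, Q s = ∫ t in Ioc 0 r, ∫ x, (Real.log
        ‖-t - sectionWidth f v i c x‖ - Real.log ‖t - sectionWidth f v i c x‖) ∂m := by
      rw [intervalIntegral.integral_of_le hr]
      congr 1; ext t
      rw [integral_sub (integrable_log_norm_sub hY hC0 hq4 hC hBae _)
        (integrable_log_norm_sub hY hC0 hq4 hC hBae _)]
    rw [hleft, hswap, ← sub_eq_iff_eq_add', ← e1, ← e0, ← integral_sub i1 i0,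
      ← integral_indicator (hf.measurableSet_slab i c)]
    congr 1; ext x
    rw [← mul_sub, integral_log_interval_sub, intervalIntegral.integral_of_le hr]
    by_cases hx : x.1 i ∈ Icc (0 : ℝ) 1
    · rw [indicator_of_mem hx, Pi.one_apply, one_mul]
      -- When h = 0 the two logarithms cancel, so leaving empty sections out of the slab is
      -- harmless.
      rcases (hf.sectionWidth_nonneg i c x).eq_or_lt with h | h
      · rw [indicator_of_notMem (fun hxs : x ∈ slab f v i c => hxs.2.ne h), ← h]
        simp
      · rw [indicator_of_mem (show x ∈ slab f v i c from ⟨hx, h⟩)]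
        congr 1; ext t
        rw [Real.norm_eq_abs, Real.norm_eq_abs, Real.log_abs, Real.log_abs, ← Real.log_neg_eq_log]
        congr 2; ring
    · rw [indicator_of_notMem hx, zero_mul,
        indicator_of_notMem fun hxs : x ∈ slab f v i c => hx hxs.1]
  refine contDiffOn_of_eq_comp_norm (φ := profile f v i) (φ' := Q)
    (fun x _ => hf.potential_eq_profile_norm i x) (fun r hr => ?_) hQc.continuousOn
  have h1 : HasDerivAt (fun r => profile f v i 0 + ∫ s in (0 : ℝ)..r, Q s) (Q r) r :=
    (hQc.integral_hasStrictDerivAt 0 r).hasDerivAt.const_add _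
  refine h1.congr_of_eventuallyEq ?_
  filter_upwards [lt_mem_nhds hr] with s hs
  exact hint s hs.le

end IsRadial

end RealCoordinate

/-! ### The shape of minimizers -/

section Shape

set_option linter.unusedSectionVars false

variable {ι κ : Type*} [Fintype ι] [Fintype κ] {v : V ι κ} {R c : ℝ} {f : V ι κ → ℝ}

theorem isOpen_VUnits : IsOpen (VUnits ι κ) := by
  have : VUnits ι κ = ⋂ a, {x : V ι κ | coord a x ≠ 0} := by
    ext x
    rw [mem_iInter]
    exact normV_ne_zero_iff
  rw [this]
  exact isOpen_iInter_of_finite fun a => isOpen_ne_fun (coord a).continuous continuous_const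

theorem densityMeasure_eq_restrict {U : Set (V ι κ)} (hU : MeasurableSet U)
    (hc : f =ᵐ[volume] U.indicator 1) : densityMeasure f = volume.restrict U := by
  rw [← withDensity_indicator_one hU, densityMeasure]
  refine withDensity_congr_ae ?_
  filter_upwards [hc] with x hx
  rw [hx]
  by_cases h : x ∈ U <;> simp [h]

theorem norm_coord_smul_sub (a : ι ⊕ κ) (x v : V ι κ) {t : ℝ} (ht : 0 ≤ t) :
    ‖coord a (v + t • (x - v) - v)‖ = t * ‖coord a (x - v)‖ := by
  rw [add_sub_cancel_left, map_smul, norm_smul, Real.norm_of_nonneg ht]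

theorem exists_coord_ne_zero {x : V ι κ} (hx : x ≠ v) : ∃ a, coord a (x - v) ≠ 0 := by
  by_contra h
  push Not at h
  exact hx (ext_coord fun a => sub_eq_zero.1 (by rw [← map_sub]; exact h a))

namespace IsRadial

theorem totalPotential_smul_lt (hf : IsRadial f v R) {x : V ι κ} (hx : x ≠ v) {t : ℝ} (ht : 0 ≤ t)
    (ht1 : t < 1) : totalPotential f (v + t • (x - v)) < totalPotential f x := by
  obtain ⟨a, ha⟩ := exists_coord_ne_zero hx
  refine hf.totalPotential_lt (fun b => ?_) (a := a) ?_
  · rw [norm_coord_smul_sub b x v ht]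
    exact mul_le_of_le_one_left (norm_nonneg _) ht1.le
  · rw [norm_coord_smul_sub a x v ht]
    exact mul_lt_of_lt_one_left (norm_pos_iff.2 ha) ht1

/-- A point of the level set other than v is a limit of points on its ray towards v, where the
potential is strictly smaller. -/
theorem mem_frontier_iff (hf : IsRadial f v R) {x : V ι κ} (hx : x ≠ v) :
    x ∈ frontier {x | totalPotential f x < c} ↔ totalPotential f x = c := by
  have hcont := continuous_totalPotential hf.toIsProbDensity
  refine ⟨fun h => frontier_lt_subset_eq hcont continuous_const h, fun h => ?_⟩
  rw [(isOpen_lt hcont continuous_const).frontier_eq]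
  refine ⟨?_, fun h' => (ne_of_lt h') h⟩
  have hlim : Filter.Tendsto (fun t : ℝ => v + t • (x - v)) (nhdsWithin 1 (Iio 1)) (nhds x) := by
    have : Continuous fun t : ℝ => v + t • (x - v) := by fun_prop
    have h1 := this.tendsto 1
    rw [one_smul, add_sub_cancel] at h1
    exact h1.mono_left nhdsWithin_le_nhds
  refine mem_closure_of_tendsto hlim ?_
  filter_upwards [self_mem_nhdsWithin,
    nhdsWithin_le_nhds (lt_mem_nhds (zero_lt_one (α := ℝ)))] with t ht ht0
  exact (hf.totalPotential_smul_lt hx ht0.le ht).trans_eq h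

theorem smul_closure_subset (hf : IsRadial f v R) (hne : {x | totalPotential f x < c}.Nonempty)
    {t : ℝ} (ht : 0 < t) (ht1 : t < 1) :
    t • ((fun x => x - v) '' closure {x | totalPotential f x < c}) ⊆
      (fun x => x - v) '' {x | totalPotential f x < c} := by
  rintro _ ⟨_, ⟨x, hx, rfl⟩, rfl⟩
  have hxc : totalPotential f x ≤ c :=
    closure_lt_subset_le (continuous_totalPotential hf.toIsProbDensity) continuous_const hx
  refine ⟨v + t • (x - v), ?_, by simp⟩
  -- The center is fixed by the dilation; it belongs to the set because the potential is minimal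
  -- there and the set is nonempty.
  rcases eq_or_ne x v with rfl | h
  · obtain ⟨y, hy⟩ := hne
    rw [sub_self, smul_zero, add_zero]
    exact (hf.totalPotential_le fun a => by simp).trans_lt hy
  · exact (hf.totalPotential_smul_lt h ht.le ht1).trans_le hxc

/-- The derivative of the potential in the radial direction does not vanish. -/
theorem fderiv_totalPotential_ne_zero (hf : IsRadial f v R) {x : V ι κ} (hx : x ≠ v)
    (hd : DifferentiableAt ℝ (totalPotential f) x) : fderiv ℝ (totalPotential f) x ≠ 0 := by
  intro h0
  obtain ⟨a, ha⟩ := exists_coord_ne_zero hx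
  set N := ‖coord a (x - v)‖
  have hN : 0 < N := norm_pos_iff.2 ha
  set T := max R N
  have hT : 0 < T := lt_max_of_lt_left hf.radius_pos
  have hd1 : HasDerivAt (fun t : ℝ => totalPotential f (v + t • (x - v))) 0 1 := by
    have e : v + (1 : ℝ) • (x - v) = x := by simp
    have h1 : HasFDerivAt (totalPotential f) (0 : V ι κ →L[ℝ] ℝ) (v + (1 : ℝ) • (x - v)) := by
      rw [e, ← h0]; exact hd.hasFDerivAt
    have h2 : HasDerivAt (fun t : ℝ => v + t • (x - v)) ((1 : ℝ) • (x - v)) 1 :=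
      ((hasDerivAt_id (1 : ℝ)).smul_const (x - v)).const_add v
    exact h1.comp_hasDerivAt (1 : ℝ) h2
  have hlow : ∀ t : ℝ, 0 ≤ t → t < 1 →
      N ^ 2 / (8 * T ^ 2) * (1 - t) ≤
        totalPotential f x - totalPotential f (v + t • (x - v)) := by
    intro t ht ht1
    have hle : ∀ b, ‖coord b (v + t • (x - v) - v)‖ ≤ ‖coord b (x - v)‖ := fun b => by
      rw [norm_coord_smul_sub b x v ht]
      exact mul_le_of_le_one_left (norm_nonneg _) ht1.le
    have h1 := hf.potential_sub_ge a T (le_max_left _ _) _ x (hle a) (le_max_right _ _)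
    rw [norm_coord_smul_sub a x v ht] at h1
    have h2 : potential a f x - potential a f (v + t • (x - v)) ≤
        totalPotential f x - totalPotential f (v + t • (x - v)) := by
      rw [totalPotential, totalPotential, ← Finset.sum_sub_distrib]
      have hpos : ∀ b, 0 ≤ potential b f x - potential b f (v + t • (x - v)) := fun b =>
        sub_nonneg.2 (hf.potential_le b (hle b))
      have h3 := Finset.single_le_sum (f := fun b => weight b * potential b f x -
        weight b * potential b f (v + t • (x - v))) (fun b _ => by
          rw [← mul_sub]; exact mul_nonneg (weight_pos b).le (hpos b)) (Finset.mem_univ a)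
      refine le_trans ?_ h3
      rw [← mul_sub]
      exact le_mul_of_one_le_left (hpos a) (one_le_weight a)
    refine le_trans ?_ (h1.trans h2)
    rw [div_mul_eq_mul_div]
    gcongr
    have : t ^ 2 ≤ t := by nlinarith
    change N ^ 2 * (1 - t) ≤ N ^ 2 - (t * N) ^ 2
    nlinarith [sq_nonneg N]
  -- Slopes from the left along the ray are at least N² / (8T²) > 0, which contradicts the limit 0.
  have hs := hd1.tendsto_slope
  have hs' := hs.mono_left (nhdsWithin_mono (1 : ℝ)
    (show Iio (1 : ℝ) ⊆ {1}ᶜ from fun t ht => ne_of_lt ht))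
  have hge := ge_of_tendsto (b := N ^ 2 / (8 * T ^ 2)) hs' (by
    filter_upwards [self_mem_nhdsWithin,
      nhdsWithin_le_nhds (lt_mem_nhds (zero_lt_one (α := ℝ)))] with t ht ht0
    have ht1 : t < 1 := ht
    have := hlow t ht0.le ht1
    rw [slope_def_field, one_smul, add_sub_cancel, le_div_iff_of_neg (by linarith)]
    linarith)
  have : 0 < N ^ 2 / (8 * T ^ 2) := by positivity
  linarith

theorem contDiffOn_totalPotential [Nontrivial (ι ⊕ κ)] (hf : IsRadial f v R)
    (hc : f =ᵐ[volume] {x | totalPotential f x < c}.indicator 1) :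
    ContDiffOn ℝ 1 (totalPotential f) {x | x - v ∈ VUnits ι κ} := by
  have hsub : ∀ a, {x : V ι κ | x - v ∈ VUnits ι κ} ⊆ {x | coord a (x - v) ≠ 0} :=
    fun a x hx => normV_ne_zero_iff.1 hx a
  refine ContDiffOn.sum fun a _ => contDiffOn_const.mul ?_
  rcases a with i | j
  · obtain ⟨b, hb⟩ := exists_ne (Sum.inl i : ι ⊕ κ)
    exact (hf.contDiffOn_potential_inl i hc hb).mono (hsub _)
  · exact (hf.contDiffOn_potential_inr j).mono (hsub _)

theorem isC1Hypersurface_of_nontrivial [Nontrivial (ι ⊕ κ)] (hf : IsRadial f v R)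
    (hc : f =ᵐ[volume] {x | totalPotential f x < c}.indicator 1) :
    IsC1Hypersurface
      (((fun x => x - v) '' frontier {x | totalPotential f x < c}) ∩ VUnits ι κ) := by
  obtain ⟨a₀⟩ : Nonempty (ι ⊕ κ) := inferInstance
  intro x hx
  have hne : ∀ y ∈ VUnits ι κ, y + v ≠ v := fun y hy h => by
    have := normV_ne_zero_iff.1 hy a₀
    rw [add_eq_right.1 h] at this
    simp at this
  have hCD : ContDiffOn ℝ 1 (fun y => totalPotential f (y + v)) (VUnits ι κ) :=
    (hf.contDiffOn_totalPotential hc).comp (contDiff_id.add contDiff_const).contDiffOn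
      fun y hy => by simpa using hy
  refine ⟨VUnits ι κ, isOpen_VUnits, hx.2, fun y => totalPotential f (y + v) - c,
    hCD.sub contDiffOn_const, fun y hy => ?_, ?_⟩
  · rw [fderiv_sub_const, fderiv_comp_add_right]
    have hd := ((hCD.contDiffAt (isOpen_VUnits.mem_nhds hy)).differentiableAt one_ne_zero)
    refine hf.fderiv_totalPotential_ne_zero (hne y hy) ?_
    exact (differentiableAt_comp_add_right v).1 hd
  · ext y
    simp only [mem_inter_iff, mem_image, mem_ofPred_eq, sub_eq_zero]
    constructor
    · rintro ⟨⟨⟨z, hz, rfl⟩, hzu⟩, -⟩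
      refine ⟨hzu, ?_⟩
      have := hne _ hzu
      rw [sub_add_cancel] at this ⊢
      exact (hf.mem_frontier_iff this).1 hz
    · rintro ⟨hyu, hy⟩
      exact ⟨⟨⟨y + v, (hf.mem_frontier_iff (hne y hyu)).2 hy, by simp⟩, hyu⟩, hyu⟩

/-- The level set is a sphere about v, cut out by the square of the norm. This polynomial replaces
the potential, which need not be C¹ at the boundary for a lone real coordinate. -/
theorem isC1Hypersurface_of_subsingleton [Subsingleton (ι ⊕ κ)] [Nonempty (ι ⊕ κ)]
    (hf : IsRadial f v R) :
    IsC1Hypersurface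
      (((fun x => x - v) '' frontier {x | totalPotential f x < c}) ∩ VUnits ι κ) := by
  obtain ⟨a⟩ := ‹Nonempty (ι ⊕ κ)›
  rintro _ ⟨⟨x, hx, rfl⟩, hxu⟩
  have hxu' : x - v ∈ VUnits ι κ := hxu
  have hne : ∀ y, y - v ∈ VUnits ι κ → y ≠ v := fun y hy h => by
    have := normV_ne_zero_iff.1 hy a
    rw [h] at this
    simp at this
  have hxc := (hf.mem_frontier_iff (hne x hxu')).1 hx
  have hlev : ∀ y, totalPotential f y = c ↔ ‖coord a (y - v)‖ = ‖coord a (x - v)‖ := by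
    intro y
    have h1 := totalPotential_sub_of_coord_eq (f := f) (a := a) (x := y) (y := x)
      fun b hb => absurd (Subsingleton.elim b a) hb
    constructor
    · intro hy
      rw [hy, hxc, sub_self] at h1
      refine hf.norm_coord_eq a (sub_eq_zero.1 ?_)
      exact (mul_eq_zero.1 h1.symm).resolve_left (weight_pos a).ne'
    · intro hy
      rw [le_antisymm (hf.potential_le a hy.le) (hf.potential_le a hy.ge), sub_self, mul_zero,
        hxc] at h1
      linarith
  refine ⟨VUnits ι κ, isOpen_VUnits, hxu, fun y => ‖coord a y‖ ^ 2 - ‖coord a (x - v)‖ ^ 2,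
    ((coord a).contDiff.norm_sq ℝ).contDiffOn.sub contDiffOn_const, fun y hy h0 => ?_, ?_⟩
  · have hya : 0 < ‖coord a y‖ := norm_pos_iff.2 (normV_ne_zero_iff.1 hy a)
    rw [fderiv_sub_const] at h0
    have h1 : HasFDerivAt (fun y : V ι κ => ‖coord a y‖ ^ 2) _ y :=
      (coord a).hasFDerivAt.norm_sq
    rw [h1.fderiv] at h0
    -- Evaluating the derivative in the direction y itself gives 2‖coord a y‖².
    have h2 := congrArg (fun φ : V ι κ →L[ℝ] ℝ => φ y) h0
    simp at h2
    exact hya.ne' (by simpa using h2)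
  · ext y
    simp only [mem_inter_iff, mem_image, mem_ofPred_eq, sub_eq_zero]
    rw [sq_eq_sq₀ (norm_nonneg _) (norm_nonneg _)]
    constructor
    · rintro ⟨⟨⟨z, hz, rfl⟩, hzu⟩, -⟩
      exact ⟨hzu, (hlev z).1 ((hf.mem_frontier_iff (hne z hzu)).1 hz)⟩
    · rintro ⟨hyu, hy⟩
      have hyu' : y + v - v ∈ VUnits ι κ := by rwa [add_sub_cancel_right]
      refine ⟨⟨⟨y + v, (hf.mem_frontier_iff (hne _ hyu')).2 ((hlev _).2 ?_), by simp⟩, hyu⟩, hyu⟩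
      rwa [add_sub_cancel_right]

end IsRadial

end Shape

end LogNormEnergy

theorem mainTheorem9 {ι κ : Type*} [Fintype ι] [Fintype κ] (ν : Measure (LogNormEnergy.V ι κ))
    (hν : LogNormEnergy.IsEnergyMinimizer ν) :
    ∃ U : Set (LogNormEnergy.V ι κ), IsOpen U ∧ ν = volume.restrict U ∧
      ∃ v : LogNormEnergy.V ι κ,
        LogNormEnergy.IsC1Hypersurface
          (((fun x => x - v) '' frontier U) ∩ LogNormEnergy.VUnits ι κ) ∧
        ∀ t : ℝ, 0 < t → t < 1 →
          t • ((fun x => x - v) '' closure U) ⊆ (fun x => x - v) '' U := by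
  obtain ⟨f, hf, rfl⟩ := hν.exists_density
  rcases isEmpty_or_nonempty (ι ⊕ κ) with hempty | hnonempty
  -- Without coordinates V is a point of mass one, and U is the whole space, with empty frontier.
  · have hsub : Subsingleton (LogNormEnergy.V ι κ) :=
      ⟨fun x y => LogNormEnergy.ext_coord fun a => isEmptyElim a⟩
    have hconst : f = fun _ => f 0 := funext fun x => congrArg f (Subsingleton.elim x 0)
    have hvol : (volume : Measure (LogNormEnergy.V ι κ)).real univ = 1 := by
      have hι : IsEmpty ι := (isEmpty_sum.1 hempty).1
      have hκ : IsEmpty κ := (isEmpty_sum.1 hempty).2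
      rw [Measure.real, Measure.volume_eq_prod, ← univ_prod_univ, Measure.prod_prod,
        volume_pi, volume_pi, Measure.pi_empty_univ, Measure.pi_empty_univ]
      simp
    have hf0 : f 0 = 1 := by
      have := hf.1.integral_eq_one
      rw [hconst, integral_const, hvol, one_smul] at this
      exact this
    refine ⟨univ, isOpen_univ, LogNormEnergy.densityMeasure_eq_restrict MeasurableSet.univ ?_, 0,
      ?_, fun t _ _ => ?_⟩
    · refine Filter.Eventually.of_forall fun x => ?_
      rw [hconst]; simp [hf0]
    · rw [frontier_univ, image_empty, empty_inter]
      intro x hx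
      exact absurd hx (notMem_empty x)
    · simp
  · obtain ⟨R, hr⟩ := hf.exists_isRadial
    obtain ⟨c, hc⟩ := hf.ae_eq_indicator hr
    have hopen : IsOpen {x | LogNormEnergy.totalPotential f x < c} :=
      isOpen_lt (LogNormEnergy.continuous_totalPotential hf.1) continuous_const
    have hν' := LogNormEnergy.densityMeasure_eq_restrict hopen.measurableSet hc
    have hne : {x | LogNormEnergy.totalPotential f x < c}.Nonempty := by
      by_contra h
      have h1 := hf.1.densityMeasure_univ
      rw [hν', not_nonempty_iff_eq_empty.1 h] at h1
      simp at h1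
    refine ⟨_, hopen, hν', LogNormEnergy.barycenter f, ?_,
      fun t ht ht1 => hr.smul_closure_subset hne ht ht1⟩
    rcases subsingleton_or_nontrivial (ι ⊕ κ) with hs | hn
    · exact hr.isC1Hypersurface_of_subsingleton
    · exact hr.isC1Hypersurface_of_nontrivial hc
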